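/- Let $Q$ be a finite-dimensional smooth manifold with tangent bundle projection $\tau:TQ\to Q$, let $L:TQ\to\mathbb R$ be a smooth regular Lagrangian (its fibre Hessian is nonsingular), with Legendre transformation $\mathbb FL:TQ\to T^*Q$, $\langle\mathbb FL(u_q),w_q\rangle=\frac{d}{dt}\big|_{t=0}L(u_q+tw_q)$, energy $E_L(v)=\langle\mathbb FL(v),v\rangle-L(v)$ and Poincaré–Cartan two-form $\omega_L=-d(S^*dL)$, where $S$ is the vertical endomorphism of $TTQ$. Let $\mathcal D\subseteq TQ$ be a smooth distribution and put $F^o_v=S^*((T_v\mathcal D)^o)$ for $v\in\mathcal D$. Assume that the nonholonomic system $(Q,L,\mathcal D)$ is regular: for all $v\in\mathcal D$, $\dim (T_v\mathcal D)^o=\dim F^o_v$, and $T_v\mathcal D\cap\sharp(F^o_v)=\{0\}$, where $\sharp$ is the inverse of $X\mapsto i_X\omega_L$. Let $\Gamma_{nh}$ be the vector field on $\mathcal D$ determined by $i_{\Gamma_{nh}}\omega_L-dE_L\in F^o$, let $\phi_t^{\Gamma_{nh}}$ be its flow, and let $F_{nh}:\mathcal D\to T^*Q$ be the nonholonomic external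 force, determined by $$i_{\Gamma_{nh}}\omega_L=dE_L-\tau^*F_{nh}\quad\text{along }\mathcal D ,$$ that is, $(F_{nh})_i=\frac{d}{dt}\frac{\partial L}{\partial\dot q^i}-\frac{\partial L}{\partial q^i}$ along the trajectories of $\Gamma_{nh}$. Let $h>0$ and let $\mathcal U_h\subseteq\mathcal D$ be an open subset of $\mathcal D$ on which the flow is defined for all $t\in[0,h]$ and on which the nonholonomic exponential map $\exp_h(v)=(\tau(v),\tau(\phi_h^{\Gamma_{nh}}(v)))$ is an embedding into $Q\times Q$, that is, a diffeomorphism onto the submanifold $\mathcal M_h^{e,nh}=\exp_h(\mathcal U_h)$. Let $R^{e-}_{h,nh}:\mathcal M_h^{e,nh}\to\mathcal U_h$ be its inverse and $R^{e+}_{h,nh}=\phi_h^{\Gamma_{nh}}\circ R^{e-}_{h,nh}$. Define the nonholonomic exact discrete Lagrangian $l_{d,nh}^{e,h}:\mathcal M_h^{e,nh}\to\mathbb R$ by $$l_{d,nh}^{e,h}(q_0,q_1)=\int_0^h\bigl(L\circ\phi_t^{\Gamma_{nh}}\circ R^{e-}_{h,nh}\bigr)(q_0,q_1)\,dt .$$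 Then for every $(q_0,q_1)\in\mathcal M_h^{e,nh}$ this integral exists, $l_{d,nh}^{e,h}$ is differentiable at $(q_0,q_1)$, as are the maps $\tau\circ\phi_t^{\Gamma_{nh}}\circ R^{e-}_{h,nh}:\mathcal M_h^{e,nh}\to Q$ for $t\in[0,h]$, and for every $(X_{q_0},X_{q_1})\in T_{(q_0,q_1)}\mathcal M_h^{e,nh}\subseteq T_{q_0}Q\times T_{q_1}Q$, with $\gamma_0(t)=(\phi_t^{\Gamma_{nh}}\circ R^{e-}_{h,nh})(q_0,q_1)$ and $$X_{01}(t)=T_{(q_0,q_1)}\bigl(\tau\circ\phi_t^{\Gamma_{nh}}\circ R^{e-}_{h,nh}\bigr)(X_{q_0},X_{q_1}),$$ the curve $X_{01}:[0,h]\to TQ$ is smooth, $t\mapsto\langle F_{nh}(\gamma_0(t)),X_{01}(t)\rangle$ is integrable on $[0,h]$, and $$\bigl\langle dl_{d,nh}^{e,h}(q_0,q_1),(X_{q_0},X_{q_1})\bigr\rangle=-\int_0^h\langle F_{nh}(\gamma_0(t)),X_{01}(t)\rangle\,dt+\langle\mathbb FL(R^{e+}_{h,nh}(q_0,q_1)),X_{q_1}\rangle-\langle\mathbb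 FL(R^{e-}_{h,nh}(q_0,q_1)),X_{q_0}\rangle .$$ -/

import Mathlib

open Set MeasureTheory
open scoped Manifold ContDiff Topology

noncomputable section

namespace Nonholonomic

section Submanifold

variable {V : Type*} [NormedAddCommGroup V] [NormedSpace ℝ V]
  {H : Type*} [TopologicalSpace H] {N : Type*} [TopologicalSpace N] [ChartedSpace H N]

/-- `X` is the velocity at time `0` of a smooth curve `(-ε, ε) → N` through `p` that stays in
the subset `S` of the manifold `N`. -/
def IsVelocityIn (J : ModelWithCorners ℝ V H) (S : Set N) (p : N) (X : TangentSpace J p) : Prop :=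
  ∃ (ε : ℝ) (c : ℝ → N), 0 < ε ∧ ContMDiffOn 𝓘(ℝ, ℝ) J ∞ c (Ioo (-ε) ε) ∧
    (∀ s ∈ Ioo (-ε) ε, c s ∈ S) ∧ c 0 = p ∧
    HasMFDerivAt 𝓘(ℝ, ℝ) J c 0 ((1 : ℝ →L[ℝ] ℝ).smulRight (X : V))

/-- The tangent space `T_p S ⊆ T_p N` of a subset `S` of a manifold `N`, spanned by the velocities
of smooth curves in `S`. If `S` is an embedded submanifold, these velocities already form a
subspace, and this is the image of the tangent space of `S` under the tangent map of the
inclusion. -/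
def tangentSubspace (J : ModelWithCorners ℝ V H) (S : Set N) (p : N) :
    Submodule ℝ (TangentSpace J p) :=
  Submodule.span ℝ {X | IsVelocityIn J S p X}

variable {V' : Type*} [NormedAddCommGroup V'] [NormedSpace ℝ V']
  {H' : Type*} [TopologicalSpace H'] {N' : Type*} [TopologicalSpace N'] [ChartedSpace H' N']

/-- On vectors tangent to `S`, any two derivatives within `S` of a map agree: for a map defined on
an embedded submanifold `S`, `mfderivWithin` restricted to `tangentSubspace` is its tangent map. -/
theorem mfderivWithin_apply_eq_of_mem_tangentSubspace
    {J : ModelWithCorners ℝ V H} {J' : ModelWithCorners ℝ V' H'} {S : Set N} {p : N} {f : N → N'}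
    {f' : TangentSpace J p →L[ℝ] TangentSpace J' (f p)} (hf : HasMFDerivWithinAt J J' f S p f')
    {X : TangentSpace J p} (hX : X ∈ tangentSubspace J S p) :
    mfderivWithin J J' f S p X = f' X := by
  have hg := hf.mdifferentiableWithinAt.hasMFDerivWithinAt
  induction hX using Submodule.span_induction with
  | mem X hX =>
    obtain ⟨ε, c, hε, -, hcS, rfl, hc⟩ := hX
    have hn : Ioo (-ε) ε ∈ 𝓝 (0 : ℝ) := Ioo_mem_nhds (by linarith) hε
    have hsub : Ioo (-ε) ε ⊆ c ⁻¹' S := fun s hs => hcS s hs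
    have h1 := (hf.comp (0 : ℝ) hc.hasMFDerivWithinAt hsub).hasMFDerivAt hn
    have h2 := (hg.comp (0 : ℝ) hc.hasMFDerivWithinAt hsub).hasMFDerivAt hn
    have h3 := congrArg (fun A : ℝ →L[ℝ] V' => A 1) (hasMFDerivAt_unique h2 h1)
    have e : ((1 : ℝ →L[ℝ] ℝ).smulRight (X : V)) 1 = (X : V) := by simp
    have h4 : mfderivWithin J J' f S (c 0) (((1 : ℝ →L[ℝ] ℝ).smulRight (X : V)) 1)
        = f' (((1 : ℝ →L[ℝ] ℝ).smulRight (X : V)) 1) := h3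
    rw [e] at h4
    exact h4
  | zero => rw [map_zero, map_zero]
  | add x y _ _ hx hy => rw [map_add, map_add, hx, hy]
  | smul a x _ hx => rw [map_smul, map_smul, hx]

end Submanifold

variable {E : Type*} [NormedAddCommGroup E] [NormedSpace ℝ E]
  {Q : Type*} [TopologicalSpace Q] [ChartedSpace E Q] [IsManifold 𝓘(ℝ, E) ∞ Q]

/-- The tangent bundle projection. -/
abbrev proj (v : TangentBundle 𝓘(ℝ, E) Q) : Q := v.proj

/-- The Legendre transformation: `⟨FL(u_q), w_q⟩ = d/dt L(u_q + t w_q)` at `t = 0`, the derivative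
of `L` along the fibre `T_q Q`. -/
def legendre (L : TangentBundle 𝓘(ℝ, E) Q → ℝ) (v : TangentBundle 𝓘(ℝ, E) Q) :
    TangentSpace 𝓘(ℝ, E) v.proj →L[ℝ] ℝ :=
  fderiv ℝ (fun u : E => L ⟨v.proj, u⟩) v.2

/-- `L` is regular: its fibre Hessian `∂²L/∂q̇ⁱ∂q̇ʲ` is nonsingular at every point. -/
def IsRegularLagrangian (L : TangentBundle 𝓘(ℝ, E) Q → ℝ) : Prop :=
  ∀ v : TangentBundle 𝓘(ℝ, E) Q, ∀ a : E,
    (∀ b : E, fderiv ℝ (fderiv ℝ (fun u : E => L ⟨v.proj, u⟩)) v.2 a b = 0) → a = 0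

/-- The energy `E_L = Δ L - L`. -/
def energy (L : TangentBundle 𝓘(ℝ, E) Q → ℝ) (v : TangentBundle 𝓘(ℝ, E) Q) : ℝ :=
  legendre L v v.2 - L v

/-- The differential of the energy. -/
def dEnergy (L : TangentBundle 𝓘(ℝ, E) Q → ℝ) (v : TangentBundle 𝓘(ℝ, E) Q) :
    TangentSpace 𝓘(ℝ, E).tangent v →L[ℝ] ℝ :=
  mfderiv 𝓘(ℝ, E).tangent 𝓘(ℝ, ℝ) (energy L) v

/-- The Poincaré–Cartan one-form `θ_L = S^* dL = (∂L/∂q̇ⁱ) dqⁱ`, in the natural coordinates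
`(q, q̇)` on `TQ` induced by the chart of `Q` at `τ(v)`. -/
def poincareCartanOneForm (L : TangentBundle 𝓘(ℝ, E) Q → ℝ) (v : TangentBundle 𝓘(ℝ, E) Q)
    (z : E × E) : E × E →L[ℝ] ℝ :=
  (fderiv ℝ (fun z : E × E => L ((extChartAt 𝓘(ℝ, E).tangent v).symm z)) z) ∘L
    ((ContinuousLinearMap.inr ℝ E E) ∘L (ContinuousLinearMap.fst ℝ E E))

/-- The contraction `i_X ω_L` at `v`, for the Poincaré–Cartan two-form `ω_L = -dθ_L`, that is,
`ω_L(X, Y) = (D_Y θ_L)(X) - (D_X θ_L)(Y)` in the natural coordinates around `v`. (Vectors in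
`T_v TQ` are represented in just these coordinates.) -/
def contractOmega (L : TangentBundle 𝓘(ℝ, E) Q → ℝ) (v : TangentBundle 𝓘(ℝ, E) Q)
    (X : TangentSpace 𝓘(ℝ, E).tangent v) : TangentSpace 𝓘(ℝ, E).tangent v →L[ℝ] ℝ :=
  let A : E × E →L[ℝ] E × E →L[ℝ] ℝ :=
    fderiv ℝ (poincareCartanOneForm L v) (extChartAt 𝓘(ℝ, E).tangent v v)
  (A.flip (X : E × E) - A (X : E × E) : E × E →L[ℝ] ℝ)

/-- The tangent map `T_v τ` of the tangent bundle projection `τ : TQ → Q`. -/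
def tangentProj (v : TangentBundle 𝓘(ℝ, E) Q) :
    TangentSpace 𝓘(ℝ, E).tangent v →L[ℝ] TangentSpace 𝓘(ℝ, E) v.proj :=
  mfderiv 𝓘(ℝ, E).tangent 𝓘(ℝ, E) (proj : TangentBundle 𝓘(ℝ, E) Q → Q) v

/-- The vertical lift `w ↦ w^V_v = d/dt (v + t w)` at `t = 0`, the tangent map at `v` of the
inclusion of the fibre `T_q Q` in `TQ`. -/
def verticalLift (v : TangentBundle 𝓘(ℝ, E) Q) :
    TangentSpace 𝓘(ℝ, E) v.proj →L[ℝ] TangentSpace 𝓘(ℝ, E).tangent v :=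
  mfderiv 𝓘(ℝ, E) 𝓘(ℝ, E).tangent (fun u : E => (⟨v.proj, u⟩ : TangentBundle 𝓘(ℝ, E) Q)) v.2

/-- The vertical endomorphism `S(X) = (T_v τ (X))^V_v` of `T_v TQ`. -/
def verticalEndo (v : TangentBundle 𝓘(ℝ, E) Q) :
    TangentSpace 𝓘(ℝ, E).tangent v →L[ℝ] TangentSpace 𝓘(ℝ, E).tangent v :=
  (verticalLift v) ∘L (tangentProj v)

/-- A smooth distribution `D` on `Q`: locally it is the common kernel of finitely many smooth
one-forms `μ¹, …, μᵏ` that are linearly independent at each point. Smoothness of `μᵃ` is stated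
as smoothness of the constraint function `Φᵃ(v_q) = ⟨μᵃ(q), v_q⟩`. -/
def IsSmoothDistribution (D : (q : Q) → Submodule ℝ (TangentSpace 𝓘(ℝ, E) q)) : Prop :=
  ∀ q₀ : Q, ∃ (W : Set Q) (k : ℕ) (μ : Fin k → (q : Q) → TangentSpace 𝓘(ℝ, E) q →ₗ[ℝ] ℝ),
    IsOpen W ∧ q₀ ∈ W ∧
    (∀ a, ContMDiffOn 𝓘(ℝ, E).tangent 𝓘(ℝ, ℝ) ∞
      (fun v : TangentBundle 𝓘(ℝ, E) Q => μ a v.proj v.2) (proj ⁻¹' W)) ∧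
    ∀ q ∈ W, LinearIndependent ℝ (fun a => μ a q) ∧
      ∀ w : TangentSpace 𝓘(ℝ, E) q, w ∈ D q ↔ ∀ a, μ a q w = 0

/-- The distribution as a subset of `TQ`. -/
def constraintSet (D : (q : Q) → Submodule ℝ (TangentSpace 𝓘(ℝ, E) q)) :
    Set (TangentBundle 𝓘(ℝ, E) Q) :=
  {v | v.2 ∈ D v.proj}

/-- `T_v D ⊆ T_v TQ`. -/
def tangentD (D : (q : Q) → Submodule ℝ (TangentSpace 𝓘(ℝ, E) q))
    (v : TangentBundle 𝓘(ℝ, E) Q) : Submodule ℝ (TangentSpace 𝓘(ℝ, E).tangent v) :=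
  tangentSubspace 𝓘(ℝ, E).tangent (constraintSet D) v

/-- The annihilator `(T_v D)°`. -/
def tangentDAnn (D : (q : Q) → Submodule ℝ (TangentSpace 𝓘(ℝ, E) q))
    (v : TangentBundle 𝓘(ℝ, E) Q) :
    Submodule ℝ (Module.Dual ℝ (TangentSpace 𝓘(ℝ, E).tangent v)) :=
  (tangentD D v).dualAnnihilator

/-- The space of reaction forces `F°_v = S^*((T_v D)°)`. -/
def reactionForms (D : (q : Q) → Submodule ℝ (TangentSpace 𝓘(ℝ, E) q))
    (v : TangentBundle 𝓘(ℝ, E) Q) :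
    Submodule ℝ (Module.Dual ℝ (TangentSpace 𝓘(ℝ, E).tangent v)) :=
  (tangentDAnn D v).map (verticalEndo v).toLinearMap.dualMap

/-- The nonholonomic system `(Q, L, D)` is regular. In the compatibility condition
`T_v D ∩ ♯(F°_v) = 0`, the map `♯` is the inverse of `X ↦ i_X ω_L`. -/
structure IsRegularSystem (L : TangentBundle 𝓘(ℝ, E) Q → ℝ)
    (D : (q : Q) → Submodule ℝ (TangentSpace 𝓘(ℝ, E) q)) : Prop where
  admissibility : ∀ v ∈ constraintSet D,
    Module.finrank ℝ (tangentDAnn D v) = Module.finrank ℝ (reactionForms D v)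
  compatibility : ∀ v ∈ constraintSet D, ∀ X ∈ tangentD D v,
    (contractOmega L v X).toLinearMap ∈ reactionForms D v → X = 0

/-- `X ∈ T_v D` solves the nonholonomic equation `i_X ω_L - dE_L ∈ F°` at `v`. -/
def IsNonholonomicVector (L : TangentBundle 𝓘(ℝ, E) Q → ℝ)
    (D : (q : Q) → Submodule ℝ (TangentSpace 𝓘(ℝ, E) q)) (v : TangentBundle 𝓘(ℝ, E) Q)
    (X : TangentSpace 𝓘(ℝ, E).tangent v) : Prop :=
  X ∈ tangentD D v ∧ (contractOmega L v X - dEnergy L v).toLinearMap ∈ reactionForms D v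

open Classical in
/-- The nonholonomic vector field `Γ_nh`, the solution of the nonholonomic equation along `D`
(unique there if the system is regular; its values off `D` are irrelevant). -/
def nonholonomicField (L : TangentBundle 𝓘(ℝ, E) Q → ℝ)
    (D : (q : Q) → Submodule ℝ (TangentSpace 𝓘(ℝ, E) q)) (v : TangentBundle 𝓘(ℝ, E) Q) :
    TangentSpace 𝓘(ℝ, E).tangent v :=
  if hX : ∃ X, IsNonholonomicVector L D v X then hX.choose else 0

open Classical in
/-- The nonholonomic external force `F_nh : D → T^*Q`, given by
`i_{Γ_nh} ω_L = dE_L - τ^* F_nh`, that is, in coordinates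
`(F_nh)_i = d/dt (∂L/∂q̇ⁱ) - ∂L/∂qⁱ` along the trajectories of `Γ_nh`. -/
def nonholonomicForce (L : TangentBundle 𝓘(ℝ, E) Q → ℝ)
    (D : (q : Q) → Submodule ℝ (TangentSpace 𝓘(ℝ, E) q)) (v : TangentBundle 𝓘(ℝ, E) Q) :
    TangentSpace 𝓘(ℝ, E) v.proj →L[ℝ] ℝ :=
  if hF : ∃ F : TangentSpace 𝓘(ℝ, E) v.proj →L[ℝ] ℝ, ∀ Y : TangentSpace 𝓘(ℝ, E).tangent v,
      contractOmega L v (nonholonomicField L D v) Y = dEnergy L v Y - F (tangentProj v Y)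
  then hF.choose else 0

/-- `γ` is an integral curve of `Γ_nh` in `D`, defined on `[0, t]` and starting at `v`. -/
def IsTrajectory (L : TangentBundle 𝓘(ℝ, E) Q → ℝ)
    (D : (q : Q) → Submodule ℝ (TangentSpace 𝓘(ℝ, E) q)) (t : ℝ)
    (v : TangentBundle 𝓘(ℝ, E) Q) (γ : ℝ → TangentBundle 𝓘(ℝ, E) Q) : Prop :=
  γ 0 = v ∧ (∀ s ∈ Icc 0 t, γ s ∈ constraintSet D) ∧
    IsMIntegralCurveOn (I := 𝓘(ℝ, E).tangent) γ (nonholonomicField L D) (Icc 0 t)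

open Classical in
/-- The flow `φ_t` of `Γ_nh` on `D` for `t ≥ 0` (with the value `v` where it is not defined). -/
def flow (L : TangentBundle 𝓘(ℝ, E) Q → ℝ)
    (D : (q : Q) → Submodule ℝ (TangentSpace 𝓘(ℝ, E) q)) (t : ℝ)
    (v : TangentBundle 𝓘(ℝ, E) Q) : TangentBundle 𝓘(ℝ, E) Q :=
  if hγ : ∃ γ, IsTrajectory L D t v γ then hγ.choose t else v

/-- The set of `v ∈ D` whose trajectory is defined on `[0, h]`. -/
def flowDomain (L : TangentBundle 𝓘(ℝ, E) Q → ℝ)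
    (D : (q : Q) → Submodule ℝ (TangentSpace 𝓘(ℝ, E) q)) (h : ℝ) :
    Set (TangentBundle 𝓘(ℝ, E) Q) :=
  {v | v ∈ constraintSet D ∧ ∃ γ, IsTrajectory L D h v γ}

/-- The nonholonomic exponential map `exp_h(v) = (τ(v), τ(φ_h(v)))`. -/
def nhExp (L : TangentBundle 𝓘(ℝ, E) Q → ℝ)
    (D : (q : Q) → Submodule ℝ (TangentSpace 𝓘(ℝ, E) q)) (h : ℝ)
    (v : TangentBundle 𝓘(ℝ, E) Q) : Q × Q :=
  (v.proj, (flow L D h v).proj)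

/-- The exact discrete nonholonomic constraint submanifold `M_h = exp_h(U_h)`. -/
def discreteConstraint (L : TangentBundle 𝓘(ℝ, E) Q → ℝ)
    (D : (q : Q) → Submodule ℝ (TangentSpace 𝓘(ℝ, E) q)) (h : ℝ)
    (U : Set (TangentBundle 𝓘(ℝ, E) Q)) : Set (Q × Q) :=
  nhExp L D h '' U

open Classical in
/-- The exact retraction `R⁻ : M_h → U_h`, the inverse of `exp_h : U_h → M_h` (extended by zero
vectors to `Q × Q`). -/
def retractionMinus (L : TangentBundle 𝓘(ℝ, E) Q → ℝ)
    (D : (q : Q) → Submodule ℝ (TangentSpace 𝓘(ℝ, E) q)) (h : ℝ)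
    (U : Set (TangentBundle 𝓘(ℝ, E) Q)) (p : Q × Q) : TangentBundle 𝓘(ℝ, E) Q :=
  if hv : ∃ v ∈ U, nhExp L D h v = p then hv.choose else ⟨p.1, 0⟩

/-- The retraction `R⁺ = φ_h ∘ R⁻`. -/
def retractionPlus (L : TangentBundle 𝓘(ℝ, E) Q → ℝ)
    (D : (q : Q) → Submodule ℝ (TangentSpace 𝓘(ℝ, E) q)) (h : ℝ)
    (U : Set (TangentBundle 𝓘(ℝ, E) Q)) (p : Q × Q) : TangentBundle 𝓘(ℝ, E) Q :=
  flow L D h (retractionMinus L D h U p)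

/-- `U = U_h` is an open subset of `D`, contained in the domain of `exp_h`, on which `exp_h` is an
embedding: a diffeomorphism onto its image `M_h ⊆ Q × Q`. -/
structure IsEmbeddingDomain (L : TangentBundle 𝓘(ℝ, E) Q → ℝ)
    (D : (q : Q) → Submodule ℝ (TangentSpace 𝓘(ℝ, E) q)) (h : ℝ)
    (U : Set (TangentBundle 𝓘(ℝ, E) Q)) : Prop where
  open_in_D : ∃ O, IsOpen O ∧ U = O ∩ constraintSet D
  subset_domain : U ⊆ flowDomain L D h
  injOn : InjOn (nhExp L D h) U
  smooth : ContMDiffOn 𝓘(ℝ, E).tangent (𝓘(ℝ, E).prod 𝓘(ℝ, E)) ∞ (nhExp L D h) U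
  smooth_inverse : ContMDiffOn (𝓘(ℝ, E).prod 𝓘(ℝ, E)) 𝓘(ℝ, E).tangent ∞
    (retractionMinus L D h U) (discreteConstraint L D h U)

/-- The nonholonomic trajectory `γ₀(t) = φ_t(R⁻(q₀, q₁))` connecting the points of `p = (q₀, q₁)`. -/
def connecting (L : TangentBundle 𝓘(ℝ, E) Q → ℝ)
    (D : (q : Q) → Submodule ℝ (TangentSpace 𝓘(ℝ, E) q)) (h : ℝ)
    (U : Set (TangentBundle 𝓘(ℝ, E) Q)) (t : ℝ) (p : Q × Q) : TangentBundle 𝓘(ℝ, E) Q :=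
  flow L D t (retractionMinus L D h U p)

/-- The map `τ ∘ φ_t ∘ R⁻ : M_h → Q`. -/
def connectingBase (L : TangentBundle 𝓘(ℝ, E) Q → ℝ)
    (D : (q : Q) → Submodule ℝ (TangentSpace 𝓘(ℝ, E) q)) (h : ℝ)
    (U : Set (TangentBundle 𝓘(ℝ, E) Q)) (t : ℝ) (p : Q × Q) : Q :=
  (connecting L D h U t p).proj

/-- The nonholonomic exact discrete Lagrangian `l(q₀, q₁) = ∫₀ʰ L(φ_t(R⁻(q₀, q₁))) dt`. -/
def discreteLagrangian (L : TangentBundle 𝓘(ℝ, E) Q → ℝ)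
    (D : (q : Q) → Submodule ℝ (TangentSpace 𝓘(ℝ, E) q)) (h : ℝ)
    (U : Set (TangentBundle 𝓘(ℝ, E) Q)) (p : Q × Q) : ℝ :=
  ∫ t in (0 : ℝ)..h, L (connecting L D h U t p)

/-- The variation field `X₀₁(t) = T_p(τ ∘ φ_t ∘ R⁻)(X)`, for `X` tangent to `M_h` at `p`. -/
def variationField (L : TangentBundle 𝓘(ℝ, E) Q → ℝ)
    (D : (q : Q) → Submodule ℝ (TangentSpace 𝓘(ℝ, E) q)) (h : ℝ)
    (U : Set (TangentBundle 𝓘(ℝ, E) Q)) (p : Q × Q)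
    (X : TangentSpace (𝓘(ℝ, E).prod 𝓘(ℝ, E)) p) (t : ℝ) :
    TangentSpace 𝓘(ℝ, E) (connecting L D h U t p).proj :=
  mfderivWithin (𝓘(ℝ, E).prod 𝓘(ℝ, E)) 𝓘(ℝ, E) (connectingBase L D h U t)
    (discreteConstraint L D h U) p X

/-- The one-form `⟨β_nh(p), X⟩ = ∫₀ʰ ⟨F_nh(γ₀(t)), X₀₁(t)⟩ dt` on `M_h`. -/
def betaForm (L : TangentBundle 𝓘(ℝ, E) Q → ℝ)
    (D : (q : Q) → Submodule ℝ (TangentSpace 𝓘(ℝ, E) q)) (h : ℝ)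
    (U : Set (TangentBundle 𝓘(ℝ, E) Q)) (p : Q × Q)
    (X : TangentSpace (𝓘(ℝ, E).prod 𝓘(ℝ, E)) p) : ℝ :=
  ∫ t in (0 : ℝ)..h, nonholonomicForce L D (connecting L D h U t p) (variationField L D h U p X t)

end Nonholonomic

end

noncomputable section

namespace Nonholonomic

/-! ### Ordinary differential equations: local flows, derivatives in the initial point, uniqueness
-/

section ODE

variable {V : Type*} [NormedAddCommGroup V] [NormedSpace ℝ V]

/-! The formula is the first variation of the action with the Euler–Lagrange term kept. In
coordinates, let `z` solve a second order equation with field `f` and let `m` be a variation of `z`,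
that is, a solution of the linearised equation. Then the derivative of `∂ℓ/∂u (m.1)` is `dℓ(m)` plus
the Euler–Lagrange form of `f` on `m.1` (`hasDerivAt_fiberDeriv_variation`). Integration gives the
differential of the action as momentum terms at the two ends minus the integral of the
Euler–Lagrange form, and along nonholonomic trajectories that form is the force.

Making this rigorous needs three things. The first is a smooth equation. The nonholonomic field is
given pointwise, and only along `D`. In a natural chart it solves a linear system for the
acceleration and the Lagrange multipliers. Compatibility and the independence of the constraint
one-forms make this system invertible at the base point, hence nearby, on and off the constraint set
(`exists_constrained_dynamics`). So the field extends locally to a smooth second order field on an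
open subset of `E × E` whose Euler–Lagrange form is the nonholonomic force
(`exists_chart_dynamics`). Trajectories are then pieces of ordinary flows, which are differentiable
in the initial point (`exists_localFlow`), and the action along them can be differentiated
(`exists_localFlow_action`).

The second is the passage from a chart to all of `[0, h]`. Consider, for a pair of times `a`, `b`,
the assertion that differentiability of the family at time `a` implies differentiability at time `b`
together with the variation formula between them. It holds for nearby times in either order
(`IsTrajectoryFamily.exists_local_variation`) and is transitive, since the intermediate momenta
cancel. Connectedness of `[0, h]` gives it for all pairs (`IsTrajectoryFamily.hasVariationFormula`).
The start is time `0`, where the family is the smooth retraction.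

The third is the ends. On the discrete constraint set the base points at times `0` and `h` are the
two projections of `Q × Q`, so the variation field there equals the two components of the given
tangent vector. Derivatives within a subset are not unique as linear maps, so they are compared only
on `tangentSubspace`, where they are determined. -/

theorem gronwallBound_zero_left_eq_mul (K η x : ℝ) :
    gronwallBound 0 K η x = η * gronwallBound 0 K 1 x := by
  by_cases hK : K = 0
  · subst hK; simp [gronwallBound_K0]
  · simp [gronwallBound_of_K_ne_0 hK]; field_simp

/-- Grönwall's inequality on a symmetric interval, in both directions of time. -/
theorem norm_le_of_hasDerivAt_of_norm_le {e e' : ℝ → V} {K η ε : ℝ} (hK : 0 ≤ K) (hη : 0 ≤ η)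
    (h0 : e 0 = 0) (he : ∀ s, |s| < ε → HasDerivAt e (e' s) s)
    (hb : ∀ s, |s| < ε → ‖e' s‖ ≤ K * ‖e s‖ + η) {s : ℝ} (hs : |s| < ε) :
    ‖e s‖ ≤ η * gronwallBound 0 K 1 ε := by
  have key : ∀ {e e' : ℝ → V}, e 0 = 0 → (∀ s, |s| < ε → HasDerivAt e (e' s) s) →
      (∀ s, |s| < ε → ‖e' s‖ ≤ K * ‖e s‖ + η) → ∀ s, 0 ≤ s → s < ε →
      ‖e s‖ ≤ η * gronwallBound 0 K 1 ε := by
    intro e e' h0 he hb s hs hsε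
    have hlt : ∀ x ∈ Icc 0 s, |x| < ε := fun x hx => by
      rw [abs_of_nonneg hx.1]; exact hx.2.trans_lt hsε
    have h := norm_le_gronwallBound_of_norm_deriv_right_le (f := e) (f' := e') (δ := 0) (K := K)
      (ε := η) (a := 0) (b := s)
      (fun x hx => (he x (hlt x hx)).continuousAt.continuousWithinAt)
      (fun x hx => (he x (hlt x (Ico_subset_Icc_self hx))).hasDerivWithinAt) (by simp [h0])
      (fun x hx => hb x (hlt x (Ico_subset_Icc_self hx))) s ⟨hs, le_rfl⟩
    rw [sub_zero] at h
    refine h.trans ?_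
    rw [← gronwallBound_zero_left_eq_mul]
    exact gronwallBound_mono le_rfl hη hK hsε.le
  rcases le_total 0 s with h | h
  · exact key h0 he hb s h ((le_abs_self s).trans_lt hs)
  · have h1 := key (e := fun s => e (-s)) (e' := fun s => -e' (-s)) (by simp [h0])
      (fun s hs => by
        have := (he (-s) (by rwa [abs_neg])).scomp s (hasDerivAt_neg s)
        simpa [Function.comp_def] using this)
      (fun s hs => by rw [norm_neg]; exact hb (-s) (by rwa [abs_neg])) (-s) (by linarith)
      ((neg_le_abs s).trans_lt hs)
    simpa using h1

/-- A `C²` map differs from its first order Taylor expansion by a uniformly quadratic term. -/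
theorem exists_ball_norm_sub_fderiv_le {V' : Type*} [NormedAddCommGroup V'] [NormedSpace ℝ V']
    {f : V → V'} {z₀ : V} (hf : ContDiffAt ℝ 2 f z₀) :
    ∃ ρ > 0, ∃ K C : ℝ, 0 ≤ K ∧ 0 ≤ C ∧ ∀ z ∈ Metric.ball z₀ ρ, DifferentiableAt ℝ f z ∧
      ‖fderiv ℝ f z‖ ≤ K ∧
      ∀ w ∈ Metric.ball z₀ ρ, ‖f w - f z - fderiv ℝ f z (w - z)‖ ≤ C * ‖w - z‖ ^ 2 := by
  have h1 : ContDiffAt ℝ 1 (fderiv ℝ f) z₀ := hf.fderiv_right (by norm_num)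
  obtain ⟨C, S, hS, hC⟩ := h1.exists_lipschitzOnWith
  have hd : ∀ᶠ z in 𝓝 z₀, DifferentiableAt ℝ f z :=
    (hf.eventually (by simp)).mono fun z hz => hz.differentiableAt (by norm_num)
  have hK : ∀ᶠ z in 𝓝 z₀, ‖fderiv ℝ f z‖ < ‖fderiv ℝ f z₀‖ + 1 :=
    h1.continuousAt.norm.eventually_lt continuousAt_const (by linarith)
  obtain ⟨ρ, hρ, H⟩ := Metric.eventually_nhds_iff_ball.1 ((hd.and hK).and hS)
  refine ⟨ρ, hρ, ‖fderiv ℝ f z₀‖ + 1, C, by positivity, C.2, fun z hz =>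
    ⟨(H z hz).1.1, (H z hz).1.2.le, fun w hw => ?_⟩⟩
  have hseg : segment ℝ z w ⊆ Metric.ball z₀ ρ := (convex_ball z₀ ρ).segment_subset hz hw
  -- Mean value inequality for `f` minus its linear part at `z`: by the Lipschitz bound on `fderiv ℝ
  -- f`, the derivative of this difference is at most `C * ‖w - z‖` on the segment.
  have := (convex_segment z w).norm_image_sub_le_of_norm_hasFDerivWithin_le'
    (f := f) (f' := fderiv ℝ f) (φ := fderiv ℝ f z) (C := C * ‖w - z‖)
    (fun x hx => (H x (hseg hx)).1.1.hasFDerivAt.hasFDerivWithinAt)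
    (fun x hx => by
      refine (hC.norm_sub_le (H x (hseg hx)).2 (H z hz).2).trans ?_
      gcongr
      exact norm_sub_le_of_mem_segment hx)
    (left_mem_segment ℝ z w) (right_mem_segment ℝ z w)
  rw [pow_two, ← mul_assoc]
  exact this

/-- The local flow `Θ` of a vector field, with its derivative `M` in the initial point, which solves
the variational equation. -/
theorem exists_localFlow [CompleteSpace V] {f : V → V} {Ω : Set V} {z₀ : V} (hΩ : Ω ∈ 𝓝 z₀)
    (hf : ContDiffAt ℝ ∞ f z₀) :
    ∃ ε > 0, ∃ r > 0, ∃ (Θ : ℝ → V → V) (M : ℝ → V → V →L[ℝ] V),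
      (∀ z ∈ Metric.ball z₀ r, Θ 0 z = z ∧ M 0 z = ContinuousLinearMap.id ℝ V ∧
        ∀ s, |s| < ε → Θ s z ∈ Ω ∧ HasDerivAt (fun s => Θ s z) (f (Θ s z)) s ∧
          HasDerivAt (fun s => M s z) ((fderiv ℝ f (Θ s z)).comp (M s z)) s ∧
          HasFDerivAt (Θ s) (M s z) z) ∧
      ContinuousOn (fun x : ℝ × V => (Θ x.1 x.2, M x.1 x.2))
        (Ioo (-ε) ε ×ˢ Metric.ball z₀ r) := by
  -- The equation and its linearisation form one `C¹` system, so a single application of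
  -- Picard–Lindelöf yields `Θ` and `M` with joint continuity. That `M` is the derivative of `Θ` is
  -- proved afterwards.
  let g : V × (V →L[ℝ] V) → V × (V →L[ℝ] V) := fun x => (f x.1, (fderiv ℝ f x.1).comp x.2)
  let x₀ : V × (V →L[ℝ] V) := (z₀, ContinuousLinearMap.id ℝ V)
  have hf2 : ContDiffAt ℝ 2 f z₀ := by exact_mod_cast contDiffAt_infty.1 hf 2
  have hg : ContDiffAt ℝ 1 g x₀ := by
    have hf1 : ContDiffAt ℝ 1 (fun x : V × (V →L[ℝ] V) => f x.1) x₀ :=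
      ContDiffAt.comp x₀ (hf.of_le (by exact_mod_cast le_top)) contDiffAt_fst
    have hf' : ContDiffAt ℝ 1 (fun x : V × (V →L[ℝ] V) => fderiv ℝ f x.1) x₀ :=
      ContDiffAt.comp x₀ (hf2.fderiv_right (m := 1) (by norm_num)) contDiffAt_fst
    exact hf1.prodMk (hf'.clm_comp contDiffAt_snd)
  obtain ⟨ε₀, hε₀, a, r₀, Lp, Kp, hr₀, hpl⟩ := IsPicardLindelof.of_contDiffAt_one hg
  obtain ⟨α, hα, L', hL'⟩ :=
    (hpl 0).exists_forall_mem_closedBall_eq_hasDerivWithinAt_lipschitzOnWith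
  simp only [zero_sub, zero_add] at hα hL'
  have hcont : ContinuousOn (Function.uncurry α) (Metric.closedBall x₀ r₀ ×ˢ Icc (-ε₀) ε₀) :=
    continuousOn_prod_of_continuousOn_lipschitzOnWith _ L'
      (fun x hx => HasDerivWithinAt.continuousOn (hα x hx).2) hL'
  obtain ⟨ρ, hρ, K, C, hK, hC, hest⟩ :=
    exists_ball_norm_sub_fderiv_le hf2
  have hx₀ : x₀ ∈ Metric.closedBall x₀ (r₀ : ℝ) := Metric.mem_closedBall_self r₀.2
  have hα₀ : α x₀ 0 = x₀ := (hα x₀ hx₀).1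
  have hN : ∀ᶠ y : V × (V →L[ℝ] V) in 𝓝 x₀, y.1 ∈ Ω ∩ Metric.ball z₀ ρ :=
    continuousAt_fst.eventually (Filter.inter_mem hΩ (Metric.ball_mem_nhds z₀ hρ))
  have hev : ∀ᶠ q : (V × (V →L[ℝ] V)) × ℝ in 𝓝 (x₀, (0 : ℝ)),
      (α q.1 q.2).1 ∈ Ω ∩ Metric.ball z₀ ρ := by
    have hc : ContinuousAt (Function.uncurry α) (x₀, (0 : ℝ)) :=
      hcont.continuousAt (prod_mem_nhds (Metric.closedBall_mem_nhds x₀ hr₀)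
        (Icc_mem_nhds (by linarith) hε₀))
    refine hc.eventually (p := fun y => y.1 ∈ Ω ∩ Metric.ball z₀ ρ) ?_
    change ∀ᶠ y in 𝓝 (α x₀ 0), _
    rw [hα₀]; exact hN
  obtain ⟨δ, hδ, hδ'⟩ := Metric.eventually_nhds_iff_ball.1 hev
  have hι : ∀ z, dist ((z, ContinuousLinearMap.id ℝ V) : V × (V →L[ℝ] V)) x₀ = dist z z₀ := by
    intro z; simp [x₀, Prod.dist_eq]
  let ι : V → V × (V →L[ℝ] V) := fun z => (z, ContinuousLinearMap.id ℝ V)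
  have hιc : Continuous ι := by fun_prop
  let r : ℝ := min δ r₀
  let ε : ℝ := min δ ε₀
  have hr : 0 < r := lt_min hδ (by exact_mod_cast hr₀)
  have hε : 0 < ε := lt_min hδ hε₀
  have hιr : ∀ z ∈ Metric.ball z₀ r, ι z ∈ Metric.closedBall x₀ (r₀ : ℝ) := fun z hz => by
    rw [Metric.mem_closedBall, hι]
    exact (Metric.mem_ball.1 hz).le.trans (min_le_right _ _)
  have hmem : ∀ z ∈ Metric.ball z₀ r, ∀ s, |s| < ε →
      (α (ι z) s).1 ∈ Ω ∩ Metric.ball z₀ ρ := fun z hz s hs => by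
    refine hδ' (ι z, s) ?_
    rw [Metric.mem_ball, Prod.dist_eq]
    refine max_lt ?_ ?_
    · rw [hι]; exact (Metric.mem_ball.1 hz).trans_le (min_le_left _ _)
    · simpa using hs.trans_le (min_le_left _ _)
  have hder : ∀ z ∈ Metric.ball z₀ r, ∀ s, |s| < ε → HasDerivAt (α (ι z)) (g (α (ι z) s)) s :=
    fun z hz s hs => by
      obtain ⟨h1, h2⟩ := abs_lt.1 (hs.trans_le (min_le_right δ ε₀))
      exact ((hα _ (hιr z hz)).2 s ⟨h1.le, h2.le⟩).hasDerivAt (Icc_mem_nhds h1 h2)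
  have hΘ : ∀ z ∈ Metric.ball z₀ r, ∀ s, |s| < ε →
      HasDerivAt (fun s => (α (ι z) s).1) (f (α (ι z) s).1) s := fun z hz s hs =>
    (hder z hz s hs).fst
  have hM : ∀ z ∈ Metric.ball z₀ r, ∀ s, |s| < ε →
      HasDerivAt (fun s => (α (ι z) s).2) ((fderiv ℝ f (α (ι z) s).1).comp (α (ι z) s).2) s :=
    fun z hz s hs => (hder z hz s hs).snd
  refine ⟨ε, hε, r, hr, fun s z => (α (ι z) s).1, fun s z => (α (ι z) s).2, ?_, ?_⟩
  · intro z hz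
    have h0 : α (ι z) 0 = ι z := (hα _ (hιr z hz)).1
    refine ⟨congrArg Prod.fst h0, congrArg Prod.snd h0, fun s hs =>
      ⟨(hmem z hz s hs).1, hΘ z hz s hs, hM z hz s hs, ?_⟩⟩
    rw [hasFDerivAt_iff_isLittleO]
    have hsI : ∀ s, |s| < ε → s ∈ Icc (-ε₀) ε₀ := fun s hs =>
      ⟨(abs_lt.1 (hs.trans_le (min_le_right δ ε₀))).1.le,
        (abs_lt.1 (hs.trans_le (min_le_right δ ε₀))).2.le⟩
    -- The first order error vanishes at time `0` and satisfies the linearised equation up to the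
    -- Taylor remainder of `f`, which is quadratic in `‖w - z‖` because the flow is Lipschitz.
    -- Grönwall keeps the error quadratic.
    have hquad : ∀ w ∈ Metric.ball z₀ r,
        ‖(α (ι w) s).1 - (α (ι z) s).1 - (α (ι z) s).2 (w - z)‖ ≤
          (C * (L' * ‖w - z‖) ^ 2) * gronwallBound 0 K 1 ε := by
      intro w hw
      have h0w : α (ι w) 0 = ι w := (hα _ (hιr w hw)).1
      refine norm_le_of_hasDerivAt_of_norm_le
        (e := fun s => (α (ι w) s).1 - (α (ι z) s).1 - (α (ι z) s).2 (w - z))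
        (e' := fun s => f (α (ι w) s).1 - f (α (ι z) s).1 -
          ((fderiv ℝ f (α (ι z) s).1).comp (α (ι z) s).2) (w - z))
        hK (by positivity) ?_ ?_ ?_ hs
      · simp [h0, h0w, ι]
      · intro s hs
        exact ((hΘ w hw s hs).sub (hΘ z hz s hs)).sub
          ((hM z hz s hs).clm_apply (hasDerivAt_const s (w - z)) |>.congr_deriv (by simp))
      · intro s hs
        have hz' := hest _ (hmem z hz s hs).2
        have hlip : ‖(α (ι w) s).1 - (α (ι z) s).1‖ ≤ L' * ‖w - z‖ := by
          have h3 := (hL' s (hsI s hs)).dist_le_mul _ (hιr w hw) _ (hιr z hz)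
          have h4 : dist (ι w) (ι z) = ‖w - z‖ := by
            simp [ι, dist_eq_norm]
          rw [h4] at h3
          rw [← dist_eq_norm]
          exact (Prod.dist_eq (x := α (ι w) s) (y := α (ι z) s) ▸ le_max_left _ _).trans h3
        have hsplit : f (α (ι w) s).1 - f (α (ι z) s).1 -
            ((fderiv ℝ f (α (ι z) s).1).comp (α (ι z) s).2) (w - z) =
            fderiv ℝ f (α (ι z) s).1
              ((α (ι w) s).1 - (α (ι z) s).1 - (α (ι z) s).2 (w - z)) +
            (f (α (ι w) s).1 - f (α (ι z) s).1 -
              fderiv ℝ f (α (ι z) s).1 ((α (ι w) s).1 - (α (ι z) s).1)) := by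
          simp only [map_sub, ContinuousLinearMap.comp_apply]; abel
        rw [hsplit]
        refine (norm_add_le _ _).trans (add_le_add ?_ ?_)
        · exact ((fderiv ℝ f _).le_opNorm _).trans
            (mul_le_mul_of_nonneg_right hz'.2.1 (norm_nonneg _))
        · refine (hz'.2.2 _ (hmem w hw s hs).2).trans ?_
          gcongr
    have hO : (fun w => (α (ι w) s).1 - (α (ι z) s).1 - (α (ι z) s).2 (w - z)) =O[𝓝 z]
        fun w => ‖w - z‖ ^ 2 := by
      refine Asymptotics.IsBigO.of_bound (C * L' ^ 2 * gronwallBound 0 K 1 ε) ?_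
      filter_upwards [Metric.isOpen_ball.mem_nhds hz] with w hw
      refine (hquad w hw).trans (le_of_eq ?_)
      rw [norm_pow, norm_norm]; ring
    refine hO.trans_isLittleO ?_
    have h2 := (Asymptotics.isLittleO_norm_pow_id (E' := V) one_lt_two)
    have h3 : Filter.Tendsto (fun w => w - z) (𝓝 z) (𝓝 0) := by
      have : Continuous fun w => w - z := by fun_prop
      simpa using this.tendsto z
    exact h2.comp_tendsto h3
  · have hφ : ContinuousOn (fun x : ℝ × V => (ι x.2, x.1)) (Ioo (-ε) ε ×ˢ Metric.ball z₀ r) := by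
      fun_prop
    have := hcont.comp hφ (fun x hx => ⟨hιr _ hx.2, ?_⟩)
    · exact this
    · have hle : ε ≤ ε₀ := min_le_right _ _
      exact ⟨by linarith [hx.1.1], by linarith [hx.1.2]⟩

/-- Two solutions of an autonomous equation on a closed interval that agree at one time agree
nearby. -/
theorem eventually_eq_of_hasDerivWithinAt {f : V → V} {α β : ℝ → V} {c d t₁ : ℝ}
    (hf : ContDiffAt ℝ 1 f (α t₁)) (ht₁ : t₁ ∈ Icc c d) (heq : α t₁ = β t₁)
    (hα : ∀ᶠ t in 𝓝[Icc c d] t₁, HasDerivWithinAt α (f (α t)) (Icc c d) t)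
    (hβ : ∀ᶠ t in 𝓝[Icc c d] t₁, HasDerivWithinAt β (f (β t)) (Icc c d) t) :
    ∀ᶠ t in 𝓝[Icc c d] t₁, α t = β t := by
  obtain ⟨K, S, hS, hK⟩ := hf.exists_lipschitzOnWith
  have hαS : ∀ᶠ t in 𝓝[Icc c d] t₁, α t ∈ S :=
    (hα.self_of_nhdsWithin ht₁).continuousWithinAt.eventually hS
  have hβS : ∀ᶠ t in 𝓝[Icc c d] t₁, β t ∈ S :=
    (hβ.self_of_nhdsWithin ht₁).continuousWithinAt.eventually (heq ▸ hS)
  obtain ⟨δ, hδ, H⟩ := Metric.mem_nhdsWithin_iff.1 ((hα.and hβ).and (hαS.and hβS))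
  refine Metric.mem_nhdsWithin_iff.2 ⟨δ, hδ, fun t ht => ?_⟩
  rw [Real.ball_eq_Ioo] at ht H
  have hsub : ∀ s ∈ uIcc t₁ t, s ∈ Ioo (t₁ - δ) (t₁ + δ) ∩ Icc c d := fun s hs =>
    ⟨(ordConnected_Ioo.uIcc_subset ⟨by linarith, by linarith⟩ ht.1) hs,
      (ordConnected_Icc.uIcc_subset ht₁ ht.2) hs⟩
  rcases le_total t₁ t with h | h
  · rw [uIcc_of_le h] at hsub
    have hn : ∀ s ∈ Ico t₁ t, Icc c d ∈ 𝓝[≥] s := fun s hs =>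
      Filter.mem_of_superset (Icc_mem_nhdsGE hs.2)
        (Icc_subset_Icc (hsub s (Ico_subset_Icc_self hs)).2.1 ht.2.2)
    exact ODE_solution_unique_of_mem_Icc_right (v := fun _ => f) (s := fun _ => S)
      (fun _ _ => hK)
      (fun s hs => (H (hsub s hs)).1.1.continuousWithinAt.mono fun s hs => (hsub s hs).2)
      (fun s hs => (H (hsub s (Ico_subset_Icc_self hs))).1.1.mono_of_mem_nhdsWithin (hn s hs))
      (fun s hs => (H (hsub s (Ico_subset_Icc_self hs))).2.1)
      (fun s hs => (H (hsub s hs)).1.2.continuousWithinAt.mono fun s hs => (hsub s hs).2)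
      (fun s hs => (H (hsub s (Ico_subset_Icc_self hs))).1.2.mono_of_mem_nhdsWithin (hn s hs))
      (fun s hs => (H (hsub s (Ico_subset_Icc_self hs))).2.2) heq ⟨h, le_rfl⟩
  · rw [uIcc_of_ge h] at hsub
    have hn : ∀ s ∈ Ioc t t₁, Icc c d ∈ 𝓝[≤] s := fun s hs =>
      Filter.mem_of_superset (Icc_mem_nhdsLE hs.1)
        (Icc_subset_Icc ht.2.1 (hsub s (Ioc_subset_Icc_self hs)).2.2)
    exact ODE_solution_unique_of_mem_Icc_left (v := fun _ => f) (s := fun _ => S)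
      (fun _ _ => hK)
      (fun s hs => (H (hsub s hs)).1.1.continuousWithinAt.mono fun s hs => (hsub s hs).2)
      (fun s hs => (H (hsub s (Ioc_subset_Icc_self hs))).1.1.mono_of_mem_nhdsWithin (hn s hs))
      (fun s hs => (H (hsub s (Ioc_subset_Icc_self hs))).2.1)
      (fun s hs => (H (hsub s hs)).1.2.continuousWithinAt.mono fun s hs => (hsub s hs).2)
      (fun s hs => (H (hsub s (Ioc_subset_Icc_self hs))).1.2.mono_of_mem_nhdsWithin (hn s hs))
      (fun s hs => (H (hsub s (Ioc_subset_Icc_self hs))).2.2) heq ⟨le_rfl, h⟩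

/-- Continuous curves in a Hausdorff space that agree near each time at which they agree. -/
theorem eqOn_of_eventually_eq {M : Type*} [TopologicalSpace M] [T2Space M] {y w : ℝ → M} {J : Set ℝ}
    (hJ : IsPreconnected J) (hy : ContinuousOn y J) (hw : ContinuousOn w J) {t₀ : ℝ} (ht₀ : t₀ ∈ J)
    (heq : y t₀ = w t₀) (hloc : ∀ t ∈ J, y t = w t → ∀ᶠ s in 𝓝[J] t, y s = w s) : EqOn y w J := by
  intro t ht
  -- The relation is an implication, hence transitive without any case analysis. Locally it holds in
  -- both directions: agreement spreads by `hloc`, and disagreement is an open condition in a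
  -- Hausdorff space.
  refine hJ.induction₂' (fun a b => y a = w a → y b = w b) (fun a ha => ?_)
    (fun _ _ _ _ _ _ h1 h2 h => h2 (h1 h)) ht₀ ht heq
  by_cases h : y a = w a
  · exact (hloc a ha h).mono fun b hb => ⟨fun _ => hb, fun _ => h⟩
  · have : ∀ᶠ b in 𝓝[J] a, y b ≠ w b :=
      ((hy a ha).prodMk (hw a ha)).eventually (isClosed_diagonal.isOpen_compl.mem_nhds h)
    exact this.mono fun b hb => ⟨fun h' => absurd h' h, fun h' => absurd h' hb⟩

end ODE

/-! ### First variation of the action in coordinates -/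

section LocalLagrangian

variable {E : Type*} [NormedAddCommGroup E] [NormedSpace ℝ E]

/-- The momentum `∂ℓ/∂u` of a Lagrangian `ℓ(x, u)` in coordinates. -/
def fiberDeriv (ℓ : E × E → ℝ) (z : E × E) : E →L[ℝ] ℝ :=
  (fderiv ℝ ℓ z).comp (ContinuousLinearMap.inr ℝ E E)

/-- The Euler–Lagrange one-form `d/dt (∂ℓ/∂u) - ∂ℓ/∂x` along the vector field `f`, in
coordinates. -/
def eulerLagrangeForm (ℓ : E × E → ℝ) (f : E × E → E × E) (z : E × E) : E →L[ℝ] ℝ :=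
  (fderiv ℝ (fderiv ℝ ℓ) z (f z)).comp (ContinuousLinearMap.inr ℝ E E) -
    (fderiv ℝ ℓ z).comp (ContinuousLinearMap.inl ℝ E E)

theorem continuousOn_eulerLagrangeForm {ℓ : E × E → ℝ} {f : E × E → E × E} {Ω : Set (E × E)}
    (hΩ : IsOpen Ω) (hℓ : ContDiffOn ℝ ∞ ℓ Ω) (hf : ContDiffOn ℝ ∞ f Ω) :
    ContinuousOn (eulerLagrangeForm ℓ f) Ω := by
  have h1 : ContDiffOn ℝ ∞ (fderiv ℝ ℓ) Ω := hℓ.fderiv_of_isOpen hΩ (by simp)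
  have h2 : ContDiffOn ℝ ∞ (fderiv ℝ (fderiv ℝ ℓ)) Ω := h1.fderiv_of_isOpen hΩ (by simp)
  exact ((h2.continuousOn.clm_apply hf.continuousOn).clm_comp continuousOn_const).sub
    (h1.continuousOn.clm_comp continuousOn_const)

/-- The derivative of the momentum paired with a variation along a solution of a second order
equation. -/
theorem hasDerivAt_fiberDeriv_variation {ℓ : E × E → ℝ} {f : E × E → E × E} {z m : ℝ → E × E}
    {t : ℝ} (hℓ : ContDiffAt ℝ 2 ℓ (z t)) (hf : DifferentiableAt ℝ f (z t))
    (hfst : ∀ᶠ x in 𝓝 (z t), (f x).1 = x.2)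
    (hz : HasDerivAt z (f (z t)) t) (hm : HasDerivAt m (fderiv ℝ f (z t) (m t)) t) :
    HasDerivAt (fun t => fiberDeriv ℓ (z t) (m t).1)
      (fderiv ℝ ℓ (z t) (m t) + eulerLagrangeForm ℓ f (z t) (m t).1) t := by
  have h1 : HasFDerivAt (fderiv ℝ ℓ) (fderiv ℝ (fderiv ℝ ℓ) (z t)) (z t) :=
    ((hℓ.fderiv_right (m := 1) (by norm_num)).differentiableAt (by norm_num)).hasFDerivAt
  -- The second order condition enters here: differentiating `hfst` shows that the base part of the
  -- variation has the fibre part as its velocity.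
  have h2 : (fderiv ℝ f (z t) (m t)).1 = (m t).2 := by
    have h3 : HasFDerivAt (fun x => (f x).1)
        ((ContinuousLinearMap.fst ℝ E E).comp (fderiv ℝ f (z t))) (z t) :=
      hasFDerivAt_fst.comp (z t) hf.hasFDerivAt
    have h4 : HasFDerivAt (fun x : E × E => x.2) (ContinuousLinearMap.snd ℝ E E) (z t) :=
      hasFDerivAt_snd
    have h5 := h3.unique (h4.congr_of_eventuallyEq hfst)
    exact congrArg (fun A : E × E →L[ℝ] E => A (m t)) h5
  have h3 := (h1.comp_hasDerivAt t hz).clm_apply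
    ((ContinuousLinearMap.inr ℝ E E).hasFDerivAt.comp_hasDerivAt t hm.fst)
  refine (h3.congr_deriv ?_)
  have h4 : m t = (((m t).1, 0) : E × E) + (0, (m t).2) := by simp
  simp only [eulerLagrangeForm, sub_apply, ContinuousLinearMap.comp_apply,
    ContinuousLinearMap.inr_apply, ContinuousLinearMap.inl_apply, Function.comp_apply, h2]
  conv_rhs => rw [h4, map_add]
  simp only [add_zero, Prod.mk_add_mk, zero_add]
  ring

/-- The local flow of a second order vector field, with the first variation of the action. -/
theorem exists_localFlow_action [FiniteDimensional ℝ E] {ℓ : E × E → ℝ} {f : E × E → E × E}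
    {Ω : Set (E × E)} {z₀ : E × E} (hΩ : IsOpen Ω) (hz₀ : z₀ ∈ Ω) (hℓ : ContDiffOn ℝ ∞ ℓ Ω)
    (hf : ContDiffOn ℝ ∞ f Ω) (hfst : ∀ x ∈ Ω, (f x).1 = x.2) :
    ∃ ε > 0, ∃ r > 0, ∃ (Θ : ℝ → E × E → E × E) (M : ℝ → E × E → E × E →L[ℝ] E × E),
      ∀ z ∈ Metric.ball z₀ r, Θ 0 z = z ∧
        (∀ s, |s| < ε → Θ s z ∈ Ω ∧ HasDerivAt (fun s => Θ s z) (f (Θ s z)) s ∧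
          HasFDerivAt (Θ s) (M s z) z) ∧
        (∀ ξ, ContDiffOn ℝ ∞ (fun s => (Θ s z, M s z ξ)) (Ioo (-ε) ε)) ∧
        ∀ σ τ, |σ| < ε → |τ| < ε →
          (∀ ξ, IntervalIntegrable (fun s => eulerLagrangeForm ℓ f (Θ s z) (M s z ξ).1)
            volume σ τ) ∧
          ∃ A : E × E →L[ℝ] ℝ, HasFDerivAt (fun z => ∫ s in σ..τ, ℓ (Θ s z)) A z ∧
            ∀ ξ, A ξ = -(∫ s in σ..τ, eulerLagrangeForm ℓ f (Θ s z) (M s z ξ).1) +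
              fiberDeriv ℓ (Θ τ z) (M τ z ξ).1 - fiberDeriv ℓ (Θ σ z) (M σ z ξ).1 := by
  obtain ⟨ε, hε, r, hr, Θ, M, hΘ, hc⟩ :=
    exists_localFlow (hΩ.mem_nhds hz₀) (hf.contDiffAt (hΩ.mem_nhds hz₀))
  refine ⟨ε, hε, r, hr, Θ, M, fun z hz => ⟨(hΘ z hz).1, fun s hs => ?_, fun ξ => ?_, ?_⟩⟩
  · obtain ⟨h1, h2, -, h4⟩ := (hΘ z hz).2.2 s hs
    exact ⟨h1, h2, h4⟩
  · intro s hs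
    -- The pair solves a smooth autonomous system, and the equation bootstraps smoothness in time;
    -- this is applied on a closed interval around `s` inside the domain.
    obtain ⟨δ, hδs, hδε⟩ := exists_between (abs_lt.2 hs)
    have hn : Icc (-δ) δ ∈ 𝓝 s :=
      Icc_mem_nhds (by linarith [neg_le_abs s]) (by linarith [le_abs_self s])
    have hlt : ∀ s ∈ Icc (-δ) δ, |s| < ε := fun s hs => (abs_le.2 hs).trans_lt hδε
    have hf' : ContDiffOn ℝ ∞ (fderiv ℝ f) Ω := hf.fderiv_of_isOpen hΩ (by simp)
    have hg : ContDiffOn ℝ ∞ (fun x : (E × E) × (E × E) => (f x.1, fderiv ℝ f x.1 x.2))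
        (Ω ×ˢ univ) :=
      (hf.comp contDiffOn_fst fun x hx => hx.1).prodMk
        ((hf'.comp contDiffOn_fst fun x hx => hx.1).clm_apply contDiffOn_snd)
    have := ODE.contDiffOn_enat_Icc_of_hasDerivWithinAt (n := ⊤) (tmin := -δ) (tmax := δ)
      (f := fun _ (x : (E × E) × (E × E)) => (f x.1, fderiv ℝ f x.1 x.2)) (u := Ω ×ˢ univ)
      (α := fun s => (Θ s z, M s z ξ))
      (hg.comp contDiffOn_snd fun x hx => hx.2)
      (fun s hs => by
        obtain ⟨-, h2, h3, -⟩ := (hΘ z hz).2.2 s (hlt s hs)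
        exact (h2.prodMk ((h3.clm_apply (hasDerivAt_const s ξ)).congr_deriv
          (by simp))).hasDerivWithinAt)
      (fun s hs => ⟨((hΘ z hz).2.2 s (hlt s hs)).1, trivial⟩)
    exact (this.contDiffAt hn).contDiffWithinAt
  · intro σ τ hσ hτ
    have hsub : uIcc σ τ ⊆ Ioo (-ε) ε := ordConnected_Ioo.uIcc_subset (abs_lt.1 hσ) (abs_lt.1 hτ)
    have hlt : ∀ s ∈ uIcc σ τ, |s| < ε := fun s hs => abs_lt.2 (hsub hs)
    have hℓ' : ContDiffOn ℝ ∞ (fderiv ℝ ℓ) Ω := hℓ.fderiv_of_isOpen hΩ (by simp)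
    have hmaps : ∀ x ∈ Ioo (-ε) ε ×ˢ Metric.ball z₀ r, Θ x.1 x.2 ∈ Ω := fun x hx =>
      ((hΘ _ hx.2).2.2 _ (abs_lt.2 hx.1)).1
    have hF' : ContinuousOn (fun x : ℝ × (E × E) => (fderiv ℝ ℓ (Θ x.1 x.2)).comp (M x.1 x.2))
        (Ioo (-ε) ε ×ˢ Metric.ball z₀ r) :=
      (hℓ'.continuousOn.comp hc.fst hmaps).clm_comp hc.snd
    have hF : ContinuousOn (fun x : ℝ × (E × E) => ℓ (Θ x.1 x.2))
        (Ioo (-ε) ε ×ˢ Metric.ball z₀ r) := hℓ.continuousOn.comp hc.fst hmaps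
    have hslice : ∀ x ∈ Metric.ball z₀ r, ContinuousOn (fun s : ℝ => (s, x)) (uIcc σ τ) ∧
        MapsTo (fun s : ℝ => (s, x)) (uIcc σ τ) (Ioo (-ε) ε ×ˢ Metric.ball z₀ r) := fun x hx =>
      ⟨by fun_prop, fun s hs => ⟨hsub hs, hx⟩⟩
    have hEL : ∀ ξ, ContinuousOn (fun s => eulerLagrangeForm ℓ f (Θ s z) (M s z ξ).1)
        (uIcc σ τ) := fun ξ => by
      have h1 := ((continuousOn_eulerLagrangeForm hΩ hℓ hf).comp hc.fst hmaps).comp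
        (hslice z hz).1 (hslice z hz).2
      have h2 := hc.snd.comp (hslice z hz).1 (hslice z hz).2
      exact h1.clm_apply (h2.clm_apply continuousOn_const).fst
    -- Closed balls are compact in finite dimension, so joint continuity of `Θ` and `M` gives a
    -- constant that dominates the differentiated integrand near `z`.
    obtain ⟨ρ, hρ, hρz⟩ := Metric.nhds_basis_closedBall.mem_iff.1 (Metric.isOpen_ball.mem_nhds hz)
    obtain ⟨C, hC⟩ := (isCompact_uIcc.prod (isCompact_closedBall z ρ)).exists_bound_of_continuousOn
      (hF'.mono (prod_mono hsub hρz))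
    have hD := intervalIntegral.hasFDerivAt_integral_of_dominated_of_fderiv_le (𝕜 := ℝ)
      (μ := volume) (a := σ) (b := τ) (F := fun x s => ℓ (Θ s x))
      (F' := fun x s => (fderiv ℝ ℓ (Θ s x)).comp (M s x)) (x₀ := z) (bound := fun _ => C)
      (Metric.closedBall_mem_nhds z hρ)
      (by
        filter_upwards [Metric.isOpen_ball.mem_nhds hz] with x hx
        exact ((hF.comp (hslice x hx).1 (hslice x hx).2).mono uIoc_subset_uIcc).aestronglyMeasurable
          measurableSet_uIoc)
      ((hF.comp (hslice z hz).1 (hslice z hz).2).intervalIntegrable)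
      (((hF'.comp (hslice z hz).1 (hslice z hz).2).mono uIoc_subset_uIcc).aestronglyMeasurable
          measurableSet_uIoc)
      (ae_of_all _ fun s hs x hx => hC (s, x) ⟨uIoc_subset_uIcc hs, hx⟩)
      intervalIntegrable_const
      (ae_of_all _ fun s hs x hx => by
        obtain ⟨h1, -, -, h4⟩ := (hΘ x (hρz hx)).2.2 s (hlt s (uIoc_subset_uIcc hs))
        exact (((hℓ.contDiffAt (hΩ.mem_nhds h1)).differentiableAt (by simp)).hasFDerivAt).comp x h4)
    refine ⟨fun ξ => (hEL ξ).intervalIntegrable, _, hD, fun ξ => ?_⟩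
    have hI : IntervalIntegrable (fun s => (fderiv ℝ ℓ (Θ s z)).comp (M s z)) volume σ τ :=
      (hF'.comp (hslice z hz).1 (hslice z hz).2).intervalIntegrable
    have hIξ : IntervalIntegrable (fun s => fderiv ℝ ℓ (Θ s z) (M s z ξ)) volume σ τ :=
      ((hF'.comp (hslice z hz).1 (hslice z hz).2).clm_apply
        (continuousOn_const (c := ξ))).intervalIntegrable
    have hFTC := intervalIntegral.integral_eq_sub_of_hasDerivAt
      (f := fun s => fiberDeriv ℓ (Θ s z) (M s z ξ).1)
      (f' := fun s => fderiv ℝ ℓ (Θ s z) (M s z ξ) +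
        eulerLagrangeForm ℓ f (Θ s z) (M s z ξ).1) (a := σ) (b := τ)
      (fun s hs => by
        obtain ⟨h1, h2, h3, -⟩ := (hΘ z hz).2.2 s (hlt s hs)
        have hn := hΩ.mem_nhds h1
        refine hasDerivAt_fiberDeriv_variation (z := fun s => Θ s z) (m := fun s => M s z ξ)
          (by exact_mod_cast contDiffAt_infty.1 (hℓ.contDiffAt hn) 2)
          ((hf.contDiffAt hn).differentiableAt (by simp))
          (Filter.eventually_of_mem hn fun x hx => hfst x hx) h2 ?_
        exact (h3.clm_apply (hasDerivAt_const s ξ)).congr_deriv (by simp))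
      (hIξ.add (hEL ξ).intervalIntegrable)
    rw [intervalIntegral.integral_add hIξ (hEL ξ).intervalIntegrable] at hFTC
    rw [ContinuousLinearMap.intervalIntegral_apply hI]
    simp only [ContinuousLinearMap.comp_apply]
    linarith

end LocalLagrangian

/-! ### Natural charts of the tangent bundle and their transition maps -/

section Charts

variable {E : Type*} [NormedAddCommGroup E] [NormedSpace ℝ E]
  {Q : Type*} [TopologicalSpace Q] [ChartedSpace E Q] [IsManifold 𝓘(ℝ, E) ∞ Q]

theorem mem_extChartAt_tangent_source {v₀ v : TangentBundle 𝓘(ℝ, E) Q} :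
    v ∈ (extChartAt 𝓘(ℝ, E).tangent v₀).source ↔ v.proj ∈ (extChartAt 𝓘(ℝ, E) v₀.proj).source := by
  rw [extChartAt_source, extChartAt_source]
  exact TangentBundle.mem_chart_source_iff v v₀

theorem extChartAt_tangent_apply (v₀ v : TangentBundle 𝓘(ℝ, E) Q) :
    extChartAt 𝓘(ℝ, E).tangent v₀ v = (extChartAt 𝓘(ℝ, E) v₀.proj v.proj,
      tangentCoordChange 𝓘(ℝ, E) v.proj v₀.proj v.proj v.2) := rfl

theorem mem_extChartAt_tangent_target {v₀ : TangentBundle 𝓘(ℝ, E) Q} {z : E × E} :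
    z ∈ (extChartAt 𝓘(ℝ, E).tangent v₀).target ↔ z.1 ∈ (extChartAt 𝓘(ℝ, E) v₀.proj).target := by
  have := TangentBundle.mem_chart_target_iff (I := 𝓘(ℝ, E)) z v₀
  simp only [extChartAt_target, mem_inter_iff, ModelWithCorners.range_eq_univ, mem_univ, and_true]
  exact this

theorem extChartAt_tangent_symm_apply (v₀ : TangentBundle 𝓘(ℝ, E) Q) (z : E × E) :
    (extChartAt 𝓘(ℝ, E).tangent v₀).symm z = ⟨(extChartAt 𝓘(ℝ, E) v₀.proj).symm z.1,
      tangentCoordChange 𝓘(ℝ, E) v₀.proj ((extChartAt 𝓘(ℝ, E) v₀.proj).symm z.1)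
        ((extChartAt 𝓘(ℝ, E) v₀.proj).symm z.1) z.2⟩ :=
  rfl

/-- The derivative of the chart of `TQ` at `v₀`. -/
def chartDeriv (v₀ v : TangentBundle 𝓘(ℝ, E) Q) :
    E × E →L[ℝ] E × E :=
  mfderiv 𝓘(ℝ, E).tangent 𝓘(ℝ, E × E) (extChartAt 𝓘(ℝ, E).tangent v₀) v

theorem hasMFDerivAt_chart {v₀ v : TangentBundle 𝓘(ℝ, E) Q}
    (hv : v ∈ (extChartAt 𝓘(ℝ, E).tangent v₀).source) :
    HasMFDerivAt 𝓘(ℝ, E).tangent 𝓘(ℝ, E × E) (extChartAt 𝓘(ℝ, E).tangent v₀) v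
      (chartDeriv v₀ v) :=
  (mdifferentiableAt_extChartAt (by rwa [← extChartAt_source (I := 𝓘(ℝ, E).tangent)])).hasMFDerivAt

/-- The transition map from the chart of `TQ` at `v` to the one at `v₀`. -/
def chartTransition (v₀ v : TangentBundle 𝓘(ℝ, E) Q) (z : E × E) : E × E :=
  extChartAt 𝓘(ℝ, E).tangent v₀ ((extChartAt 𝓘(ℝ, E).tangent v).symm z)

theorem hasFDerivAt_chartTransition {v₀ v : TangentBundle 𝓘(ℝ, E) Q}
    (hv : v ∈ (extChartAt 𝓘(ℝ, E).tangent v₀).source) :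
    HasFDerivAt (chartTransition v₀ v) (chartDeriv v₀ v) (extChartAt 𝓘(ℝ, E).tangent v v) := by
  have h := (hasMFDerivAt_chart hv).2
  rw [ModelWithCorners.range_eq_univ] at h
  have h' : HasFDerivWithinAt (chartTransition v₀ v) (chartDeriv v₀ v) univ
    (extChartAt 𝓘(ℝ, E).tangent v v) := h
  exact h'.hasFDerivAt_of_univ

/-- The transition maps of the natural charts of `TQ` are tangent maps. -/
theorem chartTransition_eventuallyEq {v₀ v : TangentBundle 𝓘(ℝ, E) Q}
    (hv : v ∈ (extChartAt 𝓘(ℝ, E).tangent v₀).source) :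
    ∃ F : E → E, ContDiffAt ℝ ∞ F (extChartAt 𝓘(ℝ, E).tangent v v).1 ∧
      chartTransition v₀ v =ᶠ[𝓝 (extChartAt 𝓘(ℝ, E).tangent v v)]
        fun z => (F z.1, fderiv ℝ F z.1 z.2) := by
  rw [mem_extChartAt_tangent_source] at hv
  have hself : v.proj ∈ (extChartAt 𝓘(ℝ, E) v.proj).source := mem_extChartAt_source v.proj
  refine ⟨extChartAt 𝓘(ℝ, E) v₀.proj ∘ (extChartAt 𝓘(ℝ, E) v.proj).symm, ?_, ?_⟩
  · have h := contDiffWithinAt_ext_coord_change (I := 𝓘(ℝ, E)) (n := ∞) v₀.proj v.proj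
      (y := extChartAt 𝓘(ℝ, E) v.proj v.proj) (by
        rw [PartialEquiv.trans_source'', PartialEquiv.symm_symm, PartialEquiv.symm_target]
        exact mem_image_of_mem _ ⟨hself, hv⟩)
    rw [ModelWithCorners.range_eq_univ, contDiffWithinAt_univ] at h
    exact h
  · have hn : ∀ᶠ z : E × E in 𝓝 (extChartAt 𝓘(ℝ, E).tangent v v),
        z.1 ∈ (extChartAt 𝓘(ℝ, E) v.proj).target ∧
          (extChartAt 𝓘(ℝ, E) v.proj).symm z.1 ∈ (extChartAt 𝓘(ℝ, E) v₀.proj).source := by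
      refine continuousAt_fst.eventually (p := fun x => x ∈ (extChartAt 𝓘(ℝ, E) v.proj).target ∧
          (extChartAt 𝓘(ℝ, E) v.proj).symm x ∈ (extChartAt 𝓘(ℝ, E) v₀.proj).source) ?_
      refine (Filter.eventually_of_mem (extChartAt_target_mem_nhds v.proj) fun _ h => h).and ?_
      refine (continuousAt_extChartAt_symm v.proj).eventually
        (Filter.eventually_of_mem ?_ fun _ h => h)
      rw [extChartAt_to_inv]
      exact (isOpen_extChartAt_source v₀.proj).mem_nhds hv
    filter_upwards [hn] with z hz
    obtain ⟨h1, h2⟩ := hz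
    have h3 := (extChartAt 𝓘(ℝ, E) v.proj).map_target h1
    rw [chartTransition, extChartAt_tangent_symm_apply, extChartAt_tangent_apply]
    refine Prod.ext rfl ?_
    change tangentCoordChange 𝓘(ℝ, E) ((extChartAt 𝓘(ℝ, E) v.proj).symm z.1) v₀.proj _
      (tangentCoordChange 𝓘(ℝ, E) v.proj ((extChartAt 𝓘(ℝ, E) v.proj).symm z.1) _ z.2) = _
    rw [tangentCoordChange_comp ⟨⟨h3, mem_extChartAt_source _⟩, h2⟩, tangentCoordChange_def,
      ModelWithCorners.range_eq_univ, fderivWithin_univ, (extChartAt 𝓘(ℝ, E) v.proj).right_inv h1]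

/-- Both sides differentiate the base chart composed with the projection. Hence semibasic forms on
`TQ` see only the first component in a chart. -/
theorem chartDeriv_fst {v₀ v : TangentBundle 𝓘(ℝ, E) Q}
    (hv : v ∈ (extChartAt 𝓘(ℝ, E).tangent v₀).source) (Y : TangentSpace 𝓘(ℝ, E).tangent v) :
    (chartDeriv v₀ v Y).1 =
      tangentCoordChange 𝓘(ℝ, E) v.proj v₀.proj v.proj (tangentProj v Y) := by
  have hv' : v.proj ∈ (chartAt E v₀.proj).source := by
    rwa [mem_extChartAt_tangent_source, extChartAt_source] at hv
  have h1 : HasMFDerivAt 𝓘(ℝ, E).tangent 𝓘(ℝ, E)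
      (fun w => (extChartAt 𝓘(ℝ, E).tangent v₀ w).1) v
      ((ContinuousLinearMap.fst ℝ E E).comp (chartDeriv v₀ v)) :=
    HasMFDerivAt.comp v ((ContinuousLinearMap.fst ℝ E E).hasMFDerivAt) (hasMFDerivAt_chart hv)
  have h2 : HasMFDerivAt 𝓘(ℝ, E).tangent 𝓘(ℝ, E)
      (extChartAt 𝓘(ℝ, E) v₀.proj ∘ (proj : TangentBundle 𝓘(ℝ, E) Q → Q)) v
      ((tangentCoordChange 𝓘(ℝ, E) v.proj v₀.proj v.proj).comp (tangentProj v)) := by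
    have h3 := hasMFDerivAt_extChartAt (I := 𝓘(ℝ, E)) hv'
    rw [mfderiv_chartAt_eq_tangentCoordChange hv'] at h3
    exact HasMFDerivAt.comp (I := 𝓘(ℝ, E).tangent) (I' := 𝓘(ℝ, E)) (I'' := 𝓘(ℝ, E)) v h3
      (Bundle.mdifferentiableAt_proj _).hasMFDerivAt
  exact congrArg (fun A : E × E →L[ℝ] E => A Y) (hasMFDerivAt_unique h1 h2)

end Charts

/-! ### The Poincaré–Cartan form, the Legendre map and the energy in an arbitrary natural chart -/

section ChartForms

variable {E : Type*} [NormedAddCommGroup E] [NormedSpace ℝ E]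

/-- The vertical endomorphism in coordinates. -/
def vertEndo (E : Type*) [NormedAddCommGroup E] [NormedSpace ℝ E] : E × E →L[ℝ] E × E :=
  (ContinuousLinearMap.inr ℝ E E).comp (ContinuousLinearMap.fst ℝ E E)

@[simp] theorem vertEndo_apply (z : E × E) : vertEndo E z = (0, z.1) := rfl

theorem contDiffAt_tangentMap {F : E → E} {z : E × E} (hF : ContDiffAt ℝ ∞ F z.1) :
    ContDiffAt ℝ ∞ (fun z : E × E => (F z.1, fderiv ℝ F z.1 z.2)) z := by
  have h1 : ContDiffAt ℝ ∞ (fun z : E × E => F z.1) z := ContDiffAt.comp z hF contDiffAt_fst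
  have h2 : ContDiffAt ℝ ∞ (fun z : E × E => fderiv ℝ F z.1) z :=
    ContDiffAt.comp z (hF.fderiv_right (m := ∞) (by simp)) contDiffAt_fst
  exact h1.prodMk (h2.clm_apply contDiffAt_snd)

/-- Tangent maps commute with the vertical endomorphism. -/
theorem fderiv_tangentMap_comp_vertEndo {F : E → E} {z : E × E} (hF : ContDiffAt ℝ 2 F z.1) :
    (fderiv ℝ (fun z : E × E => (F z.1, fderiv ℝ F z.1 z.2)) z).comp (vertEndo E) =
      (vertEndo E).comp (fderiv ℝ (fun z : E × E => (F z.1, fderiv ℝ F z.1 z.2)) z) := by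
  have h1 : HasFDerivAt (fun z : E × E => F z.1)
      ((fderiv ℝ F z.1).comp (ContinuousLinearMap.fst ℝ E E)) z :=
    ((hF.differentiableAt (by simp)).hasFDerivAt).comp z hasFDerivAt_fst
  have h2 : HasFDerivAt (fderiv ℝ F) (fderiv ℝ (fderiv ℝ F) z.1) z.1 :=
    ((hF.fderiv_right (m := 1) (by norm_num)).differentiableAt (by simp)).hasFDerivAt
  have h3 := (h2.comp z hasFDerivAt_fst).clm_apply (hasFDerivAt_snd (𝕜 := ℝ) (p := z))
  have h4 := (h1.prodMk h3).fderiv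
  simp only [Function.comp_apply] at h4
  rw [h4]
  ext x <;> simp

/-- The second order part of the differential of `S^* dℓ` is symmetric under changes of
coordinates induced from the base. -/
theorem fderiv_comp_vertEndo_comp_tangentMap {ℓ₀ ℓ₁ : E × E → ℝ} {τ : E × E → E × E} {z : E × E}
    {F : E → E} (hF : ContDiffAt ℝ ∞ F z.1)
    (hτ : τ =ᶠ[𝓝 z] fun z => (F z.1, fderiv ℝ F z.1 z.2))
    (hℓ₀ : ContDiffAt ℝ ∞ ℓ₀ (τ z)) (hℓ : ℓ₁ =ᶠ[𝓝 z] ℓ₀ ∘ τ) (X Y : E × E) :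
    fderiv ℝ (fun z => (fderiv ℝ ℓ₁ z).comp (vertEndo E)) z Y X -
        fderiv ℝ (fun z => (fderiv ℝ ℓ₁ z).comp (vertEndo E)) z X Y =
      fderiv ℝ (fderiv ℝ ℓ₀) (τ z) (fderiv ℝ τ z Y) (0, (fderiv ℝ τ z X).1) -
        fderiv ℝ (fderiv ℝ ℓ₀) (τ z) (fderiv ℝ τ z X) (0, (fderiv ℝ τ z Y).1) := by
  have hτs : ContDiffAt ℝ ∞ τ z := (contDiffAt_tangentMap hF).congr_of_eventuallyEq hτ
  have hFz : ∀ᶠ x : E × E in 𝓝 z, ContDiffAt ℝ 2 F x.1 := by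
    refine continuousAt_fst.eventually (p := fun x => ContDiffAt ℝ 2 F x) ?_
    exact (show ContDiffAt ℝ 2 F z.1 by exact_mod_cast contDiffAt_infty.1 hF 2).eventually (by simp)
  have hS : ∀ᶠ x in 𝓝 z, (fderiv ℝ τ x).comp (vertEndo E) = (vertEndo E).comp (fderiv ℝ τ x) := by
    filter_upwards [hτ.eventuallyEq_nhds, hFz] with x hx hFx
    rw [hx.fderiv_eq]
    exact fderiv_tangentMap_comp_vertEndo hFx
  have hd : ∀ᶠ x in 𝓝 z, DifferentiableAt ℝ ℓ₀ (τ x) ∧ DifferentiableAt ℝ τ x := by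
    have h1 : ∀ᶠ y in 𝓝 (τ z), ContDiffAt ℝ 1 ℓ₀ y :=
      (show ContDiffAt ℝ 1 ℓ₀ (τ z) from hℓ₀.of_le (by simp)).eventually (by simp)
    have h2 : ∀ᶠ x in 𝓝 z, ContDiffAt ℝ 1 τ x :=
      (show ContDiffAt ℝ 1 τ z from hτs.of_le (by simp)).eventually (by simp)
    filter_upwards [hτs.continuousAt.eventually h1, h2] with x h1 h2
    exact ⟨h1.differentiableAt (by simp), h2.differentiableAt (by simp)⟩
  -- Since the vertical endomorphism commutes with tangent maps, the one-form of `ℓ₁` is the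
  -- pullback by `τ` of the one-form of `ℓ₀`.
  have hθ : (fun z => (fderiv ℝ ℓ₁ z).comp (vertEndo E)) =ᶠ[𝓝 z]
      fun x => ((fderiv ℝ ℓ₀ (τ x)).comp (vertEndo E)).comp (fderiv ℝ τ x) := by
    filter_upwards [hℓ.eventuallyEq_nhds, hS, hd] with x h1 h2 h3
    rw [h1.fderiv_eq, fderiv_comp x h3.1 h3.2, ContinuousLinearMap.comp_assoc, h2]
    rfl
  have h1 : HasFDerivAt (fderiv ℝ ℓ₀) (fderiv ℝ (fderiv ℝ ℓ₀) (τ z)) (τ z) :=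
    ((hℓ₀.fderiv_right (m := ∞) (by simp)).differentiableAt (by simp)).hasFDerivAt
  have h2 : HasFDerivAt (fderiv ℝ τ) (fderiv ℝ (fderiv ℝ τ) z) z :=
    ((hτs.fderiv_right (m := ∞) (by simp)).differentiableAt (by simp)).hasFDerivAt
  have h3 : HasFDerivAt τ (fderiv ℝ τ z) z := (hτs.differentiableAt (by simp)).hasFDerivAt
  have h4 := ((h1.comp z h3).clm_comp (hasFDerivAt_const (vertEndo E) z)).clm_comp h2
  -- The terms containing the second derivative of `τ` are symmetric in `X` and `Y`, so they drop
  -- out of the antisymmetrised expression.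
  have hsymm : fderiv ℝ (fderiv ℝ τ) z X Y = fderiv ℝ (fderiv ℝ τ) z Y X :=
    ((show ContDiffAt ℝ 2 τ z by exact_mod_cast contDiffAt_infty.1 hτs 2).isSymmSndFDerivAt
      (by simp)).eq X Y
  have h5 := h4.fderiv
  simp only [Function.comp_apply] at h5
  rw [hθ.fderiv_eq, h5]
  simp [hsymm]

variable {Q : Type*} [TopologicalSpace Q] [ChartedSpace E Q] [IsManifold 𝓘(ℝ, E) ∞ Q]

/-- A function on `TQ` in the natural chart at `v₀`. -/
def inChart (L : TangentBundle 𝓘(ℝ, E) Q → ℝ) (v₀ : TangentBundle 𝓘(ℝ, E) Q) (z : E × E) : ℝ :=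
  L ((extChartAt 𝓘(ℝ, E).tangent v₀).symm z)

theorem inChart_apply_chart {L : TangentBundle 𝓘(ℝ, E) Q → ℝ} {v₀ v : TangentBundle 𝓘(ℝ, E) Q}
    (hv : v ∈ (extChartAt 𝓘(ℝ, E).tangent v₀).source) :
    inChart L v₀ (extChartAt 𝓘(ℝ, E).tangent v₀ v) = L v := by
  rw [inChart, (extChartAt 𝓘(ℝ, E).tangent v₀).left_inv hv]

theorem contDiffOn_inChart {L : TangentBundle 𝓘(ℝ, E) Q → ℝ} {W : Set (TangentBundle 𝓘(ℝ, E) Q)}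
    (hL : ContMDiffOn 𝓘(ℝ, E).tangent 𝓘(ℝ, ℝ) ∞ L W) (v₀ : TangentBundle 𝓘(ℝ, E) Q) :
    ContDiffOn ℝ ∞ (inChart L v₀) ((extChartAt 𝓘(ℝ, E).tangent v₀).target ∩
      (extChartAt 𝓘(ℝ, E).tangent v₀).symm ⁻¹' W) := by
  rw [← contMDiffOn_iff_contDiffOn]
  have h := (contMDiffOn_extChartAt_symm (I := 𝓘(ℝ, E).tangent) (n := ∞) v₀)
  exact hL.comp (h.mono inter_subset_left) inter_subset_right

theorem contDiffAt_inChart {L : TangentBundle 𝓘(ℝ, E) Q → ℝ} {v₀ v : TangentBundle 𝓘(ℝ, E) Q}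
    (hL : ContMDiff 𝓘(ℝ, E).tangent 𝓘(ℝ, ℝ) ∞ L)
    (hv : v ∈ (extChartAt 𝓘(ℝ, E).tangent v₀).source) :
    ContDiffAt ℝ ∞ (inChart L v₀) (extChartAt 𝓘(ℝ, E).tangent v₀ v) := by
  have h := contDiffOn_inChart hL.contMDiffOn v₀ (W := univ)
  rw [preimage_univ, inter_univ] at h
  exact h.contDiffAt ((isOpen_extChartAt_target v₀).mem_nhds
    ((extChartAt 𝓘(ℝ, E).tangent v₀).map_source hv))

theorem chartTransition_self_apply (v₀ v : TangentBundle 𝓘(ℝ, E) Q) :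
    chartTransition v₀ v (extChartAt 𝓘(ℝ, E).tangent v v) =
      extChartAt 𝓘(ℝ, E).tangent v₀ v := by
  rw [chartTransition, extChartAt_to_inv]

theorem inChart_eventuallyEq (L : TangentBundle 𝓘(ℝ, E) Q → ℝ) {v₀ v : TangentBundle 𝓘(ℝ, E) Q}
    (hv : v ∈ (extChartAt 𝓘(ℝ, E).tangent v₀).source) :
    inChart L v =ᶠ[𝓝 (extChartAt 𝓘(ℝ, E).tangent v v)] inChart L v₀ ∘ chartTransition v₀ v := by
  have h : ∀ᶠ z in 𝓝 (extChartAt 𝓘(ℝ, E).tangent v v),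
      (extChartAt 𝓘(ℝ, E).tangent v).symm z ∈ (extChartAt 𝓘(ℝ, E).tangent v₀).source := by
    refine (continuousAt_extChartAt_symm v).eventually (Filter.eventually_of_mem ?_ fun _ h => h)
    rw [extChartAt_to_inv]
    exact (isOpen_extChartAt_source v₀).mem_nhds hv
  filter_upwards [h] with z hz
  exact (inChart_apply_chart hz).symm

/-- The Poincaré–Cartan two-form in the natural chart at `v₀`. -/
theorem contractOmega_apply {L : TangentBundle 𝓘(ℝ, E) Q → ℝ}
    (hL : ContMDiff 𝓘(ℝ, E).tangent 𝓘(ℝ, ℝ) ∞ L) {v₀ v : TangentBundle 𝓘(ℝ, E) Q}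
    (hv : v ∈ (extChartAt 𝓘(ℝ, E).tangent v₀).source) (X Y : E × E) :
    contractOmega L v X Y =
      fderiv ℝ (fderiv ℝ (inChart L v₀)) (extChartAt 𝓘(ℝ, E).tangent v₀ v) (chartDeriv v₀ v Y)
          (0, (chartDeriv v₀ v X).1) -
        fderiv ℝ (fderiv ℝ (inChart L v₀)) (extChartAt 𝓘(ℝ, E).tangent v₀ v) (chartDeriv v₀ v X)
          (0, (chartDeriv v₀ v Y).1) := by
  obtain ⟨F, hF, hFτ⟩ := chartTransition_eventuallyEq hv
  have hτ := hasFDerivAt_chartTransition hv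
  have h := fderiv_comp_vertEndo_comp_tangentMap (ℓ₀ := inChart L v₀) (ℓ₁ := inChart L v) hF hFτ
    (by rw [chartTransition_self_apply]; exact contDiffAt_inChart hL hv)
    (inChart_eventuallyEq L hv) X Y
  rw [hτ.fderiv, chartTransition_self_apply] at h
  exact h

theorem hasFDerivAt_fiberDeriv {ℓ : E × E → ℝ} {z : E × E} (hℓ : DifferentiableAt ℝ ℓ z) :
    HasFDerivAt (fun u => ℓ (z.1, u)) (fiberDeriv ℓ z) z.2 :=
  HasFDerivAt.comp z.2 hℓ.hasFDerivAt (hasFDerivAt_prodMk_right z.1 z.2)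

/-- The Legendre transformation in the natural chart at `v₀`. -/
theorem legendre_apply {L : TangentBundle 𝓘(ℝ, E) Q → ℝ}
    (hL : ContMDiff 𝓘(ℝ, E).tangent 𝓘(ℝ, ℝ) ∞ L) {v₀ v : TangentBundle 𝓘(ℝ, E) Q}
    (hv : v ∈ (extChartAt 𝓘(ℝ, E).tangent v₀).source) (w : E) :
    legendre L v w = fiberDeriv (inChart L v₀) (extChartAt 𝓘(ℝ, E).tangent v₀ v)
      (tangentCoordChange 𝓘(ℝ, E) v.proj v₀.proj v.proj w) := by
  have h1 : (fun u : E => L ⟨v.proj, u⟩) = fun u : E =>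
      inChart L v₀ (extChartAt 𝓘(ℝ, E) v₀.proj v.proj,
        tangentCoordChange 𝓘(ℝ, E) v.proj v₀.proj v.proj u) := by
    funext u
    have hu : (⟨v.proj, u⟩ : TangentBundle 𝓘(ℝ, E) Q) ∈ (extChartAt 𝓘(ℝ, E).tangent v₀).source :=
      mem_extChartAt_tangent_source.2 (mem_extChartAt_tangent_source.1 hv)
    exact (inChart_apply_chart hu).symm
  have h2 := HasFDerivAt.comp (E := E) (F := E) (G := ℝ) v.2 (hasFDerivAt_fiberDeriv
    ((contDiffAt_inChart hL hv).differentiableAt (by simp)))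
    (tangentCoordChange 𝓘(ℝ, E) v.proj v₀.proj v.proj).hasFDerivAt
  have h3 := h2.fderiv
  change fderiv ℝ (fun u : E => L ⟨v.proj, u⟩) v.2 w = _
  rw [h1]
  exact congrArg (fun A : E →L[ℝ] ℝ => A w) h3

/-- The energy in coordinates. -/
def chartEnergy (ℓ : E × E → ℝ) (z : E × E) : ℝ := fiberDeriv ℓ z z.2 - ℓ z

/-- Differentiating the argument `z.2` of the momentum produces `dℓ(0, Y.2)`, which cancels the
vertical part of the differential of `-ℓ`. -/
theorem fderiv_chartEnergy {ℓ : E × E → ℝ} {z : E × E} (hℓ : ContDiffAt ℝ ∞ ℓ z) :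
    DifferentiableAt ℝ (chartEnergy ℓ) z ∧ ∀ Y, fderiv ℝ (chartEnergy ℓ) z Y =
      fderiv ℝ (fderiv ℝ ℓ) z Y (0, z.2) - fderiv ℝ ℓ z (Y.1, 0) := by
  have h1 : HasFDerivAt (fderiv ℝ ℓ) (fderiv ℝ (fderiv ℝ ℓ) z) z :=
    ((hℓ.fderiv_right (m := ∞) (by simp)).differentiableAt (by simp)).hasFDerivAt
  have h2 : HasFDerivAt (fun z : E × E => ((0 : E), z.2))
      ((ContinuousLinearMap.inr ℝ E E).comp (ContinuousLinearMap.snd ℝ E E)) z :=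
    ((ContinuousLinearMap.inr ℝ E E).comp (ContinuousLinearMap.snd ℝ E E)).hasFDerivAt
  have h3 : HasFDerivAt (chartEnergy ℓ) _ z :=
    (h1.clm_apply h2).sub (hℓ.differentiableAt (by simp)).hasFDerivAt
  refine ⟨h3.differentiableAt, fun Y => ?_⟩
  have hY : Y = (Y.1, 0) + (0, Y.2) := by simp
  have h4 : fderiv ℝ ℓ z Y = fderiv ℝ ℓ z (Y.1, 0) + fderiv ℝ ℓ z (0, Y.2) := by
    rw [← map_add, ← hY]
  rw [h3.fderiv]
  simp [h4]
  ring

theorem dEnergy_apply {L : TangentBundle 𝓘(ℝ, E) Q → ℝ}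
    (hL : ContMDiff 𝓘(ℝ, E).tangent 𝓘(ℝ, ℝ) ∞ L) {v₀ v : TangentBundle 𝓘(ℝ, E) Q}
    (hv : v ∈ (extChartAt 𝓘(ℝ, E).tangent v₀).source) (Y : E × E) :
    dEnergy L v Y = fderiv ℝ (chartEnergy (inChart L v₀)) (extChartAt 𝓘(ℝ, E).tangent v₀ v)
      (chartDeriv v₀ v Y) := by
  have h1 : energy L =ᶠ[𝓝 v]
      chartEnergy (inChart L v₀) ∘ extChartAt 𝓘(ℝ, E).tangent v₀ := by
    filter_upwards [(isOpen_extChartAt_source v₀).mem_nhds hv] with w hw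
    rw [energy, show legendre L w w.2 = _ from legendre_apply hL hw w.2,
      Function.comp_apply, chartEnergy, inChart_apply_chart hw]
    rfl
  have h2 := HasMFDerivAt.comp v
    (fderiv_chartEnergy (contDiffAt_inChart hL hv)).1.hasFDerivAt.hasMFDerivAt
    (hasMFDerivAt_chart hv)
  exact congrArg (fun A : E × E →L[ℝ] ℝ => A Y) (h2.congr_of_eventuallyEq h1).mfderiv

/-- For a second order vector `X`, the one-form `i_X ω_L - dE_L` is minus the Euler–Lagrange
form. -/
theorem contractOmega_sub_dEnergy_apply {L : TangentBundle 𝓘(ℝ, E) Q → ℝ}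
    (hL : ContMDiff 𝓘(ℝ, E).tangent 𝓘(ℝ, ℝ) ∞ L) {v₀ v : TangentBundle 𝓘(ℝ, E) Q}
    (hv : v ∈ (extChartAt 𝓘(ℝ, E).tangent v₀).source) {X : E × E}
    (hX : (chartDeriv v₀ v X).1 = (extChartAt 𝓘(ℝ, E).tangent v₀ v).2) (Y : E × E) :
    contractOmega L v X Y - dEnergy L v Y =
      -eulerLagrangeForm (inChart L v₀) (fun _ => chartDeriv v₀ v X)
        (extChartAt 𝓘(ℝ, E).tangent v₀ v) (chartDeriv v₀ v Y).1 := by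
  -- For a second order `X` the two terms `D²ℓ(Y)(0, u)`, one from the form and one from the energy,
  -- cancel. A constant field may stand in for the dynamics because the Euler–Lagrange form uses
  -- only its value at the point.
  rw [contractOmega_apply hL hv, dEnergy_apply hL hv,
    (fderiv_chartEnergy (contDiffAt_inChart hL hv)).2, hX]
  simp [eulerLagrangeForm]

end ChartForms

/-! ### Constraint functions of a distribution in natural charts -/

section Distribution

variable {E : Type*} [NormedAddCommGroup E] [NormedSpace ℝ E]
  {Q : Type*} [TopologicalSpace Q] [ChartedSpace E Q] [IsManifold 𝓘(ℝ, E) ∞ Q]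

/-- The one-forms `μ` are smooth and pointwise independent on the open set `W`, where their common
kernel is `D`. -/
structure IsLocalCoframe (D : (q : Q) → Submodule ℝ (TangentSpace 𝓘(ℝ, E) q)) (W : Set Q) {k : ℕ}
    (μ : Fin k → (q : Q) → TangentSpace 𝓘(ℝ, E) q →ₗ[ℝ] ℝ) : Prop where
  isOpen : IsOpen W
  smooth : ∀ a, ContMDiffOn 𝓘(ℝ, E).tangent 𝓘(ℝ, ℝ) ∞
    (fun v : TangentBundle 𝓘(ℝ, E) Q => μ a v.proj v.2) (proj ⁻¹' W)
  linearIndependent : ∀ q ∈ W, LinearIndependent ℝ (fun a => μ a q)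
  mem_iff : ∀ q ∈ W, ∀ w : TangentSpace 𝓘(ℝ, E) q, w ∈ D q ↔ ∀ a, μ a q w = 0

/-- The constraint function of a one-form on `Q`. -/
def constraintFun (μ : (q : Q) → TangentSpace 𝓘(ℝ, E) q →ₗ[ℝ] ℝ)
    (v : TangentBundle 𝓘(ℝ, E) Q) : ℝ :=
  μ v.proj v.2

variable {D : (q : Q) → Submodule ℝ (TangentSpace 𝓘(ℝ, E) q)} {W : Set Q} {k : ℕ}
    {μ : Fin k → (q : Q) → TangentSpace 𝓘(ℝ, E) q →ₗ[ℝ] ℝ}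

theorem continuous_tangentBundle_proj : Continuous (proj : TangentBundle 𝓘(ℝ, E) Q → Q) :=
  FiberBundle.continuous_proj E (TangentSpace 𝓘(ℝ, E))

theorem mfderiv_apply_inChart {g : TangentBundle 𝓘(ℝ, E) Q → ℝ} {v₀ v : TangentBundle 𝓘(ℝ, E) Q}
    (hv : v ∈ (extChartAt 𝓘(ℝ, E).tangent v₀).source)
    (hg : DifferentiableAt ℝ (inChart g v₀) (extChartAt 𝓘(ℝ, E).tangent v₀ v)) (Y : E × E) :
    mfderiv 𝓘(ℝ, E).tangent 𝓘(ℝ, ℝ) g v Y =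
      fderiv ℝ (inChart g v₀) (extChartAt 𝓘(ℝ, E).tangent v₀ v) (chartDeriv v₀ v Y) := by
  have h1 : g =ᶠ[𝓝 v] inChart g v₀ ∘ extChartAt 𝓘(ℝ, E).tangent v₀ := by
    filter_upwards [(isOpen_extChartAt_source v₀).mem_nhds hv] with w hw
    exact (inChart_apply_chart hw).symm
  have h2 := HasMFDerivAt.comp v hg.hasFDerivAt.hasMFDerivAt (hasMFDerivAt_chart hv)
  exact congrArg (fun A : E × E →L[ℝ] ℝ => A Y) (h2.congr_of_eventuallyEq h1).mfderiv

theorem chartDeriv_self (v : TangentBundle 𝓘(ℝ, E) Q) (Y : E × E) : chartDeriv v v Y = Y := by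
  have h := hasFDerivAt_chartTransition (mem_extChartAt_source (I := 𝓘(ℝ, E).tangent) v)
  have h2 : chartTransition v v =ᶠ[𝓝 (extChartAt 𝓘(ℝ, E).tangent v v)] id := by
    filter_upwards [extChartAt_target_mem_nhds (I := 𝓘(ℝ, E).tangent) v] with z hz
    exact (extChartAt 𝓘(ℝ, E).tangent v).right_inv hz
  have h3 := (h.congr_of_eventuallyEq h2.symm).unique (hasFDerivAt_id _)
  rw [h3]; rfl

/-- The domain, in the chart at `v₀`, of the constraint functions. -/
def coframeDomain (W : Set Q) (v₀ : TangentBundle 𝓘(ℝ, E) Q) : Set (E × E) :=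
  (extChartAt 𝓘(ℝ, E).tangent v₀).target ∩
    (extChartAt 𝓘(ℝ, E).tangent v₀).symm ⁻¹' (proj ⁻¹' W)

theorem IsLocalCoframe.isOpen_coframeDomain (hμ : IsLocalCoframe D W μ)
    (v₀ : TangentBundle 𝓘(ℝ, E) Q) : IsOpen (coframeDomain W v₀) :=
  (continuousOn_extChartAt_symm v₀).isOpen_inter_preimage (isOpen_extChartAt_target v₀)
    (hμ.isOpen.preimage continuous_tangentBundle_proj)

theorem mem_coframeDomain {v₀ v : TangentBundle 𝓘(ℝ, E) Q}
    (hv : v ∈ (extChartAt 𝓘(ℝ, E).tangent v₀).source) (hW : v.proj ∈ W) :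
    extChartAt 𝓘(ℝ, E).tangent v₀ v ∈ coframeDomain W v₀ := by
  refine ⟨(extChartAt 𝓘(ℝ, E).tangent v₀).map_source hv, ?_⟩
  rw [mem_preimage, (extChartAt 𝓘(ℝ, E).tangent v₀).left_inv hv]
  exact hW

/-- The domain is a condition on the base point alone, so curves in it may be corrected freely along
the fibres. -/
theorem mem_coframeDomain_of_fst_eq {v₀ : TangentBundle 𝓘(ℝ, E) Q} {z z' : E × E}
    (hz : z ∈ coframeDomain W v₀) (h : z'.1 = z.1) : z' ∈ coframeDomain W v₀ := by
  refine ⟨mem_extChartAt_tangent_target.2 (h ▸ mem_extChartAt_tangent_target.1 hz.1), ?_⟩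
  have h2 := hz.2
  simp only [mem_preimage, proj, extChartAt_tangent_symm_apply] at h2 ⊢
  rwa [h]

theorem IsLocalCoframe.contDiffOn (hμ : IsLocalCoframe D W μ) (v₀ : TangentBundle 𝓘(ℝ, E) Q)
    (a : Fin k) : ContDiffOn ℝ ∞ (inChart (constraintFun (μ a)) v₀) (coframeDomain W v₀) :=
  contDiffOn_inChart (hμ.smooth a) v₀

theorem IsLocalCoframe.differentiableAt (hμ : IsLocalCoframe D W μ) {v₀ : TangentBundle 𝓘(ℝ, E) Q}
    {z : E × E} (hz : z ∈ coframeDomain W v₀) (a : Fin k) :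
    DifferentiableAt ℝ (inChart (constraintFun (μ a)) v₀) z :=
  ((hμ.contDiffOn v₀ a).contDiffAt
    ((hμ.isOpen_coframeDomain v₀).mem_nhds hz)).differentiableAt (by simp)

/-- The constraint functions are linear in the fibres. -/
theorem IsLocalCoframe.inChart_eq_fiberDeriv (hμ : IsLocalCoframe D W μ)
    {v₀ : TangentBundle 𝓘(ℝ, E) Q} {z : E × E} (hz : z ∈ coframeDomain W v₀) (a : Fin k) (w : E) :
    inChart (constraintFun (μ a)) v₀ (z.1, w) =
      fiberDeriv (inChart (constraintFun (μ a)) v₀) z w := by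
  have h1 := hasFDerivAt_fiberDeriv (hμ.differentiableAt hz a)
  let x := (extChartAt 𝓘(ℝ, E) v₀.proj).symm z.1
  let B : E →L[ℝ] E := tangentCoordChange 𝓘(ℝ, E) v₀.proj x x
  have h2 : ∀ u : E, inChart (constraintFun (μ a)) v₀ (z.1, u) = μ a x (B u) := fun u => rfl
  have h3 : IsLinearMap ℝ (fun u : E => inChart (constraintFun (μ a)) v₀ (z.1, u)) := by
    refine ⟨fun u u' => ?_, fun c u => ?_⟩
    · rw [h2, h2, h2, map_add]; exact map_add (μ a x) (B u) (B u')
    · rw [h2, h2, map_smul]; exact map_smul (μ a x) c (B u)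
  have h4 : HasDerivAt (fun t : ℝ => inChart (constraintFun (μ a)) v₀ (z.1, z.2 + t • w))
      (fiberDeriv (inChart (constraintFun (μ a)) v₀) z w) 0 := by
    have h5 : HasDerivAt (fun t : ℝ => z.2 + t • w) w 0 := by
      simpa using ((hasDerivAt_id (0 : ℝ)).smul_const w).const_add z.2
    have h6 : HasFDerivAt (fun u => inChart (constraintFun (μ a)) v₀ (z.1, u))
      (fiberDeriv (inChart (constraintFun (μ a)) v₀) z) (z.2 + (0 : ℝ) • w) := by simpa using h1
    exact h6.comp_hasDerivAt 0 h5
  have h5 : HasDerivAt (fun t : ℝ => inChart (constraintFun (μ a)) v₀ (z.1, z.2 + t • w))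
      (inChart (constraintFun (μ a)) v₀ (z.1, w)) 0 := by
    have : (fun t : ℝ => inChart (constraintFun (μ a)) v₀ (z.1, z.2 + t • w)) = fun t : ℝ =>
        inChart (constraintFun (μ a)) v₀ (z.1, z.2) +
          t * inChart (constraintFun (μ a)) v₀ (z.1, w) := by
      funext t
      rw [h3.map_add z.2, h3.map_smul t w]; rfl
    rw [this]
    simpa using ((hasDerivAt_id (0 : ℝ)).mul_const
      (inChart (constraintFun (μ a)) v₀ (z.1, w))).const_add
        (inChart (constraintFun (μ a)) v₀ (z.1, z.2))
  exact h5.unique h4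

/-- The one-forms in the chart at `v₀`. -/
theorem IsLocalCoframe.fiberDeriv_apply (hμ : IsLocalCoframe D W μ)
    {v₀ v : TangentBundle 𝓘(ℝ, E) Q} (hv : v ∈ (extChartAt 𝓘(ℝ, E).tangent v₀).source)
    (hW : v.proj ∈ W) (a : Fin k) (w : E) :
    fiberDeriv (inChart (constraintFun (μ a)) v₀) (extChartAt 𝓘(ℝ, E).tangent v₀ v)
      (tangentCoordChange 𝓘(ℝ, E) v.proj v₀.proj v.proj w) = μ a v.proj w := by
  rw [← hμ.inChart_eq_fiberDeriv (mem_coframeDomain hv hW)]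
  have hu : (⟨v.proj, w⟩ : TangentBundle 𝓘(ℝ, E) Q) ∈ (extChartAt 𝓘(ℝ, E).tangent v₀).source :=
      mem_extChartAt_tangent_source.2 (mem_extChartAt_tangent_source.1 hv)
  exact inChart_apply_chart (L := constraintFun (μ a)) hu

theorem IsLocalCoframe.mem_constraintSet_iff (hμ : IsLocalCoframe D W μ)
    {v : TangentBundle 𝓘(ℝ, E) Q} (hW : v.proj ∈ W) :
    v ∈ constraintSet D ↔ ∀ a, constraintFun (μ a) v = 0 :=
  hμ.mem_iff v.proj hW v.2

end Distribution

/-! ### Tangent spaces of the constraint set and reaction forms -/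

section TangentSpaces

/-- A nonzero functional vanishing on a proper range would be a nontrivial linear relation among the
`L a`. -/
theorem surjective_pi_of_linearIndependent {V : Type*} [AddCommGroup V] [Module ℝ V] {k : ℕ}
    {L : Fin k → V →ₗ[ℝ] ℝ} (hL : LinearIndependent ℝ L) :
    Function.Surjective (LinearMap.pi L) := by
  rw [← LinearMap.range_eq_top]
  by_contra h
  obtain ⟨φ, hφ, hle⟩ := Submodule.exists_le_ker_of_lt_top _ (lt_top_iff_ne_top.2 h)
  apply hφ
  have h1 : ∑ a, φ (Pi.single a 1) • L a = 0 := by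
    ext w
    have h2 : φ (LinearMap.pi L w) = 0 := hle ⟨w, rfl⟩
    rw [LinearMap.pi_apply_eq_sum_univ φ (LinearMap.pi L w)] at h2
    have h5 : ∀ i : Fin k, (fun j => if i = j then (1 : ℝ) else 0) = Pi.single i 1 := fun i => by
      ext j; simp [Pi.single_apply, eq_comm]
    simp only [h5] at h2
    simpa [mul_comm] using h2
  have h3 := Fintype.linearIndependent_iff.1 hL _ h1
  ext a
  simpa using h3 a

variable {E : Type*} [NormedAddCommGroup E] [NormedSpace ℝ E]

/-- A vector annihilated by the differential of a submersion that is linear in the second argument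
is the velocity of a smooth curve in its zero set. -/
theorem exists_curve_of_fderiv_eq_zero {k : ℕ} {N : Set (E × E)} {Ψ : E × E → Fin k → ℝ}
    (hN : IsOpen N) (hΨ : ContDiffOn ℝ ∞ Ψ N)
    (hlin : ∀ z ∈ N, ∀ w, Ψ (z.1, w) = (fderiv ℝ Ψ z).comp (ContinuousLinearMap.inr ℝ E E) w)
    (hfst : ∀ z ∈ N, ∀ w, (z.1, w) ∈ N) {z X : E × E} (hz : z ∈ N) (hΨz : Ψ z = 0)
    (hsurj : Function.Surjective ((fderiv ℝ Ψ z).comp (ContinuousLinearMap.inr ℝ E E)))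
    (hX : fderiv ℝ Ψ z X = 0) :
    ∃ (ε : ℝ) (c : ℝ → E × E), 0 < ε ∧ ContDiffOn ℝ ∞ c (Ioo (-ε) ε) ∧
      (∀ s ∈ Ioo (-ε) ε, c s ∈ N ∧ Ψ (c s) = 0) ∧ c 0 = z ∧ HasDerivAt c X 0 := by
  let m : E × E → E →L[ℝ] (Fin k → ℝ) := fun z =>
    (fderiv ℝ Ψ z).comp (ContinuousLinearMap.inr ℝ E E)
  obtain ⟨σ', hσ'⟩ := LinearMap.exists_rightInverse_of_surjective (m z).toLinearMap
    (LinearMap.range_eq_top.2 hsurj)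
  let σ : (Fin k → ℝ) →L[ℝ] E := LinearMap.toContinuousLinearMap σ'
  have hσ : (m z).comp σ = 1 := by
    ext1 y; exact congrArg (fun A : (Fin k → ℝ) →ₗ[ℝ] (Fin k → ℝ) => A y) hσ'
  let ζ : ℝ → E × E := fun t => z + t • X
  have hζ : ContDiff ℝ ∞ ζ := by fun_prop
  have hζ0 : ζ 0 = z := by simp [ζ]
  have hm : ContDiffOn ℝ ∞ m N := (hΨ.fderiv_of_isOpen hN (by simp)).clm_comp contDiffOn_const
  let A : ℝ → (Fin k → ℝ) →L[ℝ] (Fin k → ℝ) := fun t => (m (ζ t)).comp σ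
  have hA0 : A 0 = 1 := by simp only [A, hζ0, hσ]
  have hA : ∀ t, ζ t ∈ N → ContDiffAt ℝ ∞ A t := fun t ht =>
    have h : ContDiffAt ℝ ∞ (fun t => m (ζ t)) t :=
      ContDiffAt.comp (E := ℝ) (F := E × E) (G := E →L[ℝ] (Fin k → ℝ)) t
        (hm.contDiffAt (hN.mem_nhds ht)) hζ.contDiffAt
    h.clm_comp contDiffAt_const
  have hΨζ : ∀ t, ζ t ∈ N → ContDiffAt ℝ ∞ (fun t => Ψ (ζ t)) t := fun t ht => by
    exact ContDiffAt.comp (E := ℝ) (F := E × E) (G := Fin k → ℝ) t (hΨ.contDiffAt (hN.mem_nhds ht))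
      hζ.contDiffAt
  -- The line `ζ` is corrected along the fibre by `σ (R t)`. As `Ψ` is linear there, staying in the
  -- zero set means `A t (R t) = Ψ (ζ t)`, a linear equation solvable near `0` because `A 0 = 1`.
  -- The correction does not change the velocity, since `Ψ ∘ ζ` vanishes to first order at `0`.
  let R : ℝ → Fin k → ℝ := fun t => Ring.inverse (A t) (Ψ (ζ t))
  have hinv : ∀ t, ζ t ∈ N → IsUnit (A t) → ContDiffAt ℝ ∞ (fun t => Ring.inverse (A t)) t := by
    rintro t ht ⟨u, hu⟩
    have hi : ContDiffAt ℝ ∞ (Ring.inverse : ((Fin k → ℝ) →L[ℝ] (Fin k → ℝ)) → _) (A t) := by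
      rw [← hu]
      exact contDiffAt_ringInverse ℝ u
    exact ContDiffAt.comp (E := ℝ) (F := (Fin k → ℝ) →L[ℝ] (Fin k → ℝ))
      (G := (Fin k → ℝ) →L[ℝ] (Fin k → ℝ)) t hi (hA t ht)
  have hR : ∀ t, ζ t ∈ N → IsUnit (A t) → ContDiffAt ℝ ∞ R t := fun t ht hu =>
    (hinv t ht hu).clm_apply (hΨζ t ht)
  have hev : ∀ᶠ t in 𝓝 (0 : ℝ), ζ t ∈ N ∧ IsUnit (A t) := by
    have hz0 : ζ 0 ∈ N := by rwa [hζ0]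
    refine (hζ.continuous.continuousAt.eventually (hN.mem_nhds hz0)).and ?_
    refine (hA 0 hz0).continuousAt.eventually (Units.isOpen.mem_nhds ?_)
    rw [hA0]; exact isUnit_one
  obtain ⟨ε, hε, H⟩ := Metric.eventually_nhds_iff_ball.1 hev
  rw [Real.ball_eq_Ioo, zero_sub, zero_add] at H
  have h0 : (0 : ℝ) ∈ Ioo (-ε) ε := ⟨by linarith, hε⟩
  refine ⟨ε, fun t => ((ζ t).1, (ζ t).2 - σ (R t)), hε, fun t ht => ?_,
    fun t ht => ⟨?_, ?_⟩, ?_, ?_⟩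
  · have h1 : ContDiffAt ℝ ∞ (fun t => σ (R t)) t :=
      ContDiffAt.comp (E := ℝ) (F := Fin k → ℝ) (G := E) t σ.contDiff.contDiffAt
        (hR t (H t ht).1 (H t ht).2)
    exact (hζ.fst.contDiffAt.prodMk (hζ.snd.contDiffAt.sub h1)).contDiffWithinAt
  · exact hfst _ (H t ht).1 _
  · have h1 : m (ζ t) (σ (R t)) = Ψ (ζ t) := by
      change (A t) (R t) = _
      have h2 := Ring.mul_inverse_cancel _ (H t ht).2
      exact congrArg (fun B : (Fin k → ℝ) →L[ℝ] (Fin k → ℝ) => B (Ψ (ζ t))) h2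
    have h2 := hlin _ (H t ht).1 (ζ t).2
    rw [hlin _ (H t ht).1, map_sub, ← h2]
    exact sub_eq_zero.2 h1.symm
  · simp [R, hζ0, hΨz]
  · have h1 : HasDerivAt ζ X 0 := by
      exact (((hasDerivAt_id (0 : ℝ)).smul_const X).const_add z).congr_deriv (one_smul ℝ X)
    have h2 : HasDerivAt (fun t => Ψ (ζ t)) 0 0 := by
      have h3 : HasFDerivAt Ψ (fderiv ℝ Ψ z) (ζ 0) := by
        rw [hζ0]; exact ((hΨ.contDiffAt (hN.mem_nhds hz)).differentiableAt (by simp)).hasFDerivAt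
      exact (h3.comp_hasDerivAt 0 h1).congr_deriv hX
    have h3 : HasDerivAt R 0 0 := by
      have h4 := ((hinv 0 (H 0 h0).1 (H 0 h0).2).differentiableAt (by simp)).hasDerivAt.clm_apply h2
      simpa [hζ0, hΨz] using h4
    have h4 : HasDerivAt (fun t => σ (R t)) 0 0 := by
      exact (σ.hasFDerivAt.comp_hasDerivAt 0 h3).congr_deriv (map_zero σ)
    have h5 : HasDerivAt (fun t => (ζ t).2 - σ (R t)) (X.2 - 0) 0 :=
      ((ContinuousLinearMap.snd ℝ E E).hasFDerivAt.comp_hasDerivAt 0 h1 :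
        HasDerivAt (fun t => (ζ t).2) X.2 0).sub h4
    have h6 : HasDerivAt (fun t => (ζ t).1) X.1 0 :=
      (ContinuousLinearMap.fst ℝ E E).hasFDerivAt.comp_hasDerivAt 0 h1
    exact (h6.prodMk h5).congr_deriv (by simp)

variable {Q : Type*} [TopologicalSpace Q] [ChartedSpace E Q] [IsManifold 𝓘(ℝ, E) ∞ Q]
  {D : (q : Q) → Submodule ℝ (TangentSpace 𝓘(ℝ, E) q)} {W : Set Q} {k : ℕ}
  {μ : Fin k → (q : Q) → TangentSpace 𝓘(ℝ, E) q →ₗ[ℝ] ℝ}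

/-- The differential of a constraint function. -/
def constraintDeriv (μ : (q : Q) → TangentSpace 𝓘(ℝ, E) q →ₗ[ℝ] ℝ)
    (v : TangentBundle 𝓘(ℝ, E) Q) : E × E →L[ℝ] ℝ :=
  mfderiv 𝓘(ℝ, E).tangent 𝓘(ℝ, ℝ) (constraintFun μ) v

theorem IsLocalCoframe.mdifferentiableAt (hμ : IsLocalCoframe D W μ)
    {v : TangentBundle 𝓘(ℝ, E) Q} (hW : v.proj ∈ W) (a : Fin k) :
    MDifferentiableAt 𝓘(ℝ, E).tangent 𝓘(ℝ, ℝ) (constraintFun (μ a)) v :=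
  ((hμ.smooth a).contMDiffAt ((hμ.isOpen.preimage continuous_tangentBundle_proj).mem_nhds
    hW)).mdifferentiableAt (by simp)

theorem IsLocalCoframe.constraintDeriv_apply (hμ : IsLocalCoframe D W μ)
    {v₀ v : TangentBundle 𝓘(ℝ, E) Q} (hv : v ∈ (extChartAt 𝓘(ℝ, E).tangent v₀).source)
    (hW : v.proj ∈ W) (a : Fin k) (Y : E × E) :
    constraintDeriv (μ a) v Y = fderiv ℝ (inChart (constraintFun (μ a)) v₀)
      (extChartAt 𝓘(ℝ, E).tangent v₀ v) (chartDeriv v₀ v Y) :=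
  mfderiv_apply_inChart hv (hμ.differentiableAt (mem_coframeDomain hv hW) a) Y

/-- The tangent space of the constraint set is the common kernel of the differentials of the
constraint functions. -/
theorem IsLocalCoframe.mem_tangentD_iff (hμ : IsLocalCoframe D W μ)
    {v : TangentBundle 𝓘(ℝ, E) Q} (hW : v.proj ∈ W) (hv : v ∈ constraintSet D) (X : E × E) :
    X ∈ tangentD D v ↔ ∀ a, constraintDeriv (μ a) v X = 0 := by
  constructor
  · intro hX a
    let K : Submodule ℝ (E × E) := LinearMap.ker (constraintDeriv (μ a) v).toLinearMap
    -- The tangent space is a span, so it suffices to treat velocities of curves, along which the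
    -- constraint functions vanish.
    have hle : tangentD D v ≤ K := by
      refine Submodule.span_le.2 ?_
      rintro Y ⟨ε, c, hε, -, hc, rfl, hcY⟩
      have h1 := HasMFDerivAt.comp (0 : ℝ) (hμ.mdifferentiableAt hW a).hasMFDerivAt hcY
      have h2 : constraintFun (μ a) ∘ c =ᶠ[𝓝 0] fun _ => (0 : ℝ) := by
        have hW' : ∀ᶠ s in 𝓝 (0 : ℝ), (c s).proj ∈ W :=
          (continuous_tangentBundle_proj.continuousAt.comp hcY.continuousAt).eventually
            (hμ.isOpen.mem_nhds hW)
        filter_upwards [hW', Ioo_mem_nhds (neg_lt_zero.2 hε) hε] with s hs hsε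
        exact (hμ.mem_constraintSet_iff hs).1 (hc s hsε) a
      have h3 : HasMFDerivAt 𝓘(ℝ, ℝ) 𝓘(ℝ, ℝ) (constraintFun (μ a) ∘ c) 0 (0 : ℝ →L[ℝ] ℝ) :=
        ((hasFDerivAt_const (0 : ℝ) (0 : ℝ)).hasMFDerivAt).congr_of_eventuallyEq h2
      have h4 := congrArg (fun A : ℝ →L[ℝ] ℝ => A 1) (hasMFDerivAt_unique h1 h3)
      change constraintDeriv (μ a) (c 0) Y = 0
      have h5 : ((1 : ℝ →L[ℝ] ℝ).smulRight (Y : E × E)) 1 = Y := by simp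
      have h6 : constraintDeriv (μ a) (c 0) (((1 : ℝ →L[ℝ] ℝ).smulRight (Y : E × E)) 1) = 0 := h4
      rwa [h5] at h6
    exact hle hX
  · intro hX
    let e := extChartAt 𝓘(ℝ, E).tangent v
    let Ψ : E × E → Fin k → ℝ := fun z a => inChart (constraintFun (μ a)) v z
    have hself : v ∈ e.source := mem_extChartAt_source v
    have hz : e v ∈ coframeDomain W v := mem_coframeDomain hself hW
    have hΨ' : ∀ z ∈ coframeDomain W v, ∀ Y a, fderiv ℝ Ψ z Y a =
        fderiv ℝ (inChart (constraintFun (μ a)) v) z Y := fun z hz Y a => by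
      rw [(hasFDerivAt_pi.2 fun a => (hμ.differentiableAt hz a).hasFDerivAt).fderiv]
      rfl
    obtain ⟨ε, c, hε, hcs, hc, hc0, hcX⟩ := exists_curve_of_fderiv_eq_zero (X := X)
      (hμ.isOpen_coframeDomain v) (Ψ := Ψ) (contDiffOn_pi.2 fun a => hμ.contDiffOn v a)
      (fun z hz w => by
        ext a
        change inChart (constraintFun (μ a)) v (z.1, w) = _
        rw [hμ.inChart_eq_fiberDeriv hz a w]
        exact (hΨ' z hz _ a).symm)
      (fun z hz w => mem_coframeDomain_of_fst_eq hz rfl) hz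
      (by
        ext a
        change inChart (constraintFun (μ a)) v (e v) = 0
        rw [inChart_apply_chart hself]
        exact (hμ.mem_constraintSet_iff hW).1 hv a)
      (by
        intro y
        obtain ⟨w, hw⟩ := surjective_pi_of_linearIndependent (hμ.linearIndependent _ hW) y
        refine ⟨tangentCoordChange 𝓘(ℝ, E) v.proj v.proj v.proj w, ?_⟩
        ext a
        refine (hΨ' _ hz _ a).trans ?_
        refine (hμ.fiberDeriv_apply hself hW a w).trans ?_
        exact congrFun hw a)
      (by
        ext a
        rw [hΨ' _ hz]
        have h := hX a
        rwa [hμ.constraintDeriv_apply hself hW a X, chartDeriv_self] at h)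
    -- Every vector of the common kernel is the velocity of one curve, so no linear combinations are
    -- needed.
    refine Submodule.subset_span ⟨ε, e.symm ∘ c, hε, ?_, ?_, ?_, ?_⟩
    · exact (contMDiffOn_extChartAt_symm (I := 𝓘(ℝ, E).tangent) v).comp hcs.contMDiffOn
        fun s hs => (hc s hs).1.1
    · intro s hs
      refine (hμ.mem_constraintSet_iff (hc s hs).1.2).2 fun a => ?_
      exact congrFun (hc s hs).2 a
    · change e.symm (c 0) = v
      rw [hc0, e.left_inv hself]
    · have h0 : e.symm (c 0) = v := by rw [hc0, e.left_inv hself]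
      have hcont : ContinuousAt (e.symm ∘ c) 0 := by
        refine ContinuousAt.comp ?_ hcX.continuousAt
        rw [hc0]; exact continuousAt_extChartAt_symm v
      refine ⟨hcont, ?_⟩
      have h1 : (extChartAt 𝓘(ℝ, E).tangent v ∘ (e.symm ∘ c)) =ᶠ[𝓝 0] c := by
        filter_upwards [Ioo_mem_nhds (neg_lt_zero.2 hε) hε] with s hs
        exact e.right_inv (hc s hs).1.1
      have h2 : HasFDerivAt (extChartAt 𝓘(ℝ, E).tangent v ∘ (e.symm ∘ c))
          ((1 : ℝ →L[ℝ] ℝ).smulRight X) 0 :=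
        (hasDerivAt_iff_hasFDerivAt.1 hcX).congr_of_eventuallyEq h1
      have h3 : HasFDerivAt (extChartAt 𝓘(ℝ, E).tangent ((e.symm ∘ c) 0) ∘ (e.symm ∘ c))
          ((1 : ℝ →L[ℝ] ℝ).smulRight X) 0 := by
        rw [show (e.symm ∘ c) 0 = v from h0]; exact h2
      exact h3.hasFDerivWithinAt

theorem mdifferentiableAt_fiberInclusion (v : TangentBundle 𝓘(ℝ, E) Q) :
    MDifferentiableAt 𝓘(ℝ, E) 𝓘(ℝ, E).tangent
      (fun u : E => (⟨v.proj, u⟩ : TangentBundle 𝓘(ℝ, E) Q)) v.2 := by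
  refine (mdifferentiableAt_totalSpace (M := E) (E := TangentSpace 𝓘(ℝ, E)) 𝓘(ℝ, E)
    (fun u : E => (⟨v.proj, u⟩ : TangentBundle 𝓘(ℝ, E) Q)) (x₀ := (v.2 : E))).2
    ⟨mdifferentiableAt_const, ?_⟩
  exact (tangentCoordChange 𝓘(ℝ, E) v.proj v.proj v.proj).differentiableAt.mdifferentiableAt

/-- A constraint function is linear on fibres, so its fibre derivative is the one-form itself.
Consequently the adjoint of the vertical endomorphism sends the differential of a constraint
function to the pullback of its one-form from `Q`. -/
theorem IsLocalCoframe.constraintDeriv_verticalLift (hμ : IsLocalCoframe D W μ)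
    {v : TangentBundle 𝓘(ℝ, E) Q} (hW : v.proj ∈ W) (a : Fin k) (w : E) :
    constraintDeriv (μ a) v (verticalLift v w) = μ a v.proj w := by
  let ι : E → TangentBundle 𝓘(ℝ, E) Q := fun u => ⟨v.proj, u⟩
  let x : E := v.2
  have h1 : HasMFDerivAt 𝓘(ℝ, E) 𝓘(ℝ, ℝ) (constraintFun (μ a) ∘ ι) x
      ((constraintDeriv (μ a) v).comp (verticalLift v : E →L[ℝ] E × E)) :=
    HasMFDerivAt.comp (I' := 𝓘(ℝ, E).tangent) x (hμ.mdifferentiableAt hW a).hasMFDerivAt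
      (mdifferentiableAt_fiberInclusion v).hasMFDerivAt
  let A : E →L[ℝ] ℝ := (fiberDeriv (inChart (constraintFun (μ a)) v)
      (extChartAt 𝓘(ℝ, E).tangent v v)).comp
        (tangentCoordChange 𝓘(ℝ, E) v.proj v.proj v.proj : E →L[ℝ] E)
  have hA : ∀ u : E, A u = μ a v.proj u := fun u =>
    hμ.fiberDeriv_apply (mem_extChartAt_source v) hW a u
  have h2 : HasMFDerivAt 𝓘(ℝ, E) 𝓘(ℝ, ℝ) (constraintFun (μ a) ∘ ι) x A := by
    have h3 : constraintFun (μ a) ∘ ι = A := funext fun u => (hA u).symm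
    rw [h3]
    exact A.hasMFDerivAt
  rw [← hA]
  exact congrArg (fun B : E →L[ℝ] ℝ => B w) (hasMFDerivAt_unique h1 h2)

/-- The reaction forms are the pullbacks of the one-forms that define the distribution. -/
theorem IsLocalCoframe.mem_reactionForms_iff (hμ : IsLocalCoframe D W μ)
    {v : TangentBundle 𝓘(ℝ, E) Q} (hW : v.proj ∈ W) (hv : v ∈ constraintSet D)
    (φ : Module.Dual ℝ (TangentSpace 𝓘(ℝ, E).tangent v)) :
    φ ∈ reactionForms D v ↔ ∃ c : Fin k → ℝ, ∀ Y : E × E,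
      φ Y = ∑ a, c a * μ a v.proj (tangentProj v Y) := by
  have hS : ∀ a (Y : E × E), constraintDeriv (μ a) v (verticalEndo v Y) =
      μ a v.proj (tangentProj v Y) := fun a Y =>
    hμ.constraintDeriv_verticalLift hW a (tangentProj v Y)
  constructor
  · rintro ⟨ψ, hψ, rfl⟩
    have hker : ∀ X, X ∈ tangentD D v → ψ X = 0 := (Submodule.mem_dualAnnihilator _).1 hψ
    let ψ' : E × E →ₗ[ℝ] ℝ := ψ
    -- A functional vanishing on the common kernel of finitely many functionals is a linear
    -- combination of them.
    have hψ' : ψ' ∈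
        Submodule.span ℝ (range fun a => (constraintDeriv (μ a) v).toLinearMap) := by
      refine mem_span_of_iInf_ker_le_ker fun X hX => ?_
      rw [Submodule.mem_iInf] at hX
      exact hker X ((hμ.mem_tangentD_iff hW hv X).2 hX)
    obtain ⟨c, hc⟩ := (Submodule.mem_span_range_iff_exists_fun ℝ).1 hψ'
    refine ⟨c, fun Y => ?_⟩
    change ψ' (verticalEndo v Y) = _
    rw [← hc]
    refine (LinearMap.sum_apply _ _ _).trans ?_
    exact Finset.sum_congr rfl fun a _ => congrArg (c a * ·) (hS a Y)
  · rintro ⟨c, hc⟩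
    let ψ : E × E →ₗ[ℝ] ℝ := ∑ a, c a • (constraintDeriv (μ a) v).toLinearMap
    have hψ : ∀ Y : E × E, ψ Y = ∑ a, c a * constraintDeriv (μ a) v Y := fun Y => by
      simp [ψ, LinearMap.sum_apply]
    have hker : ∀ X, X ∈ tangentD D v → ψ X = 0 := fun X hX => by
      refine (hψ X).trans ?_
      exact Finset.sum_eq_zero fun a _ => by
        rw [(hμ.mem_tangentD_iff hW hv X).1 hX a, mul_zero]
    refine ⟨ψ, (Submodule.mem_dualAnnihilator _).2 hker, ?_⟩
    refine LinearMap.ext fun Y => ?_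
    refine Eq.trans ?_ (hc Y).symm
    refine (hψ (verticalEndo v Y)).trans ?_
    exact Finset.sum_congr rfl fun a _ => congrArg (c a * ·) (hS a Y)

end TangentSpaces

/-! ### Accelerations and Lagrange multipliers -/

section ConstrainedDynamics

variable {E : Type*} [NormedAddCommGroup E] [NormedSpace ℝ E]

/-- The fibre Hessian. -/
def fiberHessian (ℓ : E × E → ℝ) (z : E × E) : E →L[ℝ] E →L[ℝ] ℝ :=
  ((ContinuousLinearMap.compL ℝ E (E × E) ℝ).flip (ContinuousLinearMap.inr ℝ E E)).comp
    ((fderiv ℝ (fderiv ℝ ℓ) z).comp (ContinuousLinearMap.inr ℝ E E))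

variable {G : Type*} [NormedAddCommGroup G] [NormedSpace ℝ G]

/-- The linear system that determines the acceleration and the Lagrange multipliers. -/
def multiplierSystem (A : E →L[ℝ] E →L[ℝ] ℝ) (m : E →L[ℝ] G) :
    E × (G →L[ℝ] ℝ) →L[ℝ] (E →L[ℝ] ℝ) × G :=
  (ContinuousLinearMap.inl ℝ (E →L[ℝ] ℝ) G).comp
      (A.comp (ContinuousLinearMap.fst ℝ E (G →L[ℝ] ℝ)) -
        ((ContinuousLinearMap.compL ℝ E G ℝ).flip m).comp
          (ContinuousLinearMap.snd ℝ E (G →L[ℝ] ℝ))) +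
    (ContinuousLinearMap.inr ℝ (E →L[ℝ] ℝ) G).comp
      (m.comp (ContinuousLinearMap.fst ℝ E (G →L[ℝ] ℝ)))

theorem multiplierSystem_apply (A : E →L[ℝ] E →L[ℝ] ℝ) (m : E →L[ℝ] G) (x : E × (G →L[ℝ] ℝ)) :
    multiplierSystem A m x = (A x.1 - x.2.comp m, m x.1) := by
  ext <;> simp [multiplierSystem]

variable [FiniteDimensional ℝ E] [FiniteDimensional ℝ G]

theorem finrank_continuousDual (V : Type*) [NormedAddCommGroup V] [NormedSpace ℝ V]
    [FiniteDimensional ℝ V] : Module.finrank ℝ (V →L[ℝ] ℝ) = Module.finrank ℝ V := by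
  rw [← (LinearMap.toContinuousLinearMap (𝕜 := ℝ) (E := V) (F' := ℝ)).finrank_eq]
  exact Subspace.dual_finrank_eq

/-- Both sides have dimension `dim E + dim G`, so injectivity is enough. -/
theorem exists_equiv_multiplierSystem {A : E →L[ℝ] E →L[ℝ] ℝ} {m : E →L[ℝ] G}
    (hinj : ∀ c (ν : G →L[ℝ] ℝ), A c = ν.comp m → m c = 0 → c = 0 ∧ ν = 0) :
    ∃ e : (E × (G →L[ℝ] ℝ)) ≃L[ℝ] (E →L[ℝ] ℝ) × G,
      (e : E × (G →L[ℝ] ℝ) →L[ℝ] (E →L[ℝ] ℝ) × G) = multiplierSystem A m := by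
  have h1 : Function.Injective (multiplierSystem A m).toLinearMap := by
    rw [← LinearMap.ker_eq_bot, LinearMap.ker_eq_bot']
    intro x hx
    change multiplierSystem A m x = 0 at hx
    rw [multiplierSystem_apply, Prod.mk_eq_zero, sub_eq_zero] at hx
    obtain ⟨h2, h3⟩ := hinj x.1 x.2 hx.1 hx.2
    exact Prod.ext h2 h3
  have h2 : Module.finrank ℝ (E × (G →L[ℝ] ℝ)) = Module.finrank ℝ ((E →L[ℝ] ℝ) × G) := by
    rw [Module.finrank_prod, Module.finrank_prod, finrank_continuousDual, finrank_continuousDual]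
  refine ⟨(LinearEquiv.ofInjectiveOfFinrankEq _ h1 h2).toContinuousLinearEquiv, ?_⟩
  exact ContinuousLinearMap.ext fun x => rfl

/-- The constrained Euler–Lagrange equations with multipliers have a smooth local solution for the
acceleration. -/
theorem exists_constrained_dynamics {ℓ : E × E → ℝ} {Ψ : E × E → G} {N : Set (E × E)}
    (hN : IsOpen N) (hℓ : ContDiffOn ℝ ∞ ℓ N) (hΨ : ContDiffOn ℝ ∞ Ψ N) {z₀ : E × E}
    (hz₀ : z₀ ∈ N)
    (hinj : ∀ c (ν : G →L[ℝ] ℝ), fiberHessian ℓ z₀ c =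
        ν.comp ((fderiv ℝ Ψ z₀).comp (ContinuousLinearMap.inr ℝ E E)) →
      fderiv ℝ Ψ z₀ (0, c) = 0 → c = 0 ∧ ν = 0) :
    ∃ (Ω : Set (E × E)) (f : E × E → E × E), IsOpen Ω ∧ z₀ ∈ Ω ∧ Ω ⊆ N ∧ ContDiffOn ℝ ∞ f Ω ∧
      ∀ z ∈ Ω, (f z).1 = z.2 ∧ fderiv ℝ Ψ z (f z) = 0 ∧
        ∃ ν : G →L[ℝ] ℝ, ∀ w, eulerLagrangeForm ℓ f z w = ν (fderiv ℝ Ψ z (0, w)) := by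
  -- The unknown is a pair of an acceleration and a multiplier. In `T z x = b z` the first component
  -- is the Euler–Lagrange equation with reaction force `ν ∘ m z`; the second says that `Ψ` has zero
  -- derivative along `(z.2, x.1)`.
  let m : E × E → E →L[ℝ] G := fun z => (fderiv ℝ Ψ z).comp (ContinuousLinearMap.inr ℝ E E)
  let T : E × E → E × (G →L[ℝ] ℝ) →L[ℝ] (E →L[ℝ] ℝ) × G := fun z =>
    multiplierSystem (fiberHessian ℓ z) (m z)
  let b : E × E → (E →L[ℝ] ℝ) × G := fun z =>
    ((fderiv ℝ ℓ z).comp (ContinuousLinearMap.inl ℝ E E) -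
      (fderiv ℝ (fderiv ℝ ℓ) z (z.2, 0)).comp (ContinuousLinearMap.inr ℝ E E),
      -fderiv ℝ Ψ z (z.2, 0))
  have hℓ1 : ContDiffOn ℝ ∞ (fderiv ℝ ℓ) N := hℓ.fderiv_of_isOpen hN (by simp)
  have hℓ2 : ContDiffOn ℝ ∞ (fderiv ℝ (fderiv ℝ ℓ)) N := hℓ1.fderiv_of_isOpen hN (by simp)
  have hΨ1 : ContDiffOn ℝ ∞ (fderiv ℝ Ψ) N := hΨ.fderiv_of_isOpen hN (by simp)
  have hm : ContDiffOn ℝ ∞ m N := hΨ1.clm_comp contDiffOn_const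
  have hH : ContDiffOn ℝ ∞ (fiberHessian ℓ) N :=
    contDiffOn_const.clm_comp (hℓ2.clm_comp contDiffOn_const)
  have hT : ContDiffOn ℝ ∞ T N := by
    let K : (E →L[ℝ] G) →L[ℝ] (G →L[ℝ] ℝ) →L[ℝ] E →L[ℝ] ℝ :=
      (ContinuousLinearMap.compL ℝ E G ℝ).flip
    have h1 : ContDiffOn ℝ ∞ (K ∘ m) N :=
      (ContinuousLinearMap.contDiff (𝕜 := ℝ) (E := E →L[ℝ] G)
        (F := (G →L[ℝ] ℝ) →L[ℝ] E →L[ℝ] ℝ) K).comp_contDiffOn hm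
    exact (contDiffOn_const.clm_comp ((hH.clm_comp contDiffOn_const).sub
      (h1.clm_comp contDiffOn_const))).add
      (contDiffOn_const.clm_comp (hm.clm_comp contDiffOn_const))
  have hu : ContDiffOn ℝ ∞ (fun z : E × E => ((z.2, 0) : E × E)) N := by fun_prop
  have hb : ContDiffOn ℝ ∞ b N :=
    ((hℓ1.clm_comp contDiffOn_const).sub ((hℓ2.clm_apply hu).clm_comp contDiffOn_const)).prodMk
      (hΨ1.clm_apply hu).neg
  -- Invertibility is an open condition, so the hypothesis at `z₀` alone gives a neighbourhood. The
  -- zero set of `Ψ` plays no role in it, which is how the dynamics extends off the constraints.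
  let Ω : Set (E × E) := N ∩ T ⁻¹' range
    ((↑) : ((E × (G →L[ℝ] ℝ)) ≃L[ℝ] (E →L[ℝ] ℝ) × G) → E × (G →L[ℝ] ℝ) →L[ℝ] (E →L[ℝ] ℝ) × G)
  let s : E × E → E × (G →L[ℝ] ℝ) := fun z => (T z).inverse (b z)
  have hs : ContDiffOn ℝ ∞ s Ω := fun z hz => by
    obtain ⟨e, he⟩ := hz.2
    have h1 : ContDiffAt ℝ ∞ (ContinuousLinearMap.inverse :
        (E × (G →L[ℝ] ℝ) →L[ℝ] (E →L[ℝ] ℝ) × G) → _) (T z) := by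
      rw [← he]; exact contDiffAt_map_inverse e
    have h2 : ContDiffAt ℝ ∞ (fun z => (T z).inverse) z :=
      ContDiffAt.comp (E := E × E) (F := E × (G →L[ℝ] ℝ) →L[ℝ] (E →L[ℝ] ℝ) × G)
        (G := (E →L[ℝ] ℝ) × G →L[ℝ] E × (G →L[ℝ] ℝ)) z h1 (hT.contDiffAt (hN.mem_nhds hz.1))
    exact (h2.clm_apply (hb.contDiffAt (hN.mem_nhds hz.1))).contDiffWithinAt
  have hTs : ∀ z ∈ Ω, T z (s z) = b z := fun z hz => by
    obtain ⟨e, he⟩ := hz.2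
    simp only [s]
    rw [← he, ContinuousLinearMap.inverse_equiv]
    exact e.apply_symm_apply (b z)
  refine ⟨Ω, fun z => (z.2, (s z).1), hT.continuousOn.isOpen_inter_preimage hN
    (ContinuousLinearEquiv.isOpen), ⟨hz₀, exists_equiv_multiplierSystem hinj⟩, inter_subset_left,
    contDiffOn_snd.prodMk hs.fst, fun z hz => ⟨rfl, ?_, (s z).2, fun w => ?_⟩⟩
  · have h1 := congrArg Prod.snd (hTs z hz)
    simp only [T, multiplierSystem_apply] at h1
    have h2 : ((z.2, (s z).1) : E × E) = (z.2, 0) + (0, (s z).1) := by simp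
    change fderiv ℝ Ψ z (z.2, (s z).1) = 0
    rw [h2, map_add]
    change fderiv ℝ Ψ z (0, (s z).1) = -fderiv ℝ Ψ z (z.2, 0) at h1
    rw [h1, add_neg_cancel]
  · have h1 := congrArg (fun x : (E →L[ℝ] ℝ) × G => x.1 w) (hTs z hz)
    simp only [T, multiplierSystem_apply] at h1
    change fderiv ℝ (fderiv ℝ ℓ) z (0, (s z).1) (0, w) - (s z).2 (fderiv ℝ Ψ z (0, w)) =
      fderiv ℝ ℓ z (w, 0) - fderiv ℝ (fderiv ℝ ℓ) z (z.2, 0) (0, w) at h1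
    have h2 : ((z.2, (s z).1) : E × E) = (z.2, 0) + (0, (s z).1) := by simp
    change fderiv ℝ (fderiv ℝ ℓ) z (z.2, (s z).1) (0, w) - fderiv ℝ ℓ z (w, 0) = _
    rw [h2, map_add, add_apply]
    linarith

end ConstrainedDynamics

/-! ### The nonholonomic field and force in a natural chart -/

section LocalDynamics

variable {E : Type*} [NormedAddCommGroup E] [NormedSpace ℝ E]
  {Q : Type*} [TopologicalSpace Q] [ChartedSpace E Q] [IsManifold 𝓘(ℝ, E) ∞ Q]
  {L : TangentBundle 𝓘(ℝ, E) Q → ℝ}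
  {D : (q : Q) → Submodule ℝ (TangentSpace 𝓘(ℝ, E) q)} {W : Set Q} {k : ℕ}
  {μ : Fin k → (q : Q) → TangentSpace 𝓘(ℝ, E) q →ₗ[ℝ] ℝ}

theorem bijective_chartDeriv {v₀ v : TangentBundle 𝓘(ℝ, E) Q}
    (hv : v ∈ (extChartAt 𝓘(ℝ, E).tangent v₀).source) :
    Function.Bijective (chartDeriv v₀ v) := by
  obtain ⟨e, he⟩ := isInvertible_mfderiv_extChartAt (I := 𝓘(ℝ, E).tangent) hv
  have h1 : ∀ X : E × E, chartDeriv v₀ v X = e X := fun X =>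
    (congrArg (fun A : E × E →L[ℝ] E × E => A X) he).symm
  rw [show (chartDeriv v₀ v : E × E → E × E) = e from funext h1]
  exact e.bijective

theorem contractOmega_sub (L : TangentBundle 𝓘(ℝ, E) Q → ℝ) (v : TangentBundle 𝓘(ℝ, E) Q)
    (X X' : TangentSpace 𝓘(ℝ, E).tangent v) :
    contractOmega L v (X - X') = contractOmega L v X - contractOmega L v X' := by
  let A : E × E →L[ℝ] E × E →L[ℝ] ℝ :=
    fderiv ℝ (poincareCartanOneForm L v) (extChartAt 𝓘(ℝ, E).tangent v v)
  have h : ∀ X X' : E × E, A.flip (X - X') - A (X - X') =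
      (A.flip X - A X) - (A.flip X' - A X') := fun X X' => by
    rw [map_sub, map_sub]; abel
  exact h X X'

/-- The energy cancels in the difference of two solutions, so compatibility kills it. This
identifies the vector picked in `nonholonomicField` with any solution found in a chart. -/
theorem IsRegularSystem.nonholonomicVector_unique (hsys : IsRegularSystem L D)
    {v : TangentBundle 𝓘(ℝ, E) Q} (hv : v ∈ constraintSet D)
    {X X' : TangentSpace 𝓘(ℝ, E).tangent v} (hX : IsNonholonomicVector L D v X)
    (hX' : IsNonholonomicVector L D v X') : X = X' := by
  refine sub_eq_zero.1 (hsys.compatibility v hv _ (Submodule.sub_mem _ hX.1 hX'.1) ?_)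
  convert Submodule.sub_mem _ hX.2 hX'.2 using 1
  rw [contractOmega_sub]
  refine LinearMap.ext fun Y => ?_
  exact (sub_sub_sub_cancel_right (contractOmega L v X Y) (contractOmega L v X' Y)
    (dEnergy L v Y)).symm

/-- The constraint functions in the natural chart at `v₀`. -/
def constraintMap (μ : Fin k → (q : Q) → TangentSpace 𝓘(ℝ, E) q →ₗ[ℝ] ℝ)
    (v₀ : TangentBundle 𝓘(ℝ, E) Q) (z : E × E) (a : Fin k) : ℝ :=
  inChart (constraintFun (μ a)) v₀ z

theorem IsLocalCoframe.fderiv_constraintMap (hμ : IsLocalCoframe D W μ)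
    {v₀ : TangentBundle 𝓘(ℝ, E) Q} {z : E × E} (hz : z ∈ coframeDomain W v₀) (Y : E × E)
    (a : Fin k) : fderiv ℝ (constraintMap μ v₀) z Y a =
      fderiv ℝ (inChart (constraintFun (μ a)) v₀) z Y := by
  have h : HasFDerivAt (constraintMap μ v₀) _ z :=
    hasFDerivAt_pi.2 fun a => (hμ.differentiableAt hz a).hasFDerivAt
  rw [h.fderiv]
  rfl

theorem IsLocalCoframe.mem_tangentD_iff_chart (hμ : IsLocalCoframe D W μ)
    {v₀ v : TangentBundle 𝓘(ℝ, E) Q} (hv : v ∈ (extChartAt 𝓘(ℝ, E).tangent v₀).source)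
    (hW : v.proj ∈ W) (hvD : v ∈ constraintSet D) (X : E × E) :
    X ∈ tangentD D v ↔ fderiv ℝ (constraintMap μ v₀) (extChartAt 𝓘(ℝ, E).tangent v₀ v)
      (chartDeriv v₀ v X) = 0 := by
  rw [hμ.mem_tangentD_iff hW hvD, funext_iff]
  refine forall_congr' fun a => ?_
  rw [hμ.constraintDeriv_apply hv hW, hμ.fderiv_constraintMap (mem_coframeDomain hv hW)]
  rfl

theorem IsLocalCoframe.fderiv_constraintMap_vertical (hμ : IsLocalCoframe D W μ)
    {v₀ v : TangentBundle 𝓘(ℝ, E) Q} (hv : v ∈ (extChartAt 𝓘(ℝ, E).tangent v₀).source)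
    (hW : v.proj ∈ W) (Y : E × E) (a : Fin k) :
    fderiv ℝ (constraintMap μ v₀) (extChartAt 𝓘(ℝ, E).tangent v₀ v) (0, (chartDeriv v₀ v Y).1) a =
      μ a v.proj (tangentProj v Y) := by
  have h := hμ.fiberDeriv_apply hv hW a (tangentProj v Y)
  refine (hμ.fderiv_constraintMap (mem_coframeDomain hv hW) _ a).trans (Eq.trans ?_ h)
  exact congrArg (fiberDeriv (inChart (constraintFun (μ a)) v₀) _) (chartDeriv_fst hv Y)

/-- Coefficients of the one-forms and functionals on `Fin k → ℝ` are the same data; the functional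
is the multiplier of `exists_constrained_dynamics`. -/
theorem IsLocalCoframe.mem_reactionForms_iff_chart (hμ : IsLocalCoframe D W μ)
    {v₀ v : TangentBundle 𝓘(ℝ, E) Q} (hv : v ∈ (extChartAt 𝓘(ℝ, E).tangent v₀).source)
    (hW : v.proj ∈ W) (hvD : v ∈ constraintSet D)
    (φ : Module.Dual ℝ (TangentSpace 𝓘(ℝ, E).tangent v)) :
    φ ∈ reactionForms D v ↔ ∃ ν : (Fin k → ℝ) →L[ℝ] ℝ, ∀ Y : E × E, φ Y =
      ν (fderiv ℝ (constraintMap μ v₀) (extChartAt 𝓘(ℝ, E).tangent v₀ v)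
        (0, (chartDeriv v₀ v Y).1)) := by
  rw [hμ.mem_reactionForms_iff hW hvD]
  constructor
  · rintro ⟨c, hc⟩
    refine ⟨∑ a, c a • ContinuousLinearMap.proj a, fun Y => ?_⟩
    have h := hμ.fderiv_constraintMap_vertical hv hW Y
    refine (hc Y).trans ?_
    simp only [sum_apply, smul_apply, ContinuousLinearMap.proj_apply, smul_eq_mul]
    exact Finset.sum_congr rfl fun a _ => congrArg (c a * ·) (h a).symm
  · rintro ⟨ν, hν⟩
    refine ⟨fun a => ν (Pi.single a 1), fun Y => ?_⟩
    rw [hν Y, ← ContinuousLinearMap.coe_coe, LinearMap.pi_apply_eq_sum_univ]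
    refine Finset.sum_congr rfl fun a _ => ?_
    rw [hμ.fderiv_constraintMap_vertical hv hW, smul_eq_mul, mul_comm]
    congr 2
    ext j
    simp [Pi.single_apply, eq_comm]

/-- In a natural chart, the nonholonomic vector field is the restriction to the constraint set of
a smooth second order vector field, and the nonholonomic force is its Euler–Lagrange form. -/
theorem exists_chart_dynamics [FiniteDimensional ℝ E]
    (hL : ContMDiff 𝓘(ℝ, E).tangent 𝓘(ℝ, ℝ) ∞ L) (hD : IsSmoothDistribution D)
    (hsys : IsRegularSystem L D) {v₀ : TangentBundle 𝓘(ℝ, E) Q} (hv₀ : v₀ ∈ constraintSet D) :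
    ∃ (Ω : Set (E × E)) (f : E × E → E × E), IsOpen Ω ∧ extChartAt 𝓘(ℝ, E).tangent v₀ v₀ ∈ Ω ∧
      Ω ⊆ (extChartAt 𝓘(ℝ, E).tangent v₀).target ∧ ContDiffOn ℝ ∞ (inChart L v₀) Ω ∧
      ContDiffOn ℝ ∞ f Ω ∧ (∀ z ∈ Ω, (f z).1 = z.2) ∧
      ∀ v ∈ constraintSet D, v ∈ (extChartAt 𝓘(ℝ, E).tangent v₀).source →
        extChartAt 𝓘(ℝ, E).tangent v₀ v ∈ Ω →
        chartDeriv v₀ v (nonholonomicField L D v) = f (extChartAt 𝓘(ℝ, E).tangent v₀ v) ∧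
        ∀ Y : E × E, nonholonomicForce L D v (tangentProj v Y) =
          eulerLagrangeForm (inChart L v₀) f (extChartAt 𝓘(ℝ, E).tangent v₀ v)
            (chartDeriv v₀ v Y).1 := by
  obtain ⟨W, k, μ, hWo, hW₀, hμs, hμ'⟩ := hD v₀.proj
  have hμ : IsLocalCoframe D W μ := ⟨hWo, hμs, fun q hq => (hμ' q hq).1, fun q hq => (hμ' q hq).2⟩
  have hs₀ := mem_extChartAt_source (I := 𝓘(ℝ, E).tangent) v₀
  have hz₀ : extChartAt 𝓘(ℝ, E).tangent v₀ v₀ ∈ coframeDomain W v₀ := mem_coframeDomain hs₀ hW₀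
  have hℓ : ContDiffOn ℝ ∞ (inChart L v₀) (coframeDomain W v₀) :=
    (contDiffOn_inChart hL.contMDiffOn (W := univ) v₀).mono fun z hz => ⟨hz.1, mem_univ _⟩
  obtain ⟨Ω, f, hΩ, hzΩ, hΩN, hf, hdyn⟩ := exists_constrained_dynamics (ℓ := inChart L v₀)
    (Ψ := constraintMap μ v₀) (hμ.isOpen_coframeDomain v₀) hℓ
    (contDiffOn_pi.2 fun a => hμ.contDiffOn v₀ a) hz₀ (fun c ν h1 h2 => by
      -- Compatibility is applied to the vertical vector with fibre part `c`. Its contraction is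
      -- minus the fibre Hessian of `c` on base components, so `h1` makes it a reaction form and
      -- `h2` makes the vector tangent to `D`.
      obtain ⟨X, hX⟩ := (bijective_chartDeriv hs₀).2 (0, c)
      have hXD : X ∈ tangentD D v₀ := by
        rw [hμ.mem_tangentD_iff_chart hs₀ hW₀ hv₀, hX, h2]
      have hX0 : X = 0 := by
        refine hsys.compatibility v₀ hv₀ X hXD ?_
        rw [hμ.mem_reactionForms_iff_chart hs₀ hW₀ hv₀]
        refine ⟨-ν, fun Y => ?_⟩
        refine (contractOmega_apply hL hs₀ X Y).trans ?_
        rw [hX]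
        have h3 := congrArg (fun A : E →L[ℝ] ℝ => A (chartDeriv v₀ v₀ Y).1) h1
        have h4 : fderiv ℝ (fderiv ℝ (inChart L v₀)) (extChartAt 𝓘(ℝ, E).tangent v₀ v₀) (0, c)
            (0, (chartDeriv v₀ v₀ Y).1) = ν (fderiv ℝ (constraintMap μ v₀)
              (extChartAt 𝓘(ℝ, E).tangent v₀ v₀) (0, (chartDeriv v₀ v₀ Y).1)) := h3
        rw [h4]
        have h5 : (((0 : E), ((0, c) : E × E).1) : E × E) = 0 := rfl
        rw [h5, map_zero, zero_sub]
        rfl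
      have hc : c = 0 := by
        rw [hX0, map_zero] at hX
        exact (congrArg Prod.snd hX).symm
      -- With `c = 0` the functional `ν` vanishes on the range of the fibre derivative of the
      -- constraints, which is everything by independence.
      refine ⟨hc, ContinuousLinearMap.ext fun y => ?_⟩
      obtain ⟨w, hw⟩ := surjective_pi_of_linearIndependent (hμ.linearIndependent _ hW₀) y
      have h3 := congrArg (fun A : E →L[ℝ] ℝ =>
        A (tangentCoordChange 𝓘(ℝ, E) v₀.proj v₀.proj v₀.proj w)) h1
      simp only [hc, map_zero] at h3
      have h4 : fderiv ℝ (constraintMap μ v₀) (extChartAt 𝓘(ℝ, E).tangent v₀ v₀)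
          (0, tangentCoordChange 𝓘(ℝ, E) v₀.proj v₀.proj v₀.proj w) = y := by
        ext a
        rw [hμ.fderiv_constraintMap hz₀]
        exact (hμ.fiberDeriv_apply hs₀ hW₀ a w).trans (congrFun hw a)
      rw [← h4]
      exact h3.symm)
  refine ⟨Ω, f, hΩ, hzΩ, fun z hz => (hΩN hz).1, hℓ.mono hΩN, hf, fun z hz => (hdyn z hz).1,
    fun v hvD hv hvΩ => ?_⟩
  obtain ⟨hf1, hf2, ν, hν⟩ := hdyn _ hvΩ
  have hW : v.proj ∈ W := by
    have h1 := (hΩN hvΩ).2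
    rw [mem_preimage, (extChartAt 𝓘(ℝ, E).tangent v₀).left_inv hv] at h1
    exact h1
  obtain ⟨X, hX⟩ := (bijective_chartDeriv hv).2 (f (extChartAt 𝓘(ℝ, E).tangent v₀ v))
  have hEL : ∀ Y : E × E, contractOmega L v X Y - dEnergy L v Y = -eulerLagrangeForm
      (inChart L v₀) f (extChartAt 𝓘(ℝ, E).tangent v₀ v) (chartDeriv v₀ v Y).1 := fun Y => by
    refine (contractOmega_sub_dEnergy_apply hL hv (by rw [hX, hf1]) Y).trans ?_
    rw [hX]
    rfl
  have hnh : IsNonholonomicVector L D v X := by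
    refine ⟨(hμ.mem_tangentD_iff_chart hv hW hvD X).2 (by rw [hX, hf2]),
      (hμ.mem_reactionForms_iff_chart hv hW hvD _).2 ⟨-ν, fun Y => ?_⟩⟩
    refine (hEL Y).trans ?_
    rw [hν]
    rfl
  have hfield : nonholonomicField L D v = X := by
    have hex : ∃ X, IsNonholonomicVector L D v X := ⟨X, hnh⟩
    rw [nonholonomicField, dif_pos hex]
    exact hsys.nonholonomicVector_unique hvD hex.choose_spec hnh
  refine ⟨by rw [hfield, hX], fun Y => ?_⟩
  -- The force is a chosen functional, but its defining equation fixes its value on every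
  -- `tangentProj v Y`; only existence has to be shown.
  have hex : ∃ F : TangentSpace 𝓘(ℝ, E) v.proj →L[ℝ] ℝ, ∀ Y : TangentSpace 𝓘(ℝ, E).tangent v,
      contractOmega L v (nonholonomicField L D v) Y = dEnergy L v Y - F (tangentProj v Y) := by
    let F : E →L[ℝ] ℝ := (eulerLagrangeForm (inChart L v₀) f
      (extChartAt 𝓘(ℝ, E).tangent v₀ v)).comp (tangentCoordChange 𝓘(ℝ, E) v.proj v₀.proj v.proj)
    refine ⟨F, fun Y => ?_⟩
    rw [hfield]
    have h1 := hEL Y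
    rw [chartDeriv_fst hv] at h1
    have h2 : F (tangentProj v Y) = eulerLagrangeForm (inChart L v₀) f
      (extChartAt 𝓘(ℝ, E).tangent v₀ v)
        (tangentCoordChange 𝓘(ℝ, E) v.proj v₀.proj v.proj (tangentProj v Y)) := rfl
    exact (by linarith : contractOmega L v X Y = dEnergy L v Y - F (tangentProj v Y))
  rw [nonholonomicForce, dif_pos hex]
  have h1 := hex.choose_spec Y
  have h2 := hEL Y
  have h3 : contractOmega L v (nonholonomicField L D v) Y = contractOmega L v X Y :=
    congrArg (fun X : TangentSpace 𝓘(ℝ, E).tangent v => contractOmega L v X Y) hfield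
  rw [h3] at h1
  linarith

end LocalDynamics

/-! ### Uniqueness of trajectories and the flow -/

section Trajectories

variable {E : Type*} [NormedAddCommGroup E] [NormedSpace ℝ E]
  {Q : Type*} [TopologicalSpace Q] [ChartedSpace E Q] [IsManifold 𝓘(ℝ, E) ∞ Q]

/-- Vectors over different points are separated by the projection; vectors over the same point lie
in a common chart. -/
theorem t2Space_tangentBundle [T2Space Q] : T2Space (TangentBundle 𝓘(ℝ, E) Q) := by
  refine ⟨fun v w hvw => ?_⟩
  by_cases hp : v.proj = w.proj
  · let e := chartAt (ModelProd E E) v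
    have hv : v ∈ e.source := mem_chart_source _ v
    have hw : w ∈ e.source := by
      have h1 : w ∈ (extChartAt 𝓘(ℝ, E).tangent v).source := by
        rw [mem_extChartAt_tangent_source, ← hp]; exact mem_extChartAt_source _
      rwa [extChartAt_source] at h1
    have hne : (e v : E × E) ≠ e w := fun h => hvw (e.injOn hv hw h)
    obtain ⟨A, B, hA, hB, hvA, hwB, hAB⟩ := t2_separation (X := E × E) hne
    exact ⟨e.source ∩ e ⁻¹' A, e.source ∩ e ⁻¹' B, e.isOpen_inter_preimage hA,
      e.isOpen_inter_preimage hB, ⟨hv, hvA⟩, ⟨hw, hwB⟩,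
      (hAB.preimage e).mono inter_subset_right inter_subset_right⟩
  · exact separated_by_continuous (f := (proj : TangentBundle 𝓘(ℝ, E) Q → Q))
      continuous_tangentBundle_proj hp

theorem hasDerivWithinAt_chart_comp {v₀ : TangentBundle 𝓘(ℝ, E) Q}
    {V : (v : TangentBundle 𝓘(ℝ, E) Q) → TangentSpace 𝓘(ℝ, E).tangent v}
    {γ : ℝ → TangentBundle 𝓘(ℝ, E) Q} {J : Set ℝ}
    (hγ : IsMIntegralCurveOn (I := 𝓘(ℝ, E).tangent) γ V J) {t : ℝ} (ht : t ∈ J)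
    (hs : γ t ∈ (extChartAt 𝓘(ℝ, E).tangent v₀).source) :
    HasDerivWithinAt (extChartAt 𝓘(ℝ, E).tangent v₀ ∘ γ) (chartDeriv v₀ (γ t) (V (γ t))) J t := by
  have h1 := HasMFDerivAt.comp_hasMFDerivWithinAt (I' := 𝓘(ℝ, E).tangent) t
    (hasMFDerivAt_chart hs) (hγ t ht)
  have h2 : HasFDerivWithinAt (extChartAt 𝓘(ℝ, E).tangent v₀ ∘ γ)
      ((chartDeriv v₀ (γ t)).comp ((1 : ℝ →L[ℝ] ℝ).smulRight (V (γ t) : E × E))) J t :=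
    hasMFDerivWithinAt_iff_hasFDerivWithinAt.1 h1
  have h3 : ((1 : ℝ →L[ℝ] ℝ).smulRight (V (γ t) : E × E)) 1 = V (γ t) := by simp
  exact h2.hasDerivWithinAt.congr_deriv (congrArg (chartDeriv v₀ (γ t)) h3)

variable {L : TangentBundle 𝓘(ℝ, E) Q → ℝ} {D : (q : Q) → Submodule ℝ (TangentSpace 𝓘(ℝ, E) q)}

theorem IsTrajectory.mono {s t : ℝ} {v : TangentBundle 𝓘(ℝ, E) Q}
    {γ : ℝ → TangentBundle 𝓘(ℝ, E) Q} (hγ : IsTrajectory L D t v γ) (hst : s ≤ t) :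
    IsTrajectory L D s v γ :=
  ⟨hγ.1, fun r hr => hγ.2.1 r ⟨hr.1, hr.2.trans hst⟩, hγ.2.2.mono (Icc_subset_Icc_right hst)⟩

variable [FiniteDimensional ℝ E]

/-- The field is meaningful only along `D`. In a chart, however, curves in `D` solve the extended
smooth equation, which has unique local solutions; agreement then spreads along the interval. -/
theorem eqOn_of_isMIntegralCurveOn [T2Space Q]
    (hL : ContMDiff 𝓘(ℝ, E).tangent 𝓘(ℝ, ℝ) ∞ L) (hD : IsSmoothDistribution D)
    (hsys : IsRegularSystem L D) {c d : ℝ} {γ γ' : ℝ → TangentBundle 𝓘(ℝ, E) Q}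
    (hγD : ∀ s ∈ Icc c d, γ s ∈ constraintSet D) (hγD' : ∀ s ∈ Icc c d, γ' s ∈ constraintSet D)
    (hγ : IsMIntegralCurveOn (I := 𝓘(ℝ, E).tangent) γ (nonholonomicField L D) (Icc c d))
    (hγ' : IsMIntegralCurveOn (I := 𝓘(ℝ, E).tangent) γ' (nonholonomicField L D) (Icc c d))
    {t₀ : ℝ} (ht₀ : t₀ ∈ Icc c d) (heq : γ t₀ = γ' t₀) : EqOn γ γ' (Icc c d) := by
  have : T2Space (TangentBundle 𝓘(ℝ, E) Q) := t2Space_tangentBundle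
  refine eqOn_of_eventually_eq isPreconnected_Icc hγ.continuousOn hγ'.continuousOn ht₀ heq
    fun t ht hteq => ?_
  obtain ⟨Ω, f, hΩ, hzΩ, hΩt, -, hf, -, hdyn⟩ := exists_chart_dynamics hL hD hsys (hγD t ht)
  let e := extChartAt 𝓘(ℝ, E).tangent (γ t)
  have hmem : ∀ {κ : ℝ → TangentBundle 𝓘(ℝ, E) Q}, ContinuousOn κ (Icc c d) → κ t = γ t →
      ∀ᶠ s in 𝓝[Icc c d] t, κ s ∈ e.source ∧ e (κ s) ∈ Ω := by
    intro κ hκ hκt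
    have h1 : e.source ∩ e ⁻¹' Ω ∈ 𝓝 (κ t) := by
      rw [hκt]
      exact Filter.inter_mem (extChartAt_source_mem_nhds _)
        ((continuousAt_extChartAt _).preimage_mem_nhds (hΩ.mem_nhds hzΩ))
    exact (hκ t ht).eventually h1
  have hder : ∀ {κ : ℝ → TangentBundle 𝓘(ℝ, E) Q}, (∀ s ∈ Icc c d, κ s ∈ constraintSet D) →
      IsMIntegralCurveOn (I := 𝓘(ℝ, E).tangent) κ (nonholonomicField L D) (Icc c d) → κ t = γ t →
      ∀ᶠ s in 𝓝[Icc c d] t, HasDerivWithinAt (e ∘ κ) (f ((e ∘ κ) s)) (Icc c d) s := by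
    intro κ hκD hκ hκt
    filter_upwards [hmem hκ.continuousOn hκt, self_mem_nhdsWithin] with s hs hsI
    have h1 := hasDerivWithinAt_chart_comp hκ hsI hs.1
    rwa [(hdyn _ (hκD s hsI) hs.1 hs.2).1] at h1
  have h1 := eventually_eq_of_hasDerivWithinAt (α := e ∘ γ) (β := e ∘ γ')
    (((hf.contDiffAt (hΩ.mem_nhds hzΩ))).of_le (by simp)) ht (congrArg e hteq)
    (hder hγD hγ rfl) (hder hγD' hγ' hteq.symm)
  filter_upwards [h1, hmem hγ.continuousOn rfl, hmem hγ'.continuousOn hteq.symm] with s h1 h2 h3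
  exact e.injOn h2.1 h3.1 h1

/-- `flow` chooses a trajectory separately for each time, and uniqueness makes these choices fit
into one curve. -/
theorem IsTrajectory.flow_eq [T2Space Q]
    (hL : ContMDiff 𝓘(ℝ, E).tangent 𝓘(ℝ, ℝ) ∞ L) (hD : IsSmoothDistribution D)
    (hsys : IsRegularSystem L D) {t : ℝ} {v : TangentBundle 𝓘(ℝ, E) Q}
    {γ : ℝ → TangentBundle 𝓘(ℝ, E) Q} (hγ : IsTrajectory L D t v γ) {s : ℝ} (hs : s ∈ Icc 0 t) :
    flow L D s v = γ s := by
  have hγs := hγ.mono hs.2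
  have hex : ∃ γ, IsTrajectory L D s v γ := ⟨γ, hγs⟩
  rw [flow, dif_pos hex]
  have hc := hex.choose_spec
  exact eqOn_of_isMIntegralCurveOn hL hD hsys hc.2.1 hγs.2.1 hc.2.2 hγs.2.2
    (left_mem_Icc.2 hs.1) (hc.1.trans hγs.1.symm) (right_mem_Icc.2 hs.1)

theorem isTrajectory_flow [T2Space Q]
    (hL : ContMDiff 𝓘(ℝ, E).tangent 𝓘(ℝ, ℝ) ∞ L) (hD : IsSmoothDistribution D)
    (hsys : IsRegularSystem L D) {h : ℝ} (hh : 0 ≤ h) {v : TangentBundle 𝓘(ℝ, E) Q}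
    (hv : v ∈ flowDomain L D h) : IsTrajectory L D h v (fun t => flow L D t v) := by
  obtain ⟨-, γ, hγ⟩ := hv
  have heq : ∀ s ∈ Icc 0 h, flow L D s v = γ s := fun s hs => hγ.flow_eq hL hD hsys hs
  refine ⟨(heq 0 (left_mem_Icc.2 hh)).trans hγ.1, fun s hs => ?_, fun s hs => ?_⟩
  · change flow L D s v ∈ _
    rw [heq s hs]
    exact hγ.2.1 s hs
  · have h1 := (hγ.2.2 s hs).congr_mono heq (heq s hs) Subset.rfl
    let A : TangentBundle 𝓘(ℝ, E) Q → ℝ →L[ℝ] E × E := fun w =>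
      (1 : ℝ →L[ℝ] ℝ).smulRight (nonholonomicField L D w : E × E)
    exact h1.congr_mfderiv (congrArg A (heq s hs)).symm

end Trajectories

/-! ### Families of trajectories and their variations -/

section Variation

variable {E : Type*} [NormedAddCommGroup E] [NormedSpace ℝ E]
  {Q : Type*} [TopologicalSpace Q] [ChartedSpace E Q] [IsManifold 𝓘(ℝ, E) ∞ Q]
  {V : Type*} [NormedAddCommGroup V] [NormedSpace ℝ V]
  {H : Type*} [TopologicalSpace H] {N : Type*} [TopologicalSpace N] [ChartedSpace H N]

/-- `y` is a family, parametrized by `S`, of trajectories on `[0, h]`. -/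
structure IsTrajectoryFamily (L : TangentBundle 𝓘(ℝ, E) Q → ℝ)
    (D : (q : Q) → Submodule ℝ (TangentSpace 𝓘(ℝ, E) q)) (h : ℝ) (S : Set N)
    (y : ℝ → N → TangentBundle 𝓘(ℝ, E) Q) : Prop where
  mem : ∀ p ∈ S, ∀ t ∈ Icc 0 h, y t p ∈ constraintSet D
  isMIntegralCurveOn : ∀ p ∈ S,
    IsMIntegralCurveOn (I := 𝓘(ℝ, E).tangent) (fun t => y t p) (nonholonomicField L D) (Icc 0 h)

/-- The variation of the base curve, as the projection of the variation of the trajectory. -/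
def baseVariation (J : ModelWithCorners ℝ V H) (S : Set N) (y : ℝ → N → TangentBundle 𝓘(ℝ, E) Q)
    (p : N) (X : TangentSpace J p) (t : ℝ) : TangentSpace 𝓘(ℝ, E) (y t p).proj :=
  tangentProj (y t p) (mfderivWithin J 𝓘(ℝ, E).tangent (y t) S p X)

/-- The formula for the differential of the action between the times `a` and `b`. -/
def HasVariationFormula (J : ModelWithCorners ℝ V H) (L : TangentBundle 𝓘(ℝ, E) Q → ℝ)
    (D : (q : Q) → Submodule ℝ (TangentSpace 𝓘(ℝ, E) q)) (S : Set N)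
    (y : ℝ → N → TangentBundle 𝓘(ℝ, E) Q) (p : N) (a b : ℝ) : Prop :=
  MDifferentiableWithinAt J 𝓘(ℝ, ℝ) (fun p => ∫ t in a..b, L (y t p)) S p ∧
    ∀ X ∈ tangentSubspace J S p,
      IntervalIntegrable (fun t => nonholonomicForce L D (y t p) (baseVariation J S y p X t))
        volume a b ∧
      mfderivWithin J 𝓘(ℝ, ℝ) (fun p => ∫ t in a..b, L (y t p)) S p X =
        -(∫ t in a..b, nonholonomicForce L D (y t p) (baseVariation J S y p X t)) +
          legendre L (y b p) (baseVariation J S y p X b) -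
          legendre L (y a p) (baseVariation J S y p X a)

variable {L : TangentBundle 𝓘(ℝ, E) Q → ℝ}
  {D : (q : Q) → Submodule ℝ (TangentSpace 𝓘(ℝ, E) q)} {J : ModelWithCorners ℝ V H}
  {S : Set N} {y : ℝ → N → TangentBundle 𝓘(ℝ, E) Q} {h : ℝ} {p₀ : N}

/-- A trajectory agrees with an integral curve of the chart dynamics. -/
theorem eqOn_chart_flow [T2Space Q]
    {v₀ : TangentBundle 𝓘(ℝ, E) Q} {Ω : Set (E × E)} {f : E × E → E × E} (hΩ : IsOpen Ω)
    (hΩt : Ω ⊆ (extChartAt 𝓘(ℝ, E).tangent v₀).target) (hf : ContDiffOn ℝ ∞ f Ω)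
    (hdyn : ∀ v ∈ constraintSet D, v ∈ (extChartAt 𝓘(ℝ, E).tangent v₀).source →
      extChartAt 𝓘(ℝ, E).tangent v₀ v ∈ Ω →
      chartDeriv v₀ v (nonholonomicField L D v) = f (extChartAt 𝓘(ℝ, E).tangent v₀ v))
    {c d : ℝ} {γ : ℝ → TangentBundle 𝓘(ℝ, E) Q} (hγD : ∀ s ∈ Icc c d, γ s ∈ constraintSet D)
    (hγ : IsMIntegralCurveOn (I := 𝓘(ℝ, E).tangent) γ (nonholonomicField L D) (Icc c d))
    {I : Set ℝ} (hI : IsOpen I) (hIc : IsPreconnected (Icc c d ∩ I)) {α : ℝ → E × E}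
    (hαΩ : ∀ s ∈ I, α s ∈ Ω) (hα : ∀ s ∈ I, HasDerivAt α (f (α s)) s)
    {a : ℝ} (ha : a ∈ Icc c d ∩ I) (hγa : γ a = (extChartAt 𝓘(ℝ, E).tangent v₀).symm (α a)) :
    EqOn γ ((extChartAt 𝓘(ℝ, E).tangent v₀).symm ∘ α) (Icc c d ∩ I) := by
  have : T2Space (TangentBundle 𝓘(ℝ, E) Q) := t2Space_tangentBundle
  let e := extChartAt 𝓘(ℝ, E).tangent v₀
  refine eqOn_of_eventually_eq hIc (hγ.continuousOn.mono inter_subset_left) ?_ ha hγa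
    fun t ht hteq => ?_
  · exact (continuousOn_extChartAt_symm v₀).comp
      (fun s hs => (hα s hs.2).continuousAt.continuousWithinAt) fun s hs => hΩt (hαΩ s hs.2)
  · have hγt : γ t ∈ e.source ∧ e (γ t) = α t := by
      have h1 : γ t = e.symm (α t) := hteq
      rw [h1]
      exact ⟨e.map_target (hΩt (hαΩ t ht.2)), e.right_inv (hΩt (hαΩ t ht.2))⟩
    have hmem : ∀ᶠ s in 𝓝[Icc c d] t, γ s ∈ e.source ∧ e (γ s) ∈ Ω := by
      have h1 : e.source ∩ e ⁻¹' Ω ∈ 𝓝 (γ t) := by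
        refine Filter.inter_mem ((isOpen_extChartAt_source v₀).mem_nhds hγt.1)
          ((continuousAt_extChartAt' hγt.1).preimage_mem_nhds (hΩ.mem_nhds ?_))
        change e (γ t) ∈ Ω
        rw [hγt.2]
        exact hαΩ t ht.2
      exact (hγ.continuousOn t ht.1).eventually h1
    have h1 : ∀ᶠ s in 𝓝[Icc c d] t,
        HasDerivWithinAt (e ∘ γ) (f ((e ∘ γ) s)) (Icc c d) s := by
      filter_upwards [hmem, self_mem_nhdsWithin] with s hs hsI
      have h2 := hasDerivWithinAt_chart_comp hγ hsI hs.1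
      rwa [hdyn _ (hγD s hsI) hs.1 hs.2] at h2
    have h2 : ∀ᶠ s in 𝓝[Icc c d] t, HasDerivWithinAt α (f (α s)) (Icc c d) s := by
      filter_upwards [mem_nhdsWithin_of_mem_nhds (hI.mem_nhds ht.2)] with s hs
      exact (hα s hs).hasDerivWithinAt
    -- The solution `α` is not assumed to lie in the constraint set; uniqueness for the extended
    -- field makes it follow the trajectory.
    have h3 := eventually_eq_of_hasDerivWithinAt (α := e ∘ γ) (β := α)
      (by
        change ContDiffAt ℝ 1 f (e (γ t))
        rw [hγt.2]
        exact (hf.contDiffAt (hΩ.mem_nhds (hαΩ t ht.2))).of_le (by simp)) ht.1 hγt.2 h1 h2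
    refine (nhdsWithin_mono t inter_subset_left) ?_
    filter_upwards [h3, hmem] with s h4 h5
    rw [Function.comp_apply, ← h4]
    exact (e.left_inv h5.1).symm

end Variation

/-! ### Local propagation of differentiability and of the variation formula -/

section LocalVariation

variable {E : Type*} [NormedAddCommGroup E] [NormedSpace ℝ E] [FiniteDimensional ℝ E]
  {Q : Type*} [TopologicalSpace Q] [T2Space Q] [ChartedSpace E Q] [IsManifold 𝓘(ℝ, E) ∞ Q]
  {V : Type*} [NormedAddCommGroup V] [NormedSpace ℝ V]
  {H : Type*} [TopologicalSpace H] {N : Type*} [TopologicalSpace N] [ChartedSpace H N]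
  {L : TangentBundle 𝓘(ℝ, E) Q → ℝ}
  {D : (q : Q) → Submodule ℝ (TangentSpace 𝓘(ℝ, E) q)} {J : ModelWithCorners ℝ V H}
  {S : Set N} {y : ℝ → N → TangentBundle 𝓘(ℝ, E) Q} {h : ℝ} {p₀ : N}

/-- Differentiability with respect to parameters and the variation formula propagate locally along
a trajectory. -/
theorem IsTrajectoryFamily.exists_local_variation
    (hL : ContMDiff 𝓘(ℝ, E).tangent 𝓘(ℝ, ℝ) ∞ L) (hD : IsSmoothDistribution D)
    (hsys : IsRegularSystem L D) (hy : IsTrajectoryFamily L D h S y) (hp₀ : p₀ ∈ S)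
    {x : ℝ} (hx : x ∈ Icc 0 h) :
    ∃ δ > 0, ∀ a ∈ Icc 0 h, |a - x| < δ →
      MDifferentiableWithinAt J 𝓘(ℝ, E).tangent (y a) S p₀ →
      (∀ X ∈ tangentSubspace J S p₀, ContMDiffWithinAt 𝓘(ℝ, ℝ) 𝓘(ℝ, E).tangent ∞
        (fun t : ℝ => (⟨(y t p₀).proj, baseVariation J S y p₀ X t⟩ : TangentBundle 𝓘(ℝ, E) Q))
        (Icc 0 h) a) ∧
      ∀ b ∈ Icc 0 h, |b - x| < δ → MDifferentiableWithinAt J 𝓘(ℝ, E).tangent (y b) S p₀ ∧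
        HasVariationFormula J L D S y p₀ a b := by
  let v₀ := y x p₀
  let e := extChartAt 𝓘(ℝ, E).tangent v₀
  obtain ⟨Ω, f, hΩ, hzΩ, hΩt, hℓ, hf, hfst, hdyn⟩ :=
    exists_chart_dynamics hL hD hsys (hy.mem p₀ hp₀ x hx)
  obtain ⟨ε, hε, r, hr, Θ, M, hflow⟩ := exists_localFlow_action hΩ hzΩ hℓ hf hfst
  have hev : ∀ᶠ t in 𝓝[Icc 0 h] x, y t p₀ ∈ e.source ∩ e ⁻¹' Metric.ball (e v₀) r :=
    ((hy.isMIntegralCurveOn p₀ hp₀).continuousOn x hx).eventually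
      (Filter.inter_mem (extChartAt_source_mem_nhds v₀)
        ((continuousAt_extChartAt v₀).preimage_mem_nhds (Metric.ball_mem_nhds _ hr)))
  obtain ⟨δ₁, hδ₁, hball⟩ := Metric.mem_nhdsWithin_iff.1 hev
  -- The bound `δ₁` keeps the trajectory in the ball where `Θ` is defined; `ε / 2` makes any two
  -- admissible times differ by less than `ε`.
  let δ := min δ₁ (ε / 2)
  have hδ : 0 < δ := lt_min hδ₁ (half_pos hε)
  have hδε : ∀ {a b : ℝ}, |a - x| < δ → |b - x| < δ → |b - a| < ε := fun {a b} ha hb => by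
    have h1 : δ ≤ ε / 2 := min_le_right _ _
    rw [abs_lt] at *
    constructor <;> linarith
  have hnear : ∀ {t}, t ∈ Icc 0 h → |t - x| < δ → y t p₀ ∈ e.source ∧
      e (y t p₀) ∈ Metric.ball (e v₀) r := fun {t} ht htx =>
    hball ⟨by rw [Metric.mem_ball, Real.dist_eq]; exact htx.trans_le (min_le_left _ _), ht⟩
  -- the trajectories in the chart
  have hrep : ∀ {a}, a ∈ Icc 0 h → |a - x| < δ → ∀ p ∈ S, y a p ∈ e.source →
      e (y a p) ∈ Metric.ball (e v₀) r → ∀ {t}, t ∈ Icc 0 h → |t - x| < δ →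
      Θ (t - a) (e (y a p)) ∈ e.target ∧ y t p = e.symm (Θ (t - a) (e (y a p))) := by
    intro a ha hax p hp hs hb t ht htx
    obtain ⟨h0, hΘ, -⟩ := hflow _ hb
    have hI : ∀ s ∈ Ioo (x - δ) (x + δ), |s - a| < ε := fun s hs =>
      hδε hax (by rw [abs_lt]; constructor <;> linarith [hs.1, hs.2])
    have haI : a ∈ Ioo (x - δ) (x + δ) := by
      rw [abs_lt] at hax; constructor <;> linarith [hax.1, hax.2]
    have htI : t ∈ Ioo (x - δ) (x + δ) := by
      rw [abs_lt] at htx; constructor <;> linarith [htx.1, htx.2]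
    refine ⟨hΩt (hΘ _ (hI t htI)).1, ?_⟩
    refine eqOn_chart_flow (γ := fun t => y t p) (α := fun s => Θ (s - a) (e (y a p))) hΩ hΩt hf
      (fun v hv hvs hvΩ => (hdyn v hv hvs hvΩ).1) (hy.mem p hp) (hy.isMIntegralCurveOn p hp)
      isOpen_Ioo (ordConnected_Icc.inter ordConnected_Ioo).isPreconnected
      (fun s hs => (hΘ _ (hI s hs)).1)
      (fun s hs => ?_) ⟨ha, haI⟩ ?_ ⟨ht, htI⟩
    · exact (hΘ _ (hI s hs)).2.1.comp_sub_const s a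
    · rw [sub_self, h0, e.left_inv hs]
  refine ⟨δ, hδ, fun a ha hax hga => ?_⟩
  obtain ⟨hsa, hba⟩ := hnear ha hax
  let z := e (y a p₀)
  obtain ⟨h0, hΘ, hsmooth, hact⟩ := hflow z hba
  have hnearS : ∀ᶠ p in 𝓝[S] p₀, y a p ∈ e.source ∧ e (y a p) ∈ Metric.ball (e v₀) r :=
    hga.continuousWithinAt.eventually (Filter.inter_mem
      ((isOpen_extChartAt_source v₀).mem_nhds hsa)
      ((continuousAt_extChartAt' hsa).preimage_mem_nhds (Metric.isOpen_ball.mem_nhds hba)))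
  let Da : V →L[ℝ] E × E := mfderivWithin J 𝓘(ℝ, E).tangent (y a) S p₀
  have hea : HasMFDerivWithinAt J 𝓘(ℝ, E × E) (e ∘ y a) S p₀
      ((chartDeriv v₀ (y a p₀)).comp Da) :=
    HasMFDerivAt.comp_hasMFDerivWithinAt (I' := 𝓘(ℝ, E).tangent) p₀ (hasMFDerivAt_chart hsa)
      hga.hasMFDerivWithinAt
  -- Near `p₀` within `S` the family at time `b` is the family at time `a` followed, in the chart,
  -- by `Θ (b - a)`. This transfers differentiability from `a` to `b`, and the derivative picks up
  -- the factor `M (b - a) z`.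
  have hgood : ∀ {b}, b ∈ Icc 0 h → |b - x| < δ →
      MDifferentiableWithinAt J 𝓘(ℝ, E).tangent (y b) S p₀ ∧ e (y b p₀) = Θ (b - a) z ∧
      ∀ X ∈ tangentSubspace J S p₀,
        chartDeriv v₀ (y b p₀) (mfderivWithin J 𝓘(ℝ, E).tangent (y b) S p₀ X) =
          M (b - a) z (chartDeriv v₀ (y a p₀) (Da X)) := by
    intro b hb hbx
    have hΘb := hΘ (b - a) (hδε hax hbx)
    obtain ⟨hsb, -⟩ := hnear hb hbx
    have h1 : HasMFDerivWithinAt J 𝓘(ℝ, E × E) (Θ (b - a) ∘ (e ∘ y a)) S p₀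
        ((M (b - a) z).comp ((chartDeriv v₀ (y a p₀)).comp Da)) :=
      HasMFDerivAt.comp_hasMFDerivWithinAt (I' := 𝓘(ℝ, E × E)) p₀ hΘb.2.2.hasMFDerivAt hea
    have h2 : MDifferentiableAt 𝓘(ℝ, E × E) 𝓘(ℝ, E).tangent e.symm (Θ (b - a) z) :=
      ((contMDiffOn_extChartAt_symm (I := 𝓘(ℝ, E).tangent) (n := ∞) v₀).contMDiffAt
        ((isOpen_extChartAt_target v₀).mem_nhds (hΩt hΘb.1))).mdifferentiableAt (by simp)
    have h3 : MDifferentiableWithinAt J 𝓘(ℝ, E).tangent (e.symm ∘ (Θ (b - a) ∘ (e ∘ y a))) S p₀ :=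
      MDifferentiableAt.comp_mdifferentiableWithinAt (I' := 𝓘(ℝ, E × E)) p₀ h2
        h1.mdifferentiableWithinAt
    have h4 : ∀ p ∈ S, y a p ∈ e.source ∧ e (y a p) ∈ Metric.ball (e v₀) r →
        y b p = (e.symm ∘ (Θ (b - a) ∘ (e ∘ y a))) p := fun p hp hpn =>
      (hrep ha hax p hp hpn.1 hpn.2 hb hbx).2
    have h5 : ∀ p ∈ S, y a p ∈ e.source ∧ e (y a p) ∈ Metric.ball (e v₀) r →
        (e ∘ y b) p = (Θ (b - a) ∘ (e ∘ y a)) p := fun p hp hpn => by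
      rw [Function.comp_apply, h4 p hp hpn]
      exact e.right_inv (hrep ha hax p hp hpn.1 hpn.2 hb hbx).1
    have h6 : MDifferentiableWithinAt J 𝓘(ℝ, E).tangent (y b) S p₀ := by
      refine h3.congr_of_eventuallyEq ?_ (h4 p₀ hp₀ ⟨hsa, hba⟩)
      filter_upwards [hnearS, self_mem_nhdsWithin] with p hp hpS using h4 p hpS hp
    refine ⟨h6, h5 p₀ hp₀ ⟨hsa, hba⟩, fun X hX => ?_⟩
    have h7 : HasMFDerivWithinAt J 𝓘(ℝ, E × E) (e ∘ y b) S p₀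
        ((M (b - a) z).comp ((chartDeriv v₀ (y a p₀)).comp Da)) := by
      refine h1.congr_of_eventuallyEq ?_ (h5 p₀ hp₀ ⟨hsa, hba⟩)
      filter_upwards [hnearS, self_mem_nhdsWithin] with p hp hpS using h5 p hpS hp
    have h8 := HasMFDerivAt.comp_hasMFDerivWithinAt (I' := 𝓘(ℝ, E).tangent) p₀
      (hasMFDerivAt_chart hsb) h6.hasMFDerivWithinAt
    exact (mfderivWithin_apply_eq_of_mem_tangentSubspace h8 hX).symm.trans
      (mfderivWithin_apply_eq_of_mem_tangentSubspace h7 hX)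
  have hvar : ∀ X ∈ tangentSubspace J S p₀, ∀ {b}, b ∈ Icc 0 h → |b - x| < δ →
      tangentCoordChange 𝓘(ℝ, E) (y b p₀).proj v₀.proj (y b p₀).proj
        (baseVariation J S y p₀ X b) = (M (b - a) z (chartDeriv v₀ (y a p₀) (Da X))).1 :=
    fun X hX b hb hbx => by
      rw [← (hgood hb hbx).2.2 X hX]
      exact (chartDeriv_fst (hnear hb hbx).1 _).symm
  have hcont : ∀ᶠ t in 𝓝 a, |t - x| < δ :=
    (by fun_prop : Continuous fun t : ℝ => |t - x|).continuousAt.eventually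
      (isOpen_Iio.mem_nhds hax)
  refine ⟨fun X hX => ?_, fun b hb hbx => ⟨(hgood hb hbx).1, ?_⟩⟩
  · let ξ := chartDeriv v₀ (y a p₀) (Da X)
    let g : ℝ → E × E := fun t => ((Θ (t - a) z).1, (M (t - a) z ξ).1)
    have hpt : ∀ t ∈ Icc 0 h, |t - x| < δ →
        (⟨(y t p₀).proj, baseVariation J S y p₀ X t⟩ : TangentBundle 𝓘(ℝ, E) Q) =
          e.symm (g t) := fun t ht htx => by
      have hs : (⟨(y t p₀).proj, baseVariation J S y p₀ X t⟩ : TangentBundle 𝓘(ℝ, E) Q) ∈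
          e.source :=
        mem_extChartAt_tangent_source.2 (mem_extChartAt_tangent_source.1 (hnear ht htx).1)
      rw [← e.left_inv hs]
      refine congrArg e.symm (Prod.ext ?_ (hvar X hX ht htx))
      have h1 : (e (y t p₀)).1 = (Θ (t - a) z).1 := congrArg Prod.fst (hgood ht htx).2.1
      exact h1
    have hg : ContDiffAt ℝ ∞ g a := by
      have h1 : ContDiffAt ℝ ∞ (fun s => (Θ s z, M s z ξ)) (a - a) := by
        rw [sub_self]
        exact (hsmooth ξ).contDiffAt (Ioo_mem_nhds (by linarith) hε)
      have h2 : ContDiffAt ℝ ∞ (fun t => (Θ (t - a) z, M (t - a) z ξ)) a :=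
        ContDiffAt.comp (E := ℝ) (F := ℝ) (G := (E × E) × (E × E)) (f := fun t => t - a) a h1
          (contDiffAt_id.sub contDiffAt_const)
      exact h2.fst.fst.prodMk h2.snd.fst
    have hga' : g a ∈ e.target := by
      have h1 : Θ (a - a) z ∈ e.target := hΩt (hΘ _ (hδε hax hax)).1
      exact mem_extChartAt_tangent_target.2 (mem_extChartAt_tangent_target.1 h1)
    have h1 : ContMDiffAt 𝓘(ℝ, E × E) 𝓘(ℝ, E).tangent ∞ e.symm (g a) :=
      (contMDiffOn_extChartAt_symm (I := 𝓘(ℝ, E).tangent) (n := ∞) v₀).contMDiffAt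
        ((isOpen_extChartAt_target v₀).mem_nhds hga')
    have h2 : ContMDiffAt 𝓘(ℝ, ℝ) 𝓘(ℝ, E).tangent ∞ (e.symm ∘ g) a :=
      ContMDiffAt.comp (I' := 𝓘(ℝ, E × E)) a h1 hg.contMDiffAt
    refine h2.contMDiffWithinAt.congr_of_eventuallyEq ?_ (hpt a ha hax)
    filter_upwards [self_mem_nhdsWithin, mem_nhdsWithin_of_mem_nhds hcont] with t ht htx
      using hpt t ht htx
  · have hab : ∀ t ∈ uIcc a b, t ∈ Icc 0 h ∧ |t - x| < δ := fun t ht => by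
      refine ⟨ordConnected_Icc.uIcc_subset ha hb ht, ?_⟩
      have h1 := (ordConnected_Ioo (a := x - δ) (b := x + δ)).uIcc_subset
        (x := a) (y := b) (by rw [abs_lt] at hax; constructor <;> linarith [hax.1, hax.2])
        (by rw [abs_lt] at hbx; constructor <;> linarith [hbx.1, hbx.2]) ht
      rw [abs_lt]; constructor <;> linarith [h1.1, h1.2]
    obtain ⟨hint, A, hA, hAξ⟩ := hact 0 (b - a) (by simpa using hε) (hδε hax hbx)
    have hfun : ∀ p ∈ S, y a p ∈ e.source ∧ e (y a p) ∈ Metric.ball (e v₀) r →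
        ∫ t in a..b, L (y t p) =
          ((fun z => ∫ s in (0 : ℝ)..(b - a), inChart L v₀ (Θ s z)) ∘ (e ∘ y a)) p := by
      intro p hp hpn
      have h1 : ∫ t in a..b, L (y t p) =
          ∫ t in a..b, inChart L v₀ (Θ (t - a) (e (y a p))) :=
        intervalIntegral.integral_congr fun t ht => congrArg L
          (hrep ha hax p hp hpn.1 hpn.2 (hab t ht).1 (hab t ht).2).2
      rw [h1, intervalIntegral.integral_comp_sub_right
        (fun s => inChart L v₀ (Θ s (e (y a p)))), sub_self]
      rfl
    have hder : HasMFDerivWithinAt J 𝓘(ℝ, ℝ) (fun p => ∫ t in a..b, L (y t p)) S p₀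
        (A.comp ((chartDeriv v₀ (y a p₀)).comp Da)) := by
      have h1 : HasMFDerivWithinAt J 𝓘(ℝ, ℝ)
          ((fun z => ∫ s in (0 : ℝ)..(b - a), inChart L v₀ (Θ s z)) ∘ (e ∘ y a)) S p₀
          (A.comp ((chartDeriv v₀ (y a p₀)).comp Da)) :=
        HasMFDerivAt.comp_hasMFDerivWithinAt (I' := 𝓘(ℝ, E × E)) p₀ hA.hasMFDerivAt hea
      refine h1.congr_of_eventuallyEq ?_ (hfun p₀ hp₀ ⟨hsa, hba⟩)
      filter_upwards [hnearS, self_mem_nhdsWithin] with p hp hpS using hfun p hpS hp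
    refine ⟨hder.mdifferentiableWithinAt, fun X hX => ?_⟩
    let ξ := chartDeriv v₀ (y a p₀) (Da X)
    -- Only here is the trajectory required to lie in `D`: the extended Euler–Lagrange form is the
    -- nonholonomic force at points of the constraint set.
    have hforce : ∀ t ∈ uIcc a b,
        eulerLagrangeForm (inChart L v₀) f (Θ (t - a) z) (M (t - a) z ξ).1 =
          nonholonomicForce L D (y t p₀) (baseVariation J S y p₀ X t) := fun t ht => by
      obtain ⟨hg1, hg2, hg3⟩ := hgood (hab t ht).1 (hab t ht).2
      have hst := (hnear (hab t ht).1 (hab t ht).2).1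
      have htΩ : e (y t p₀) ∈ Ω := by
        rw [hg2]; exact (hΘ _ (hδε hax (hab t ht).2)).1
      rw [← hg2, ← hg3 X hX]
      exact ((hdyn _ (hy.mem p₀ hp₀ t (hab t ht).1) hst htΩ).2 _).symm
    have hleg : ∀ {t}, t ∈ Icc 0 h → |t - x| < δ →
        fiberDeriv (inChart L v₀) (Θ (t - a) z) (M (t - a) z ξ).1 =
          legendre L (y t p₀) (baseVariation J S y p₀ X t) := fun {t} ht htx => by
      rw [← (hgood ht htx).2.1, ← hvar X hX ht htx]
      exact (legendre_apply hL (hnear ht htx).1 _).symm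
    constructor
    · have h1 := (hint ξ).comp_sub_right a
      rw [zero_add, sub_add_cancel] at h1
      exact h1.congr fun t ht => hforce t (uIoc_subset_uIcc ht)
    · refine (mfderivWithin_apply_eq_of_mem_tangentSubspace hder hX).trans ?_
      refine (hAξ ξ).trans ?_
      have h1 : ∫ s in (0 : ℝ)..(b - a), eulerLagrangeForm (inChart L v₀) f (Θ s z) (M s z ξ).1 =
          ∫ t in a..b, nonholonomicForce L D (y t p₀) (baseVariation J S y p₀ X t) := by
        rw [← intervalIntegral.integral_congr hforce, intervalIntegral.integral_comp_sub_right
          (fun s => eulerLagrangeForm (inChart L v₀) f (Θ s z) (M s z ξ).1), sub_self]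
      have h2 := hleg ha hax
      rw [sub_self] at h2
      rw [h1, hleg hb hbx, h2]

end LocalVariation

/-! ### From local to global along the time interval -/

section GlobalVariation

variable {E : Type*} [NormedAddCommGroup E] [NormedSpace ℝ E]
  {Q : Type*} [TopologicalSpace Q] [ChartedSpace E Q] [IsManifold 𝓘(ℝ, E) ∞ Q]
  {V : Type*} [NormedAddCommGroup V] [NormedSpace ℝ V]
  {H : Type*} [TopologicalSpace H] {N : Type*} [TopologicalSpace N] [ChartedSpace H N]
  {L : TangentBundle 𝓘(ℝ, E) Q → ℝ}
  {D : (q : Q) → Submodule ℝ (TangentSpace 𝓘(ℝ, E) q)} {J : ModelWithCorners ℝ V H}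
  {S : Set N} {y : ℝ → N → TangentBundle 𝓘(ℝ, E) Q} {h : ℝ} {p₀ : N}

theorem IsTrajectoryFamily.intervalIntegrable (hL : ContMDiff 𝓘(ℝ, E).tangent 𝓘(ℝ, ℝ) ∞ L)
    (hy : IsTrajectoryFamily L D h S y) {p : N} (hp : p ∈ S) {a b : ℝ} (ha : a ∈ Icc 0 h)
    (hb : b ∈ Icc 0 h) : IntervalIntegrable (fun t => L (y t p)) volume a b :=
  ContinuousOn.intervalIntegrable <| hL.continuous.comp_continuousOn <|
    (hy.isMIntegralCurveOn p hp).continuousOn.mono (ordConnected_Icc.uIcc_subset ha hb)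

/-- The integrals add, and the momentum terms at the intermediate time `b` cancel. -/
theorem IsTrajectoryFamily.hasVariationFormula_trans (hL : ContMDiff 𝓘(ℝ, E).tangent 𝓘(ℝ, ℝ) ∞ L)
    (hy : IsTrajectoryFamily L D h S y) (hp₀ : p₀ ∈ S) {a b c : ℝ} (ha : a ∈ Icc 0 h)
    (hb : b ∈ Icc 0 h) (hc : c ∈ Icc 0 h) (hab : HasVariationFormula J L D S y p₀ a b)
    (hbc : HasVariationFormula J L D S y p₀ b c) : HasVariationFormula J L D S y p₀ a c := by
  have hadd : ∀ p ∈ S, ∫ t in a..c, L (y t p) =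
      (∫ t in a..b, L (y t p)) + ∫ t in b..c, L (y t p) := fun p hp =>
    (intervalIntegral.integral_add_adjacent_intervals (hy.intervalIntegrable hL hp ha hb)
      (hy.intervalIntegrable hL hp hb hc)).symm
  let A : V →L[ℝ] ℝ := mfderivWithin J 𝓘(ℝ, ℝ) (fun p => ∫ t in a..b, L (y t p)) S p₀
  let B : V →L[ℝ] ℝ := mfderivWithin J 𝓘(ℝ, ℝ) (fun p => ∫ t in b..c, L (y t p)) S p₀
  have hder : HasMFDerivWithinAt J 𝓘(ℝ, ℝ) (fun p => ∫ t in a..c, L (y t p)) S p₀ (A + B) := by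
    have h1 : HasMFDerivWithinAt J 𝓘(ℝ, ℝ)
        (fun p => (∫ t in a..b, L (y t p)) + ∫ t in b..c, L (y t p)) S p₀ (A + B) :=
      ⟨hab.1.hasMFDerivWithinAt.1.add hbc.1.hasMFDerivWithinAt.1,
        HasFDerivWithinAt.add (𝕜 := ℝ) (E := V) (F := ℝ) hab.1.hasMFDerivWithinAt.2
          hbc.1.hasMFDerivWithinAt.2⟩
    exact h1.congr_mono hadd (hadd p₀ hp₀) Subset.rfl
  refine ⟨hder.mdifferentiableWithinAt, fun X hX => ?_⟩
  obtain ⟨hi1, hf1⟩ := hab.2 X hX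
  obtain ⟨hi2, hf2⟩ := hbc.2 X hX
  refine ⟨hi1.trans hi2, ?_⟩
  rw [← intervalIntegral.integral_add_adjacent_intervals hi1 hi2]
  refine (mfderivWithin_apply_eq_of_mem_tangentSubspace hder hX).trans ?_
  have h1 : (A + B) X = A X + B X := rfl
  have h2 : A X = _ := hf1
  have h3 : B X = _ := hf2
  have h4 : A X + B X = _ := congrArg₂ HAdd.hAdd h2 h3
  refine (h1.trans h4).trans ?_
  ring

/-- Connectedness of the interval, applied to the implication from differentiability at one time to
the conclusion at the other. The local result supplies it both from `x` to nearby times and back. -/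
theorem IsTrajectoryFamily.hasVariationFormula [FiniteDimensional ℝ E] [T2Space Q]
    (hL : ContMDiff 𝓘(ℝ, E).tangent 𝓘(ℝ, ℝ) ∞ L) (hD : IsSmoothDistribution D)
    (hsys : IsRegularSystem L D) (hy : IsTrajectoryFamily L D h S y) (hp₀ : p₀ ∈ S)
    {a b : ℝ} (ha : a ∈ Icc 0 h) (hb : b ∈ Icc 0 h)
    (hga : MDifferentiableWithinAt J 𝓘(ℝ, E).tangent (y a) S p₀) :
    MDifferentiableWithinAt J 𝓘(ℝ, E).tangent (y b) S p₀ ∧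
      HasVariationFormula J L D S y p₀ a b := by
  refine isPreconnected_Icc.induction₂'
    (fun a b => MDifferentiableWithinAt J 𝓘(ℝ, E).tangent (y a) S p₀ →
      MDifferentiableWithinAt J 𝓘(ℝ, E).tangent (y b) S p₀ ∧ HasVariationFormula J L D S y p₀ a b)
    (fun x hx => ?_) (fun r s t hr hs ht h1 h2 hg => ?_) ha hb hga
  · obtain ⟨δ, hδ, hloc⟩ := hy.exists_local_variation (J := J) hL hD hsys hp₀ hx
    have hxx : |x - x| < δ := by simpa using hδ
    filter_upwards [self_mem_nhdsWithin, mem_nhdsWithin_of_mem_nhds (Metric.ball_mem_nhds x hδ)]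
      with t ht htx
    rw [Metric.mem_ball, Real.dist_eq] at htx
    exact ⟨fun hg => (hloc x hx hxx hg).2 t ht htx, fun hg => (hloc t ht htx hg).2 x hx hxx⟩
  · obtain ⟨hgs, hrs⟩ := h1 hg
    obtain ⟨hgt, hst⟩ := h2 hgs
    exact ⟨hgt, hy.hasVariationFormula_trans hL hp₀ hr hs ht hrs hst⟩

/-- Smoothness is local in time. Since the family is differentiable at every time, the local result
applies with base time `x` itself. -/
theorem IsTrajectoryFamily.contMDiffOn_baseVariation [FiniteDimensional ℝ E] [T2Space Q]
    (hL : ContMDiff 𝓘(ℝ, E).tangent 𝓘(ℝ, ℝ) ∞ L) (hD : IsSmoothDistribution D)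
    (hsys : IsRegularSystem L D) (hy : IsTrajectoryFamily L D h S y) (hp₀ : p₀ ∈ S)
    {a : ℝ} (ha : a ∈ Icc 0 h) (hga : MDifferentiableWithinAt J 𝓘(ℝ, E).tangent (y a) S p₀)
    {X : TangentSpace J p₀} (hX : X ∈ tangentSubspace J S p₀) :
    ContMDiffOn 𝓘(ℝ, ℝ) 𝓘(ℝ, E).tangent ∞
      (fun t : ℝ => (⟨(y t p₀).proj, baseVariation J S y p₀ X t⟩ : TangentBundle 𝓘(ℝ, E) Q))
      (Icc 0 h) := by
  intro x hx
  obtain ⟨δ, hδ, hloc⟩ := hy.exists_local_variation (J := J) hL hD hsys hp₀ hx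
  exact (hloc x hx (by simpa using hδ)
    (hy.hasVariationFormula hL hD hsys hp₀ ha hx hga).1).1 X hX

theorem hasMFDerivWithinAt_proj_comp {g : N → TangentBundle 𝓘(ℝ, E) Q}
    (hg : MDifferentiableWithinAt J 𝓘(ℝ, E).tangent g S p₀) :
    HasMFDerivWithinAt J 𝓘(ℝ, E) (fun p => (g p).proj) S p₀
      ((tangentProj (g p₀)).comp (mfderivWithin J 𝓘(ℝ, E).tangent g S p₀)) :=
  HasMFDerivAt.comp_hasMFDerivWithinAt (I' := 𝓘(ℝ, E).tangent) p₀
    (Bundle.mdifferentiableAt_proj _).hasMFDerivAt hg.hasMFDerivWithinAt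

end GlobalVariation

/-! ### The family parametrised by the discrete constraint submanifold -/

section DiscreteLagrangian

variable {E : Type*} [NormedAddCommGroup E] [NormedSpace ℝ E]
  {Q : Type*} [TopologicalSpace Q] [ChartedSpace E Q] [IsManifold 𝓘(ℝ, E) ∞ Q]
  {L : TangentBundle 𝓘(ℝ, E) Q → ℝ} {D : (q : Q) → Submodule ℝ (TangentSpace 𝓘(ℝ, E) q)}
  {h : ℝ} {U : Set (TangentBundle 𝓘(ℝ, E) Q)} {p : Q × Q}

theorem retractionMinus_spec (hp : p ∈ discreteConstraint L D h U) :
    retractionMinus L D h U p ∈ U ∧ nhExp L D h (retractionMinus L D h U p) = p := by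
  have hex : ∃ v ∈ U, nhExp L D h v = p := hp
  rw [retractionMinus, dif_pos hex]
  exact hex.choose_spec

variable [FiniteDimensional ℝ E] [T2Space Q]

theorem isTrajectory_connecting
    (hL : ContMDiff 𝓘(ℝ, E).tangent 𝓘(ℝ, ℝ) ∞ L) (hD : IsSmoothDistribution D)
    (hsys : IsRegularSystem L D) (hh : 0 ≤ h) (hU : IsEmbeddingDomain L D h U)
    (hp : p ∈ discreteConstraint L D h U) :
    IsTrajectory L D h (retractionMinus L D h U p) (fun t => connecting L D h U t p) :=
  isTrajectory_flow hL hD hsys hh (hU.subset_domain (retractionMinus_spec hp).1)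

theorem isTrajectoryFamily_connecting
    (hL : ContMDiff 𝓘(ℝ, E).tangent 𝓘(ℝ, ℝ) ∞ L) (hD : IsSmoothDistribution D)
    (hsys : IsRegularSystem L D) (hh : 0 ≤ h) (hU : IsEmbeddingDomain L D h U) :
    IsTrajectoryFamily L D h (discreteConstraint L D h U) (connecting L D h U) where
  mem _ hp := (isTrajectory_connecting hL hD hsys hh hU hp).2.1
  isMIntegralCurveOn _ hp := (isTrajectory_connecting hL hD hsys hh hU hp).2.2

/-- At time `0` the family is the retraction, smooth because the exponential map is an embedding.
This starts the propagation in time. -/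
theorem mdifferentiableWithinAt_connecting_zero
    (hL : ContMDiff 𝓘(ℝ, E).tangent 𝓘(ℝ, ℝ) ∞ L) (hD : IsSmoothDistribution D)
    (hsys : IsRegularSystem L D) (hh : 0 ≤ h) (hU : IsEmbeddingDomain L D h U)
    (hp : p ∈ discreteConstraint L D h U) :
    MDifferentiableWithinAt (𝓘(ℝ, E).prod 𝓘(ℝ, E)) 𝓘(ℝ, E).tangent (connecting L D h U 0)
      (discreteConstraint L D h U) p :=
  ((hU.smooth_inverse p hp).mdifferentiableWithinAt (by simp)).congr
    (fun _ hq => (isTrajectory_connecting hL hD hsys hh hU hq).1)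
    (isTrajectory_connecting hL hD hsys hh hU hp).1

end DiscreteLagrangian

end Nonholonomic

end

/-! ### The differential of the exact discrete Lagrangian -/

theorem proposition6p2
    {E : Type*} [NormedAddCommGroup E] [NormedSpace ℝ E] [FiniteDimensional ℝ E]
    {Q : Type*} [TopologicalSpace Q] [T2Space Q] [ChartedSpace E Q] [IsManifold 𝓘(ℝ, E) ∞ Q]
    (L : TangentBundle 𝓘(ℝ, E) Q → ℝ) (hL : ContMDiff 𝓘(ℝ, E).tangent 𝓘(ℝ, ℝ) ∞ L)
    (hreg : Nonholonomic.IsRegularLagrangian L)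
    (D : (q : Q) → Submodule ℝ (TangentSpace 𝓘(ℝ, E) q))
    (hD : Nonholonomic.IsSmoothDistribution D)
    (hsys : Nonholonomic.IsRegularSystem L D)
    (h : ℝ) (hh : 0 < h)
    (U : Set (TangentBundle 𝓘(ℝ, E) Q)) (hU : Nonholonomic.IsEmbeddingDomain L D h U)
    (q₀ q₁ : Q) (hq : (q₀, q₁) ∈ Nonholonomic.discreteConstraint L D h U) :
    -- the integral defining the discrete Lagrangian exists
    IntervalIntegrable (fun t => L (Nonholonomic.connecting L D h U t (q₀, q₁))) volume 0 h ∧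
    -- the discrete Lagrangian is differentiable on the constraint submanifold
    MDifferentiableWithinAt (𝓘(ℝ, E).prod 𝓘(ℝ, E)) 𝓘(ℝ, ℝ)
      (Nonholonomic.discreteLagrangian L D h U)
      (Nonholonomic.discreteConstraint L D h U) (q₀, q₁) ∧
    -- so are the maps whose tangent maps define the variation field
    (∀ t ∈ Icc 0 h, MDifferentiableWithinAt (𝓘(ℝ, E).prod 𝓘(ℝ, E)) 𝓘(ℝ, E)
      (Nonholonomic.connectingBase L D h U t)
      (Nonholonomic.discreteConstraint L D h U) (q₀, q₁)) ∧
    ∀ (X₀ : TangentSpace 𝓘(ℝ, E) q₀) (X₁ : TangentSpace 𝓘(ℝ, E) q₁),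
      ((X₀, X₁) : TangentSpace (𝓘(ℝ, E).prod 𝓘(ℝ, E)) (q₀, q₁)) ∈
        Nonholonomic.tangentSubspace (𝓘(ℝ, E).prod 𝓘(ℝ, E))
          (Nonholonomic.discreteConstraint L D h U) (q₀, q₁) →
      -- the variation field is a smooth curve in `TQ`
      ContMDiffOn 𝓘(ℝ, ℝ) 𝓘(ℝ, E).tangent ∞
        (fun t : ℝ => (⟨(Nonholonomic.connecting L D h U t (q₀, q₁)).proj,
          Nonholonomic.variationField L D h U (q₀, q₁) (X₀, X₁) t⟩ : TangentBundle 𝓘(ℝ, E) Q))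
        (Icc 0 h) ∧
      -- the integral defining the one-form `β_nh` exists
      IntervalIntegrable (fun t =>
        Nonholonomic.nonholonomicForce L D (Nonholonomic.connecting L D h U t (q₀, q₁))
          (Nonholonomic.variationField L D h U (q₀, q₁) (X₀, X₁) t)) volume 0 h ∧
      -- the formula for the differential
      mfderivWithin (𝓘(ℝ, E).prod 𝓘(ℝ, E)) 𝓘(ℝ, ℝ) (Nonholonomic.discreteLagrangian L D h U)
          (Nonholonomic.discreteConstraint L D h U) (q₀, q₁) (X₀, X₁) =
        - Nonholonomic.betaForm L D h U (q₀, q₁) (X₀, X₁)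
        + Nonholonomic.legendre L (Nonholonomic.retractionPlus L D h U (q₀, q₁)) X₁
        - Nonholonomic.legendre L (Nonholonomic.retractionMinus L D h U (q₀, q₁)) X₀ := by
  open Nonholonomic in
  let S := discreteConstraint L D h U
  let y := connecting L D h U
  let I₂ := 𝓘(ℝ, E).prod 𝓘(ℝ, E)
  have hy : IsTrajectoryFamily L D h S y := isTrajectoryFamily_connecting hL hD hsys hh.le hU
  have h0 : (0 : ℝ) ∈ Icc 0 h := left_mem_Icc.2 hh.le
  have h1 : h ∈ Icc 0 h := right_mem_Icc.2 hh.le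
  have hg0 : MDifferentiableWithinAt I₂ 𝓘(ℝ, E).tangent (y 0) S (q₀, q₁) :=
    mdifferentiableWithinAt_connecting_zero hL hD hsys hh.le hU hq
  have hg : ∀ t ∈ Icc 0 h, MDifferentiableWithinAt I₂ 𝓘(ℝ, E).tangent (y t) S (q₀, q₁) :=
    fun t ht => (hy.hasVariationFormula hL hD hsys hq h0 ht hg0).1
  obtain ⟨hdiff, hform⟩ := (hy.hasVariationFormula hL hD hsys hq h0 h1 hg0).2
  refine ⟨hy.intervalIntegrable hL hq h0 h1, hdiff,
    fun t ht => (hasMFDerivWithinAt_proj_comp (hg t ht)).mdifferentiableWithinAt,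
    fun X₀ X₁ hX => ?_⟩
  let X : E × E := (X₀, X₁)
  -- The derivative of the base curve and the projected derivative of the trajectory are both
  -- derivatives within `S`, so they agree on the tangent vector `X`, though possibly not elsewhere.
  have hvar : ∀ t ∈ Icc 0 h, variationField L D h U (q₀, q₁) X t =
      baseVariation I₂ S y (q₀, q₁) X t := fun t ht =>
    mfderivWithin_apply_eq_of_mem_tangentSubspace (hasMFDerivWithinAt_proj_comp (hg t ht)) hX
  have huIcc : ∀ t ∈ uIcc 0 h, t ∈ Icc 0 h := fun t ht => by rwa [uIcc_of_le hh.le] at ht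
  have hforce : ∀ t ∈ uIcc 0 h,
      nonholonomicForce L D (y t (q₀, q₁)) (baseVariation I₂ S y (q₀, q₁) X t) =
        nonholonomicForce L D (y t (q₀, q₁)) (variationField L D h U (q₀, q₁) X t) :=
    fun t ht => congrArg _ (hvar t (huIcc t ht)).symm
  obtain ⟨hint, hformula⟩ := hform X hX
  refine ⟨?_, hint.congr fun t ht => hforce t (uIoc_subset_uIcc ht), ?_⟩
  · refine (hy.contMDiffOn_baseVariation hL hD hsys hq h0 hg0 hX).congr fun t ht => ?_
    exact congrArg (Bundle.TotalSpace.mk (y t (q₀, q₁)).proj) (hvar t ht)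
  -- On `S` the base points at times `0` and `h` are the coordinate projections, because the
  -- retraction inverts the exponential map. Differentiating them identifies the end values of the
  -- variation field.
  · have hbase0 : ∀ p ∈ S, (y 0 p).proj = p.1 := fun p hp => by
      have h2 : y 0 p = retractionMinus L D h U p :=
        (isTrajectory_connecting hL hD hsys hh.le hU hp).1
      rw [h2]
      exact congrArg Prod.fst (retractionMinus_spec hp).2
    have hbase1 : ∀ p ∈ S, (y h p).proj = p.2 := fun p hp =>
      congrArg Prod.snd (retractionMinus_spec hp).2
    have hX0 : baseVariation I₂ S y (q₀, q₁) X 0 = X₀ := by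
      have h2 : HasMFDerivWithinAt I₂ 𝓘(ℝ, E) (fun p : Q × Q => p.1) S (q₀, q₁)
          (ContinuousLinearMap.fst ℝ E E) := hasMFDerivWithinAt_fst _ _
      have h3 := h2.congr_mono hbase0 (hbase0 _ hq) Subset.rfl
      exact (mfderivWithin_apply_eq_of_mem_tangentSubspace
        (hasMFDerivWithinAt_proj_comp hg0) hX).symm.trans
        (mfderivWithin_apply_eq_of_mem_tangentSubspace h3 hX)
    have hX1 : baseVariation I₂ S y (q₀, q₁) X h = X₁ := by
      have h2 : HasMFDerivWithinAt I₂ 𝓘(ℝ, E) (fun p : Q × Q => p.2) S (q₀, q₁)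
          (ContinuousLinearMap.snd ℝ E E) := hasMFDerivWithinAt_snd _ _
      have h3 := h2.congr_mono hbase1 (hbase1 _ hq) Subset.rfl
      exact (mfderivWithin_apply_eq_of_mem_tangentSubspace
        (hasMFDerivWithinAt_proj_comp (hg h h1)) hX).symm.trans
        (mfderivWithin_apply_eq_of_mem_tangentSubspace h3 hX)
    let leg : TangentBundle 𝓘(ℝ, E) Q → E →L[ℝ] ℝ := legendre L
    have hy0 : y 0 (q₀, q₁) = retractionMinus L D h U (q₀, q₁) :=
      (isTrajectory_connecting hL hD hsys hh.le hU hq).1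
    have hl0 : leg (y 0 (q₀, q₁)) (baseVariation I₂ S y (q₀, q₁) X 0) =
        leg (retractionMinus L D h U (q₀, q₁)) X₀ := by
      rw [hy0]; exact congrArg (leg (retractionMinus L D h U (q₀, q₁))) hX0
    have hl1 : leg (y h (q₀, q₁)) (baseVariation I₂ S y (q₀, q₁) X h) =
        leg (retractionPlus L D h U (q₀, q₁)) X₁ := congrArg (leg (y h (q₀, q₁))) hX1
    have hβ : ∫ t in (0 : ℝ)..h,
        nonholonomicForce L D (y t (q₀, q₁)) (baseVariation I₂ S y (q₀, q₁) X t) =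
          betaForm L D h U (q₀, q₁) X := intervalIntegral.integral_congr hforce
    have hmain : mfderivWithin I₂ 𝓘(ℝ, ℝ) (discreteLagrangian L D h U) S (q₀, q₁) X =
        -(∫ t in (0 : ℝ)..h,
          nonholonomicForce L D (y t (q₀, q₁)) (baseVariation I₂ S y (q₀, q₁) X t)) +
          leg (y h (q₀, q₁)) (baseVariation I₂ S y (q₀, q₁) X h) -
          leg (y 0 (q₀, q₁)) (baseVariation I₂ S y (q₀, q₁) X 0) := hformula
    rw [hβ, hl0, hl1] at hmain
    exact hmain
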